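/- Let $M$ be a smooth manifold and $(\mathcal A,\rho,[\,,])$ a Lie algebroid over $M$, i.e. a smooth vector bundle $\mathcal A\to M$ of finite rank with a Lie bracket on $\Gamma(\mathcal A)$ and a bundle map $\rho:\mathcal A\to TM$ such that $\rho[s,t]=[\rho s,\rho t]$ and $[s,ft]=f[s,t]+(\rho(s)f)\,t$. Let $(\omega,J,g)$ be a compatible triple on $\mathcal A$: $\omega$ is a nondegenerate $2$-form on $\mathcal A$ with $d_{\mathcal A}\omega=0$, $J$ is a bundle endomorphism with $J^2=-\mathrm{id}$, $g$ is a Riemannian metric on the bundle $\mathcal A$, and $g(Ja,Jb)=g(a,b)$, $\omega(a,b)=g(a,Jb)$. For $p\in M$ put $$L_p=\ker\rho_p,\quad L^1_p=L_p\cap L_p^{\omega},\quad L^2_p=(L^1_p)^{\perp_g}\cap L_p,\quad E^1_p=J(L^1_p),\quad E^2_p=(L_p+E^1_p)^{\omega},$$ where $S^\omega$ denotes the $\omega$-complement of $S$. Then $\mathcal A_p=(E^1_p\oplus E^2_p)\oplus(L^1_p\oplus L^2_p)$ with $L^1_p\oplus L^2_p=L_p$. Let $N$ be a leaf of the characteristic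 foliation of $\mathcal A$, that is, a maximal connected (injectively immersed) integral submanifold of the generalized distribution $\rho(\mathcal A)\subseteq TM$. (a) The restricted bundle $\mathcal A_N$ has exactly one Lie algebroid structure $(\rho_N,[\,,]_N)$ over $N$ whose anchor is $\rho$ with values in $TN$ and for which $[s|_N,t|_N]_N=[s,t]|_N$ for all $s,t\in\Gamma(\mathcal A)$; the restriction $\omega_N$ of $\omega$ is a symplectic form on it. (b) Each $f\in C^\infty(N)$ has exactly one Hamiltonian section $a_f\in\Gamma(\mathcal A_N)$, defined by $df(\rho_N(b))=\omega_N(a_f,b)$ for all $b$, and there is exactly one Poisson structure (bivector field) $\pi$ on $N$ with $\pi(df,dh)=\{f,h\}=\omega_N(a_f,a_h)$ for all $f,h\in C^\infty(N)$. With $\pi^\sharp(\alpha)=\pi(\alpha,\cdot)$ and $[\alpha,\beta]_\pi=\mathcal L_{\pi^\sharp\alpha}\beta-\mathcal L_{\pi^\sharp\beta}\alpha-d(\pi(\alpha,\beta))$, $(T^*N,\pi^\sharp,[\,,]_\pi)$ is a Lie algebroid over $N$. (c) For each $x\in N$ let $\lambda_x:T_xN\to\mathcal A_x$ be the unique linear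 map with $\rho_N\circ\lambda_x=\mathrm{id}$ and values in $E^1_x+E^2_x$. Then $(E^2+L^1)_N$ is a smooth vector subbundle of $\mathcal A_N$ whose sections are closed under $[\,,]_N$, hence a Lie subalgebroid of $\mathcal A_N$, and $$\psi:(E^2+L^1)_N\to T^*N,\qquad \psi(a)=-\lambda^*(i_a\omega)=-\omega(a,\lambda(\cdot)),$$ is an isomorphism of Lie algebroids over $N$ from $(E^2+L^1)_N$ onto $(T^*N,\pi^\sharp,[\,,]_\pi)$: a smooth vector bundle isomorphism over $\mathrm{id}_N$ with $\pi^\sharp\circ\psi=\rho_N$ and $\psi([a,b]_N)=[\psi(a),\psi(b)]_\pi$ for all smooth sections $a,b$ of $(E^2+L^1)_N$. -/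

import Mathlib

open Bundle VectorField Set Filter Topology
open scoped Manifold ContDiff

universe u v

noncomputable section

/-! ### Pullback bundles: fibrewise instances -/

instance pullbackFiberAddCommGroup {B B' : Type*} (f : B' → B) (V : B → Type*)
    [∀ x, AddCommGroup (V x)] (x : B') : AddCommGroup ((f *ᵖ V) x) :=
  inferInstanceAs (AddCommGroup (V (f x)))

instance pullbackFiberIsTopologicalAddGroup {B B' : Type*} (f : B' → B) (V : B → Type*)
    [∀ x, AddCommGroup (V x)] [∀ x, TopologicalSpace (V x)]
    [∀ x, IsTopologicalAddGroup (V x)] (x : B') : IsTopologicalAddGroup ((f *ᵖ V) x) :=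
  inferInstanceAs (IsTopologicalAddGroup (V (f x)))

instance pullbackFiberContinuousSMul {B B' : Type*} (f : B' → B) (V : B → Type*)
    [∀ x, AddCommGroup (V x)] [∀ x, Module ℝ (V x)] [∀ x, TopologicalSpace (V x)]
    [∀ x, ContinuousSMul ℝ (V x)] (x : B') : ContinuousSMul ℝ ((f *ᵖ V) x) :=
  inferInstanceAs (ContinuousSMul ℝ (V (f x)))

/-! ### Lie algebroids -/

section LieAlgebroid

variable (E : Type*) [NormedAddCommGroup E] [NormedSpace ℝ E]
  {M : Type*} [TopologicalSpace M] [ChartedSpace E M] [IsManifold 𝓘(ℝ, E) ∞ M]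
  (F : Type*) [NormedAddCommGroup F] [NormedSpace ℝ F]
  (V : M → Type*) [TopologicalSpace (TotalSpace F V)]
  [∀ x, AddCommGroup (V x)] [∀ x, Module ℝ (V x)] [∀ x, TopologicalSpace (V x)]
  [∀ x, IsTopologicalAddGroup (V x)] [∀ x, ContinuousSMul ℝ (V x)]
  [FiberBundle F V] [VectorBundle ℝ F V] [ContMDiffVectorBundle ∞ F V 𝓘(ℝ, E)]

/-- A Lie algebroid structure on the smooth vector bundle `V → M` (with model fibre `F`, over a
manifold modelled on `E`): an anchor `V → TM` and a Lie bracket on the smooth sections. -/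
structure LieAlgebroid where
  /-- The anchor, a smooth vector bundle map `V → TM` over the identity. -/
  anchor (x : M) : V x →L[ℝ] TangentSpace 𝓘(ℝ, E) x
  anchor_contMDiff : ContMDiff 𝓘(ℝ, E) (𝓘(ℝ, E).prod 𝓘(ℝ, F →L[ℝ] E)) ∞
    (fun x ↦ TotalSpace.mk' (F →L[ℝ] E) (E := fun x ↦ V x →L[ℝ] TangentSpace 𝓘(ℝ, E) x)
      x (anchor x))
  /-- The bracket of smooth sections. -/
  bracket : Cₛ^∞⟮𝓘(ℝ, E); F, V⟯ →ₗ[ℝ] Cₛ^∞⟮𝓘(ℝ, E); F, V⟯ →ₗ[ℝ] Cₛ^∞⟮𝓘(ℝ, E); F, V⟯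
  bracket_self (s : Cₛ^∞⟮𝓘(ℝ, E); F, V⟯) : bracket s s = 0
  jacobi (s t w : Cₛ^∞⟮𝓘(ℝ, E); F, V⟯) :
    bracket s (bracket t w) = bracket (bracket s t) w + bracket t (bracket s w)
  anchor_bracket (s t : Cₛ^∞⟮𝓘(ℝ, E); F, V⟯) (x : M) :
    anchor x (bracket s t x) =
      mlieBracket 𝓘(ℝ, E) (fun y ↦ anchor y (s y)) (fun y ↦ anchor y (t y)) x
  /-- `[s, f t] = f [s, t] + (ρ(s) f) t`, the section `f t` being called `ft`. -/
  leibniz (s t ft : Cₛ^∞⟮𝓘(ℝ, E); F, V⟯) (f : M → ℝ) (hf : ContMDiff 𝓘(ℝ, E) 𝓘(ℝ, ℝ) ∞ f)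
    (hft : ∀ x, ft x = f x • t x) (x : M) :
    bracket s ft x = f x • bracket s t x + mvfderiv 𝓘(ℝ, E) f x (anchor x (s x)) • t x

variable {E F V}

/-- A symplectic form on a Lie algebroid: a smooth, fibrewise alternating and nondegenerate
2-form whose Lie algebroid differential vanishes. -/
structure SymplecticForm (𝒜 : LieAlgebroid E F V) where
  form (x : M) : V x →L[ℝ] V x →L[ℝ] ℝ
  contMDiff : ContMDiff 𝓘(ℝ, E) (𝓘(ℝ, E).prod 𝓘(ℝ, F →L[ℝ] F →L[ℝ] ℝ)) ∞
    (fun x ↦ TotalSpace.mk' (F →L[ℝ] F →L[ℝ] ℝ) (E := fun x ↦ V x →L[ℝ] V x →L[ℝ] ℝ)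
      x (form x))
  alternating (x : M) (a : V x) : form x a a = 0
  nondegenerate (x : M) (a : V x) (h : ∀ b, form x a b = 0) : a = 0
  closed (s₀ s₁ s₂ : Cₛ^∞⟮𝓘(ℝ, E); F, V⟯) (x : M) :
    mvfderiv 𝓘(ℝ, E) (fun y ↦ form y (s₁ y) (s₂ y)) x (𝒜.anchor x (s₀ x))
      - mvfderiv 𝓘(ℝ, E) (fun y ↦ form y (s₀ y) (s₂ y)) x (𝒜.anchor x (s₁ x))
      + mvfderiv 𝓘(ℝ, E) (fun y ↦ form y (s₀ y) (s₁ y)) x (𝒜.anchor x (s₂ x))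
      - form x (𝒜.bracket s₀ s₁ x) (s₂ x) + form x (𝒜.bracket s₀ s₂ x) (s₁ x)
      - form x (𝒜.bracket s₁ s₂ x) (s₀ x) = 0

/-- A compatible triple `(ω, J, g)` on a Lie algebroid. -/
structure CompatibleTriple (𝒜 : LieAlgebroid E F V) where
  /-- The symplectic form `ω`. -/
  Ω : SymplecticForm 𝒜
  /-- The almost complex structure. -/
  J (x : M) : V x →L[ℝ] V x
  J_contMDiff : ContMDiff 𝓘(ℝ, E) (𝓘(ℝ, E).prod 𝓘(ℝ, F →L[ℝ] F)) ∞
    (fun x ↦ TotalSpace.mk' (F →L[ℝ] F) (E := fun x ↦ V x →L[ℝ] V x) x (J x))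
  J_J (x : M) (a : V x) : J x (J x a) = -a
  /-- The Riemannian metric on the bundle `V`. -/
  g : ContMDiffRiemannianMetric 𝓘(ℝ, E) ∞ F V
  g_J_J (x : M) (a b : V x) : g.inner x (J x a) (J x b) = g.inner x a b
  form_eq (x : M) (a b : V x) : Ω.form x a b = g.inner x a (J x b)

/-- The `ω`-complement `S^ω` of a subspace `S` of the fibre at `x`. -/
def SymplecticForm.compl {𝒜 : LieAlgebroid E F V} (Ω : SymplecticForm 𝒜) {x : M}
    (S : Submodule ℝ (V x)) : Submodule ℝ (V x) where
  carrier := {a | ∀ b ∈ S, Ω.form x a b = 0}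
  add_mem' := fun ha hb c hc ↦ by simp [ha c hc, hb c hc]
  zero_mem' := fun c _ ↦ by simp
  smul_mem' := fun r a ha c hc ↦ by simp [ha c hc]

/-- `L_x`, the kernel of the anchor at `x`. -/
def LieAlgebroid.isotropy (𝒜 : LieAlgebroid E F V) (x : M) : Submodule ℝ (V x) :=
  LinearMap.ker (𝒜.anchor x : V x →ₗ[ℝ] TangentSpace 𝓘(ℝ, E) x)

namespace CompatibleTriple

variable {𝒜 : LieAlgebroid E F V} (T : CompatibleTriple 𝒜) (x : M)

/-- `L¹ = L ∩ L^ω`. -/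
def L1 : Submodule ℝ (V x) := 𝒜.isotropy x ⊓ T.Ω.compl (𝒜.isotropy x)

/-- `L²`, the `g`-orthogonal complement of `L¹` inside `L`. -/
def L2 : Submodule ℝ (V x) where
  carrier := {a | a ∈ 𝒜.isotropy x ∧ ∀ b ∈ T.L1 x, T.g.inner x a b = 0}
  add_mem' := fun ha hb ↦ ⟨add_mem ha.1 hb.1, fun c hc ↦ by simp [ha.2 c hc, hb.2 c hc]⟩
  zero_mem' := ⟨zero_mem _, fun c _ ↦ by simp⟩
  smul_mem' := fun r a ha ↦ ⟨Submodule.smul_mem _ r ha.1, fun c hc ↦ by simp [ha.2 c hc]⟩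

/-- `E¹ = J(L¹)`. -/
def E1 : Submodule ℝ (V x) := (T.L1 x).map (T.J x : V x →ₗ[ℝ] V x)

/-- `E² = (L + E¹)^ω`. -/
def E2 : Submodule ℝ (V x) := T.Ω.compl (𝒜.isotropy x ⊔ T.E1 x)

/-- The direct sum decomposition `V_x = (E¹ ⊕ E²) ⊕ (L¹ ⊕ L²)` with `L¹ ⊕ L² = L`. -/
structure HasDecomposition : Prop where
  disjoint_E : Disjoint (T.E1 x) (T.E2 x)
  disjoint_L : Disjoint (T.L1 x) (T.L2 x)
  sup_L : T.L1 x ⊔ T.L2 x = 𝒜.isotropy x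
  isCompl : IsCompl (T.E1 x ⊔ T.E2 x) (𝒜.isotropy x)

end CompatibleTriple

/-- `S` is a smooth vector subbundle of `V`: near every point its fibres have a frame of smooth
sections of `V`. -/
def IsSmoothSubbundle (E : Type*) [NormedAddCommGroup E] [NormedSpace ℝ E]
    {M : Type*} [TopologicalSpace M] [ChartedSpace E M]
    (F : Type*) [NormedAddCommGroup F] [NormedSpace ℝ F]
    {V : M → Type*} [TopologicalSpace (TotalSpace F V)]
    [∀ x, AddCommGroup (V x)] [∀ x, Module ℝ (V x)] [∀ x, TopologicalSpace (V x)]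
    [FiberBundle F V] (S : ∀ x, Submodule ℝ (V x)) : Prop :=
  ∀ x₀ : M, ∃ (k : ℕ) (e : Fin k → Cₛ^∞⟮𝓘(ℝ, E); F, V⟯), ∀ᶠ x in 𝓝 x₀,
    LinearIndependent ℝ (fun i ↦ e i x) ∧ Submodule.span ℝ (range fun i ↦ e i x) = S x

/-- `S` is a Lie subalgebroid of `𝒜` over the same base; it is then itself a Lie algebroid with
the restricted anchor and bracket. -/
structure LieAlgebroid.IsSubalgebroid (𝒜 : LieAlgebroid E F V) (S : ∀ x, Submodule ℝ (V x)) :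
    Prop where
  isSmoothSubbundle : IsSmoothSubbundle E F S
  bracket_mem (s t : Cₛ^∞⟮𝓘(ℝ, E); F, V⟯) (hs : ∀ x, s x ∈ S x) (ht : ∀ x, t x ∈ S x) (x : M) :
    𝒜.bracket s t x ∈ S x

/-- The restriction of the fibrewise linear map `ψ` to the Lie subalgebroid `S` of `𝒜` is an
isomorphism of Lie algebroids over the identity of `M` from `S` onto `ℬ`: a fibrewise linear
bijection, smooth with smooth inverse (it matches the smooth local sections of `S` with those
of `W`), which respects the anchors and the brackets. -/
structure LieAlgebroid.IsIsoOnSubalgebroid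
    {G : Type*} [NormedAddCommGroup G] [NormedSpace ℝ G]
    {W : M → Type*} [TopologicalSpace (TotalSpace G W)]
    [∀ x, AddCommGroup (W x)] [∀ x, Module ℝ (W x)] [∀ x, TopologicalSpace (W x)]
    [∀ x, IsTopologicalAddGroup (W x)] [∀ x, ContinuousSMul ℝ (W x)]
    [FiberBundle G W] [VectorBundle ℝ G W] [ContMDiffVectorBundle ∞ G W 𝓘(ℝ, E)]
    (𝒜 : LieAlgebroid E F V) (S : ∀ x, Submodule ℝ (V x)) (ℬ : LieAlgebroid E G W)
    (ψ : ∀ x, V x →ₗ[ℝ] W x) : Prop where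
  isSubalgebroid : 𝒜.IsSubalgebroid S
  bijective (x : M) : Function.Bijective ((ψ x).domRestrict (S x))
  contMDiffOn_iff (U : Set M) (hU : IsOpen U) (s : ∀ x, V x) (hs : ∀ x ∈ U, s x ∈ S x) :
    ContMDiffOn 𝓘(ℝ, E) (𝓘(ℝ, E).prod 𝓘(ℝ, F)) ∞ (fun x ↦ TotalSpace.mk' F x (s x)) U ↔
      ContMDiffOn 𝓘(ℝ, E) (𝓘(ℝ, E).prod 𝓘(ℝ, G)) ∞ (fun x ↦ TotalSpace.mk' G x (ψ x (s x))) U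
  anchor_eq (x : M) (a : V x) (ha : a ∈ S x) : ℬ.anchor x (ψ x a) = 𝒜.anchor x a
  bracket_eq (s t : Cₛ^∞⟮𝓘(ℝ, E); F, V⟯) (hs : ∀ x, s x ∈ S x) (ht : ∀ x, t x ∈ S x)
    (α β : Cₛ^∞⟮𝓘(ℝ, E); G, W⟯) (hα : ∀ x, α x = ψ x (s x)) (hβ : ∀ x, β x = ψ x (t x))
    (x : M) : ℬ.bracket α β x = ψ x (𝒜.bracket s t x)

end LieAlgebroid

/-! ### Poisson structures and the cotangent Lie algebroid -/

section Poisson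

variable (E : Type*) [NormedAddCommGroup E] [NormedSpace ℝ E]
  (M : Type*) [TopologicalSpace M] [ChartedSpace E M] [IsManifold 𝓘(ℝ, E) ∞ M]

/-- A Poisson structure on `M`, given by its bivector field `π`; the Poisson bracket is
`{f, g} = π(df, dg)`. -/
structure PoissonStructure where
  bivector (x : M) : (TangentSpace 𝓘(ℝ, E) x →L[ℝ] ℝ) →L[ℝ] (TangentSpace 𝓘(ℝ, E) x →L[ℝ] ℝ) →L[ℝ] ℝ
  /-- Smoothness: `π(α, β)` is a smooth function for all smooth 1-forms `α`, `β`. -/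
  contMDiff
    (α β : Cₛ^∞⟮𝓘(ℝ, E); E →L[ℝ] ℝ, (fun x : M ↦ TangentSpace 𝓘(ℝ, E) x →L[ℝ] ℝ)⟯) :
    ContMDiff 𝓘(ℝ, E) 𝓘(ℝ, ℝ) ∞ (fun x ↦ bivector x (α x) (β x))
  alternating (x : M) (α : TangentSpace 𝓘(ℝ, E) x →L[ℝ] ℝ) : bivector x α α = 0
  jacobi (f g h : M → ℝ) (hf : ContMDiff 𝓘(ℝ, E) 𝓘(ℝ, ℝ) ∞ f)
    (hg : ContMDiff 𝓘(ℝ, E) 𝓘(ℝ, ℝ) ∞ g) (hh : ContMDiff 𝓘(ℝ, E) 𝓘(ℝ, ℝ) ∞ h) (x : M) :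
    bivector x (mvfderiv 𝓘(ℝ, E) f x) (mvfderiv 𝓘(ℝ, E)
        (fun y ↦ bivector y (mvfderiv 𝓘(ℝ, E) g y) (mvfderiv 𝓘(ℝ, E) h y)) x)
      + bivector x (mvfderiv 𝓘(ℝ, E) g x) (mvfderiv 𝓘(ℝ, E)
        (fun y ↦ bivector y (mvfderiv 𝓘(ℝ, E) h y) (mvfderiv 𝓘(ℝ, E) f y)) x)
      + bivector x (mvfderiv 𝓘(ℝ, E) h x) (mvfderiv 𝓘(ℝ, E)
        (fun y ↦ bivector y (mvfderiv 𝓘(ℝ, E) f y) (mvfderiv 𝓘(ℝ, E) g y)) x) = 0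

variable {E M}

/-- `(ℒ_Y β)(X) = Y(β(X)) - β([Y, X])` at `x`, for vector fields `X`, `Y` and a 1-form `β`. -/
def lieDerivOneForm (Y : ∀ x : M, TangentSpace 𝓘(ℝ, E) x)
    (β : ∀ x : M, TangentSpace 𝓘(ℝ, E) x →L[ℝ] ℝ) (X : ∀ x : M, TangentSpace 𝓘(ℝ, E) x)
    (x : M) : ℝ :=
  mvfderiv 𝓘(ℝ, E) (fun y ↦ β y (X y)) x (Y x) - β x (mlieBracket 𝓘(ℝ, E) Y X x)

/-- `𝒞` is the cotangent Lie algebroid `(T*M, π^♯, [ , ]_π)` of the Poisson structure `π`, where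
`π^♯ α = π(α, ·)` and `[α, β]_π = ℒ_{π^♯ α} β - ℒ_{π^♯ β} α - d(π(α, β))`. -/
structure LieAlgebroid.IsCotangent
    (𝒞 : LieAlgebroid E (E →L[ℝ] ℝ) (fun x : M ↦ TangentSpace 𝓘(ℝ, E) x →L[ℝ] ℝ))
    (P : PoissonStructure E M) : Prop where
  anchor_eq (x : M) (α β : TangentSpace 𝓘(ℝ, E) x →L[ℝ] ℝ) : β (𝒞.anchor x α) = P.bivector x α β
  bracket_eq
    (α β : Cₛ^∞⟮𝓘(ℝ, E); E →L[ℝ] ℝ, (fun x : M ↦ TangentSpace 𝓘(ℝ, E) x →L[ℝ] ℝ)⟯)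
    (X : Cₛ^∞⟮𝓘(ℝ, E); E, (TangentSpace 𝓘(ℝ, E) : M → Type _)⟯) (x : M) :
    𝒞.bracket α β x (X x) =
      lieDerivOneForm (fun y ↦ 𝒞.anchor y (α y)) β X x
        - lieDerivOneForm (fun y ↦ 𝒞.anchor y (β y)) α X x
        - mvfderiv 𝓘(ℝ, E) (fun y ↦ P.bivector y (α y) (β y)) x (X x)

variable {F : Type*} [NormedAddCommGroup F] [NormedSpace ℝ F]
  {V : M → Type*} [TopologicalSpace (TotalSpace F V)]
  [∀ x, AddCommGroup (V x)] [∀ x, Module ℝ (V x)] [∀ x, TopologicalSpace (V x)]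
  [∀ x, IsTopologicalAddGroup (V x)] [∀ x, ContinuousSMul ℝ (V x)]
  [FiberBundle F V] [VectorBundle ℝ F V] [ContMDiffVectorBundle ∞ F V 𝓘(ℝ, E)]

/-- `s` is a Hamiltonian section of `f`: `d_𝒜 f (b) = ω(s, b)` for all `b`, where
`d_𝒜 f (b) = df(ρ(b))`. -/
def SymplecticForm.IsHamiltonian {𝒜 : LieAlgebroid E F V} (Ω : SymplecticForm 𝒜) (f : M → ℝ)
    (s : Cₛ^∞⟮𝓘(ℝ, E); F, V⟯) : Prop :=
  ∀ (x : M) (b : V x), mvfderiv 𝓘(ℝ, E) f x (𝒜.anchor x b) = Ω.form x (s x) b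

/-- `P` is the Poisson structure on the base induced by the symplectic Lie algebroid `(𝒜, ω)`:
every smooth function has exactly one Hamiltonian section, and `{f, g} = ω(a_f, a_g)`. -/
structure PoissonStructure.IsInducedBy (P : PoissonStructure E M) {𝒜 : LieAlgebroid E F V}
    (Ω : SymplecticForm 𝒜) : Prop where
  existsUnique_hamiltonian (f : M → ℝ) (hf : ContMDiff 𝓘(ℝ, E) 𝓘(ℝ, ℝ) ∞ f) :
    ∃! s : Cₛ^∞⟮𝓘(ℝ, E); F, V⟯, Ω.IsHamiltonian f s
  bracket_eq (f g : M → ℝ) (hf : ContMDiff 𝓘(ℝ, E) 𝓘(ℝ, ℝ) ∞ f)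
    (hg : ContMDiff 𝓘(ℝ, E) 𝓘(ℝ, ℝ) ∞ g) (a b : Cₛ^∞⟮𝓘(ℝ, E); F, V⟯)
    (ha : Ω.IsHamiltonian f a) (hb : Ω.IsHamiltonian g b) (x : M) :
    P.bivector x (mvfderiv 𝓘(ℝ, E) f x) (mvfderiv 𝓘(ℝ, E) g x) = Ω.form x (a x) (b x)

end Poisson

/-! ### Leaves of the characteristic foliation and restriction to a leaf -/

section Leaf

variable {E : Type*} [NormedAddCommGroup E] [NormedSpace ℝ E]
  {M : Type u} [TopologicalSpace M] [ChartedSpace E M] [IsManifold 𝓘(ℝ, E) ∞ M]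
  {F : Type*} [NormedAddCommGroup F] [NormedSpace ℝ F]
  {V : M → Type*} [TopologicalSpace (TotalSpace F V)]
  [∀ x, AddCommGroup (V x)] [∀ x, Module ℝ (V x)] [∀ x, TopologicalSpace (V x)]
  [∀ x, IsTopologicalAddGroup (V x)] [∀ x, ContinuousSMul ℝ (V x)]
  [FiberBundle F V] [VectorBundle ℝ F V] [ContMDiffVectorBundle ∞ F V 𝓘(ℝ, E)]
  {E' : Type*} [NormedAddCommGroup E'] [NormedSpace ℝ E']
  {N : Type v} [TopologicalSpace N] [ChartedSpace E' N] [IsManifold 𝓘(ℝ, E') ∞ N]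

/-- The injectively immersed manifold `ι : N → M` is an integral submanifold of the generalized
distribution `ρ(V) ⊆ TM`. -/
structure LieAlgebroid.IsIntegralSubmanifold (𝒜 : LieAlgebroid E F V)
    (ι : C^∞⟮𝓘(ℝ, E'), N; 𝓘(ℝ, E), M⟯) : Prop where
  injective : Function.Injective ι
  immersion (x : N) : Function.Injective (mfderiv 𝓘(ℝ, E') 𝓘(ℝ, E) ι x)
  tangent (x : N) :
    range (mfderiv 𝓘(ℝ, E') 𝓘(ℝ, E) ι x) = range (𝒜.anchor (ι x))

/-- `ι : N → M` is (the inclusion of) a leaf of the characteristic foliation of `𝒜`: a maximal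
connected integral submanifold of `ρ(V)`. A competitor meeting `N` has the same dimension as `N`
and injects into `M`, so it suffices to let it be modelled on the same space `E'` and to live in
the universe of `M`. -/
structure LieAlgebroid.IsLeaf (𝒜 : LieAlgebroid E F V)
    (ι : C^∞⟮𝓘(ℝ, E'), N; 𝓘(ℝ, E), M⟯) : Prop where
  connected : ConnectedSpace N
  integral : 𝒜.IsIntegralSubmanifold ι
  maximal (N' : Type u) [TopologicalSpace N'] [ChartedSpace E' N'] [IsManifold 𝓘(ℝ, E') ∞ N']
    [T2Space N'] [SecondCountableTopology N'] [ConnectedSpace N']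
    (j : C^∞⟮𝓘(ℝ, E'), N'; 𝓘(ℝ, E), M⟯) (hj : 𝒜.IsIntegralSubmanifold j)
    (hmeet : (range j ∩ range ι).Nonempty) : range j ⊆ range ι

/-- `𝒜N` is the restriction of the Lie algebroid `𝒜` to `N`, a Lie algebroid structure on the
restricted (pulled back) vector bundle: its anchor is that of `𝒜`, viewed in `TN ⊆ TM`, and the
bracket of the restrictions of two sections is the restriction of their bracket. -/
structure LieAlgebroid.IsRestriction (𝒜 : LieAlgebroid E F V)
    (ι : C^∞⟮𝓘(ℝ, E'), N; 𝓘(ℝ, E), M⟯) (𝒜N : LieAlgebroid E' F (ι *ᵖ V)) : Prop where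
  anchor_eq (x : N) (a : (ι *ᵖ V) x) :
    mfderiv 𝓘(ℝ, E') 𝓘(ℝ, E) ι x (𝒜N.anchor x a) = 𝒜.anchor (ι x) a
  bracket_eq (s t : Cₛ^∞⟮𝓘(ℝ, E); F, V⟯) (s' t' : Cₛ^∞⟮𝓘(ℝ, E'); F, (ι *ᵖ V)⟯)
    (hs : ∀ x, s' x = s (ι x)) (ht : ∀ x, t' x = t (ι x)) (x : N) :
    𝒜N.bracket s' t' x = 𝒜.bracket s t (ι x)

namespace CompatibleTriple

variable {𝒜 : LieAlgebroid E F V} (T : CompatibleTriple 𝒜) (ι : C^∞⟮𝓘(ℝ, E'), N; 𝓘(ℝ, E), M⟯)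

/-- The fibres of `(E² + L¹)_N`. -/
def restrictedE2L1 (x : N) : Submodule ℝ ((ι *ᵖ V) x) := T.E2 (ι x) ⊔ T.L1 (ι x)

/-- `lam` is the fibrewise linear splitting `TN → 𝒜_N` of the anchor of `𝒜_N` that belongs to the
decomposition `𝒜_N = (E¹ + E²)_N ⊕ L_N`. -/
def IsSplitting (𝒜N : LieAlgebroid E' F (ι *ᵖ V))
    (lam : ∀ x : N, TangentSpace 𝓘(ℝ, E') x →L[ℝ] (ι *ᵖ V) x) : Prop :=
  ∀ (x : N) (v : TangentSpace 𝓘(ℝ, E') x),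
    lam x v ∈ T.E1 (ι x) ⊔ T.E2 (ι x) ∧ 𝒜N.anchor x (lam x v) = v

end CompatibleTriple

/-- The map `a ↦ -λ^*(i_a ω)` from the fibre at `x` to the cotangent space of the base. -/
def SymplecticForm.negPullContraction {𝒜 : LieAlgebroid E F V} (Ω : SymplecticForm 𝒜)
    (lam : ∀ x : M, TangentSpace 𝓘(ℝ, E) x →L[ℝ] V x) (x : M) :
    V x →ₗ[ℝ] (TangentSpace 𝓘(ℝ, E) x →L[ℝ] ℝ) where
  toFun a := -((Ω.form x a).comp (lam x))
  map_add' a b := by ext v; simp [add_comm]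
  map_smul' r a := by ext v; simp

end Leaf

end

/-!
Let `♯ : T*N → 𝒜_N` be defined by `ω(♯α, b) = -α(ρ b)`. Three facts carry the proof.

* A section of `𝒜_N` acts by the bracket as a derivation on the sections pulled back from `M`, and
  a derivation on these extends uniquely to all sections of `𝒜_N` once its symbol is tangent to `N`.
  This gives `[ , ]_N` and its uniqueness. The Jacobi identity and `dω_N = 0` hold on pulled back
  sections, and both sides are determined by these.
* The Hamiltonian section of `f` is `-♯(df)`, and `π(α, β) = ω(♯α, ♯β)`. On Hamiltonian sections
  `dω_N = 0` reads as the Jacobi identity for `π`; on sections `♯α`, `♯β`, `c` it reads as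
  `[♯α, ♯β] = ♯[α, β]_π`.
* By a count of dimensions `E² + L¹ = L^ω`. Since `ρ_N` is onto `TN`, `♯` is injective with image
  `L^ω`, and `ψ` is its inverse. So `L^ω` is a subalgebroid, and the Lie algebroid structure of
  `T*N` is the one transported from it by `ψ`.
-/

noncomputable section

/-! ### Smoothness of sections -/

section Smoothness

variable {𝕜 : Type*} [NontriviallyNormedField 𝕜] [CompleteSpace 𝕜]
  {E : Type*} [NormedAddCommGroup E] [NormedSpace 𝕜 E]
  {H : Type*} [TopologicalSpace H] {I : ModelWithCorners 𝕜 E H}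
  {M : Type*} [TopologicalSpace M] [ChartedSpace H M]
  {F : Type*} [NormedAddCommGroup F] [NormedSpace 𝕜 F] [FiniteDimensional 𝕜 F]
  {G : Type*} [NormedAddCommGroup G] [NormedSpace 𝕜 G]
  {n : WithTop ℕ∞} {A : M → F →L[𝕜] G} {x₀ : M}

theorem contMDiffAt_clm_of_apply (h : ∀ v, CMDiffAt n (fun x ↦ A x v) x₀) : CMDiffAt n A x₀ := by
  let e := ((ContinuousLinearEquiv.ofFinrankEq (Module.finrank_fin_fun 𝕜).symm :
    F ≃L[𝕜] (Fin (Module.finrank 𝕜 F) → 𝕜)).arrowCongr (.refl 𝕜 G)).trans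
      (ContinuousLinearEquiv.piRing _)
  rw [← Function.id_comp A, ← e.symm_comp_self]
  exact e.symm.contDiff.contMDiff.contMDiffAt.comp x₀ (contMDiffAt_pi_space.2 fun _ ↦ h _)

/- `u = (B A)⁻¹ B (A u)` for a left inverse `B` of `A x₀`, since `B A` stays invertible near
`x₀`. -/
theorem contMDiffAt_of_injective_clm_apply [FiniteDimensional 𝕜 G] {u : M → F}
    (hA : CMDiffAt n A x₀) (hinj : Function.Injective (A x₀))
    (h : CMDiffAt n (fun x ↦ A x (u x)) x₀) : CMDiffAt n u x₀ := by
  have := FiniteDimensional.complete 𝕜 F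
  obtain ⟨B₀, hB₀⟩ := (A x₀ : F →ₗ[𝕜] G).exists_leftInverse_of_injective
    (LinearMap.ker_eq_bot.2 hinj)
  let B : G →L[𝕜] F := LinearMap.toContinuousLinearMap B₀
  have hBA : B.comp (A x₀) = .id 𝕜 F := by ext v; exact LinearMap.congr_fun hB₀ v
  have hinv : (B.comp (A x₀)).IsInvertible := hBA ▸ ⟨.refl 𝕜 F, rfl⟩
  have hcomp : CMDiffAt n (fun x ↦ B.comp (A x)) x₀ := contMDiffAt_const.clm_comp hA
  have hinverse : CMDiffAt n (fun x ↦ (B.comp (A x)).inverse) x₀ :=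
    hinv.contDiffAt_map_inverse.contMDiffAt.comp x₀ hcomp
  have hev : ∀ᶠ x in 𝓝 x₀, (B.comp (A x)).IsInvertible := by
    obtain ⟨e, he⟩ := hinv
    exact hcomp.continuousAt (he ▸ ContinuousLinearEquiv.nhds e)
  refine (hinverse.clm_apply (contMDiffAt_const.clm_apply h :
    CMDiffAt n (fun x ↦ B (A x (u x))) x₀)).congr_of_eventuallyEq ?_
  filter_upwards [hev] with x hx
  exact (hx.inverse_apply_eq.2 rfl).symm

end Smoothness

section Bundles

variable {𝕜 : Type*} [NontriviallyNormedField 𝕜]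
  {E : Type*} [NormedAddCommGroup E] [NormedSpace 𝕜 E]
  {H : Type*} [TopologicalSpace H] {I : ModelWithCorners 𝕜 E H}
  {M : Type*} [TopologicalSpace M] [ChartedSpace H M]
  {E' : Type*} [NormedAddCommGroup E'] [NormedSpace 𝕜 E']
  {H' : Type*} [TopologicalSpace H'] {I' : ModelWithCorners 𝕜 E' H'}
  {M' : Type*} [TopologicalSpace M'] [ChartedSpace H' M']
  {G : Type*} [NormedAddCommGroup G] [NormedSpace 𝕜 G] {n : WithTop ℕ∞} {x₀ : M}

theorem contMDiffAt_trivial_iff {f : M → G} {b : M → M'} (hb : CMDiffAt n b x₀) :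
    CMDiffAt n (fun x ↦ TotalSpace.mk' G (E := fun _ : M' ↦ G) (b x) (f x)) x₀ ↔
      CMDiffAt n f x₀ := by
  rw [contMDiffAt_totalSpace]
  exact and_iff_right hb

variable {F : Type*} [NormedAddCommGroup F] [NormedSpace 𝕜 F]
  {V : M → Type*} [TopologicalSpace (TotalSpace F V)]
  [∀ x, AddCommGroup (V x)] [∀ x, Module 𝕜 (V x)] [∀ x, TopologicalSpace (V x)]
  [FiberBundle F V] [VectorBundle 𝕜 F V]

/- In local trivializations this is `contMDiffAt_of_injective_clm_apply`. -/
theorem contMDiffAt_section_of_injective_inCoordinates [CompleteSpace 𝕜]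
    [FiniteDimensional 𝕜 F] [FiniteDimensional 𝕜 G]
    {W : M' → Type*} [TopologicalSpace (TotalSpace G W)]
    [∀ x, AddCommGroup (W x)] [∀ x, Module 𝕜 (W x)] [∀ x, TopologicalSpace (W x)]
    [FiberBundle G W] [VectorBundle 𝕜 G W]
    {b : M → M'} {φ : ∀ x, V x →L[𝕜] W (b x)} {s : ∀ x, V x}
    (hφ : CMDiffAt n
      (fun x ↦ ContinuousLinearMap.inCoordinates F V G W x₀ x (b x₀) (b x) (φ x)) x₀)
    (hinj : Function.Injective (φ x₀))
    (hs : CMDiffAt n (fun x ↦ TotalSpace.mk' G (b x) (φ x (s x))) x₀) :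
    CMDiffAt n (T% s) x₀ := by
  have hx₀ : x₀ ∈ (trivializationAt F V x₀).baseSet := FiberBundle.mem_baseSet_trivializationAt' x₀
  have hb₀ : b x₀ ∈ (trivializationAt G W (b x₀)).baseSet :=
    FiberBundle.mem_baseSet_trivializationAt' (b x₀)
  rw [contMDiffAt_section]
  rw [contMDiffAt_totalSpace] at hs
  refine contMDiffAt_of_injective_clm_apply hφ ?_ (hs.2.congr_of_eventuallyEq ?_)
  · rw [ContinuousLinearMap.inCoordinates_eq hx₀ hb₀]
    simp only [ContinuousLinearMap.coe_comp, ContinuousLinearEquiv.coe_coe]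
    exact (ContinuousLinearEquiv.injective _).comp (hinj.comp (ContinuousLinearEquiv.injective _))
  · filter_upwards [(trivializationAt F V x₀).open_baseSet.mem_nhds hx₀,
      hs.1.continuousAt ((trivializationAt G W (b x₀)).open_baseSet.mem_nhds hb₀)] with x hx hx'
    rw [ContinuousLinearMap.inCoordinates_eq hx hx']
    simp [hx]

variable {W : M → Type*} [TopologicalSpace (TotalSpace G W)]
  [∀ x, AddCommGroup (W x)] [∀ x, Module 𝕜 (W x)] [∀ x, TopologicalSpace (W x)]
  [FiberBundle G W] [VectorBundle 𝕜 G W]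
  [∀ x, IsTopologicalAddGroup (W x)] [∀ x, ContinuousSMul 𝕜 (W x)]

theorem contMDiffAt_section_of_injective [CompleteSpace 𝕜] [FiniteDimensional 𝕜 F]
    [FiniteDimensional 𝕜 G] {φ : ∀ x, V x →L[𝕜] W x} {s : ∀ x, V x}
    (hφ : CMDiffAt n
      (fun x ↦ TotalSpace.mk' (F →L[𝕜] G) (E := fun x ↦ V x →L[𝕜] W x) x (φ x)) x₀)
    (hinj : Function.Injective (φ x₀)) (hs : CMDiffAt n (T% fun x ↦ φ x (s x)) x₀) :
    CMDiffAt n (T% s) x₀ :=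
  contMDiffAt_section_of_injective_inCoordinates (b := id) ((contMDiffAt_hom_bundle _).1 hφ).2
    hinj hs

variable [CompleteSpace 𝕜] [FiniteDimensional 𝕜 F]

theorem contMDiffAt_hom_of_apply {φ : ∀ x, V x →L[𝕜] W x}
    (h : ∀ s : ∀ x, V x, CMDiffAt n (T% s) x₀ → CMDiffAt n (T% fun x ↦ φ x (s x)) x₀) :
    CMDiffAt n (fun x ↦ TotalSpace.mk' (F →L[𝕜] G) (E := fun x ↦ V x →L[𝕜] W x) x (φ x)) x₀ := by
  rw [contMDiffAt_hom_bundle]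
  refine ⟨contMDiffAt_id, contMDiffAt_clm_of_apply fun v ↦ ?_⟩
  have hx₀ : x₀ ∈ (trivializationAt F V x₀).baseSet := FiberBundle.mem_baseSet_trivializationAt' x₀
  have hs : CMDiffAt n (T% fun x ↦ (trivializationAt F V x₀).symm x v) x₀ := by
    rw [contMDiffAt_section]
    refine (contMDiffAt_const (c := v)).congr_of_eventuallyEq ?_
    filter_upwards [(trivializationAt F V x₀).open_baseSet.mem_nhds hx₀] with x hx
    simp [(trivializationAt F V x₀).apply_mk_symm hx]
  have hφs := h _ hs
  rw [contMDiffAt_section] at hφs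
  refine hφs.congr_of_eventuallyEq ?_
  filter_upwards [(trivializationAt F V x₀).open_baseSet.mem_nhds hx₀,
    (trivializationAt G W x₀).open_baseSet.mem_nhds
      (FiberBundle.mem_baseSet_trivializationAt' x₀)] with x hx hy
  rw [ContinuousLinearMap.inCoordinates_eq hx hy]
  simp

theorem contMDiffAt_hom_const_of_apply {φ : ∀ x, V x →L[𝕜] G}
    (h : ∀ s : ∀ x, V x, CMDiffAt n (T% s) x₀ → CMDiffAt n (fun x ↦ φ x (s x)) x₀) :
    CMDiffAt n (fun x ↦ TotalSpace.mk' (F →L[𝕜] G) (E := fun x ↦ V x →L[𝕜] G) x (φ x)) x₀ :=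
  contMDiffAt_hom_of_apply (W := fun _ : M ↦ G) fun s hs ↦
    (contMDiffAt_trivial_iff contMDiffAt_id).2 (h s hs)

end Bundles

section BundleHom

variable {𝕜 : Type*} [NontriviallyNormedField 𝕜]
  {E : Type*} [NormedAddCommGroup E] [NormedSpace 𝕜 E]
  {H : Type*} [TopologicalSpace H] {I : ModelWithCorners 𝕜 E H}
  {M : Type*} [TopologicalSpace M] [ChartedSpace H M]
  {E' : Type*} [NormedAddCommGroup E'] [NormedSpace 𝕜 E']
  {H' : Type*} [TopologicalSpace H'] {I' : ModelWithCorners 𝕜 E' H'}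
  {M' : Type*} [TopologicalSpace M'] [ChartedSpace H' M']
  {F : Type*} [NormedAddCommGroup F] [NormedSpace 𝕜 F]
  {V : M → Type*} [TopologicalSpace (TotalSpace F V)]
  [∀ x, AddCommGroup (V x)] [∀ x, Module 𝕜 (V x)] [∀ x, TopologicalSpace (V x)]
  [FiberBundle F V] [VectorBundle 𝕜 F V]
  {F' : Type*} [NormedAddCommGroup F'] [NormedSpace 𝕜 F']
  {V' : M → Type*} [TopologicalSpace (TotalSpace F' V')]
  [∀ x, AddCommGroup (V' x)] [∀ x, Module 𝕜 (V' x)] [∀ x, TopologicalSpace (V' x)]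
  [FiberBundle F' V'] [VectorBundle 𝕜 F' V']
  {G : Type*} [NormedAddCommGroup G] [NormedSpace 𝕜 G] {n : WithTop ℕ∞}
  {b : M' → M} {x₀ : M'}

theorem contMDiffAt_hom_const_apply {φ : ∀ x, V (b x) →L[𝕜] G} {s : ∀ x, V (b x)}
    (hb : CMDiffAt n b x₀)
    (hφ : CMDiffAt n (fun x ↦ TotalSpace.mk' (F →L[𝕜] G) (E := fun x ↦ V x →L[𝕜] G) (b x)
      (φ x)) x₀)
    (hs : CMDiffAt n (fun x ↦ TotalSpace.mk' F (b x) (s x)) x₀) :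
    CMDiffAt n (fun x ↦ φ x (s x)) x₀ :=
  (contMDiffAt_trivial_iff hb).1
    (ContMDiffAt.clm_bundle_apply (E₂ := fun _ : M ↦ G) hφ hs)

theorem contMDiffAt_hom_hom_const_apply {φ : ∀ x, V (b x) →L[𝕜] V' (b x) →L[𝕜] G}
    {s : ∀ x, V (b x)} {t : ∀ x, V' (b x)} (hb : CMDiffAt n b x₀)
    (hφ : CMDiffAt n (fun x ↦ TotalSpace.mk' (F →L[𝕜] F' →L[𝕜] G)
      (E := fun x ↦ V x →L[𝕜] V' x →L[𝕜] G) (b x) (φ x)) x₀)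
    (hs : CMDiffAt n (fun x ↦ TotalSpace.mk' F (b x) (s x)) x₀)
    (ht : CMDiffAt n (fun x ↦ TotalSpace.mk' F' (b x) (t x)) x₀) :
    CMDiffAt n (fun x ↦ φ x (s x) (t x)) x₀ :=
  (contMDiffAt_trivial_iff hb).1
    (ContMDiffAt.clm_bundle_apply₂ (E₃ := fun _ : M ↦ G) hφ hs ht)

end BundleHom

/-! ### Derivatives along vector fields -/

section Differential

variable {𝕜 : Type*} [NontriviallyNormedField 𝕜]
  {E : Type*} [NormedAddCommGroup E] [NormedSpace 𝕜 E]
  {H : Type*} [TopologicalSpace H] {I : ModelWithCorners 𝕜 E H}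
  {M : Type*} [TopologicalSpace M] [ChartedSpace H M]
  {G : Type*} [NormedAddCommGroup G] [NormedSpace 𝕜 G]

theorem mvfderiv_congr_of_eventuallyEq {f g : M → G} {x : M} (h : f =ᶠ[𝓝 x] g) :
    d% f x = d% g x := by
  ext v
  exact congrArg (fun L : TangentSpace I x →L[𝕜] G ↦ L v) h.mfderiv_eq

theorem contMDiffAt_mvfderiv [IsManifold I 1 M] {m n : WithTop ℕ∞} {f : M → G} {x₀ : M}
    (hf : CMDiffAt n f x₀) (hmn : m + 1 ≤ n) :
    CMDiffAt m (fun x ↦ TotalSpace.mk' (E →L[𝕜] G) (E := fun x : M ↦ TangentSpace I x →L[𝕜] G) x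
      (d% f x)) x₀ := by
  refine (contMDiffAt_hom_bundle _).2 ⟨contMDiffAt_id,
    (hf.mfderiv_const hmn).congr_of_eventuallyEq (.of_eq ?_)⟩
  ext x v
  simp only [ContinuousLinearMap.inCoordinates, mvfderiv,
    Trivial.fiberBundle_trivializationAt', Trivial.continuousLinearMapAt_trivialization,
    ContinuousLinearMap.id_comp, ContinuousLinearMap.comp_apply,
    ContinuousLinearEquiv.coe_coe, inTangentCoordinates,
    TangentBundle.continuousLinearMapAt_model_space, id_eq]
  rfl

theorem contMDiffAt_mvfderiv_apply [IsManifold I 1 M] {m n : WithTop ℕ∞} {f : M → G}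
    {X : ∀ x : M, TangentSpace I x} {x₀ : M} (hf : CMDiffAt n f x₀) (hX : CMDiffAt m (T% X) x₀)
    (hmn : m + 1 ≤ n) : CMDiffAt m (fun x ↦ d% f x (X x)) x₀ :=
  contMDiffAt_hom_const_apply contMDiffAt_id (contMDiffAt_mvfderiv hf hmn) hX

end Differential

section Calculus

variable {E : Type*} [NormedAddCommGroup E] [NormedSpace ℝ E]
  {H : Type*} [TopologicalSpace H] {I : ModelWithCorners ℝ E H}
  {M : Type*} [TopologicalSpace M] [ChartedSpace H M] [IsManifold I ∞ M]

theorem mlieBracket_mlieBracket_smul_right [CompleteSpace E] {f : M → ℝ}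
    {X Y Z : ∀ x : M, TangentSpace I x} {x : M} (hf : CMDiffAt 2 f x) (hY : CMDiffAt 2 (T% Y) x)
    (hZ : CMDiffAt 2 (T% Z) x) :
    mlieBracket I X (mlieBracket I Y (f • Z)) x =
      d% (fun y ↦ d% f y (Y y)) x (X x) • Z x + d% f x (Y x) • mlieBracket I X Z x
        + (d% f x (X x) • mlieBracket I Y Z x + f x • mlieBracket I X (mlieBracket I Y Z) x) := by
  have : IsManifold I (minSmoothness ℝ 2) M := by simpa using inferInstanceAs (IsManifold I 2 M)
  have : IsManifold I ((2 : ℕ∞) + 1) M := by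
    norm_num; infer_instance
  have hYf : MDiffAt (fun y ↦ d% f y (Y y)) x :=
    (contMDiffAt_mvfderiv_apply (m := 1) hf (hY.of_le one_le_two)
      (by norm_num)).mdifferentiableAt one_ne_zero
  have hYZ : MDiffAt (T% fun y ↦ mlieBracket I Y Z y) x :=
    (ContMDiffAt.mlieBracket_vectorField (m := 1) (n := 2) hY hZ
      (by norm_num)).mdifferentiableAt one_ne_zero
  have hfx : MDiffAt f x := hf.mdifferentiableAt two_ne_zero
  have hZx : MDiffAt (T% Z) x := hZ.mdifferentiableAt two_ne_zero
  have hev : mlieBracket I Y (f • Z) =ᶠ[𝓝 x]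
      (fun y ↦ d% f y (Y y)) • Z + f • mlieBracket I Y Z := by
    filter_upwards [(contMDiffAt_iff_contMDiffAt_nhds (by simp)).1 hf,
      (contMDiffAt_iff_contMDiffAt_nhds (by simp)).1 hZ] with y hfy hZy
    exact mlieBracket_smul_right (hfy.mdifferentiableAt two_ne_zero)
      (hZy.mdifferentiableAt two_ne_zero)
  rw [EventuallyEq.rfl.mlieBracket_vectorField_eq hev,
    mlieBracket_add_right (hYf.smul_section hZx) (hfx.smul_section hYZ),
    mlieBracket_smul_right hYf hZx, mlieBracket_smul_right hfx hYZ]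

/- Compare the coefficients of `Z` in the Jacobi identities for `X`, `Y`, `f • Z` and for
`X`, `Y`, `Z`, where `Z` is any vector field that does not vanish at `x`. -/
theorem mvfderiv_mlieBracket [CompleteSpace E] {f : M → ℝ} {X Y : ∀ x : M, TangentSpace I x} {x : M}
    (hf : CMDiffAt 2 f x) (hX : CMDiffAt 2 (T% X) x) (hY : CMDiffAt 2 (T% Y) x) :
    d% f x (mlieBracket I X Y x) =
      d% (fun y ↦ d% f y (Y y)) x (X x) - d% (fun y ↦ d% f y (X y)) x (Y x) := by
  rcases subsingleton_or_nontrivial (TangentSpace I x) with _ | _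
  · simp [Subsingleton.elim _ (0 : TangentSpace I x)]
  obtain ⟨v, hv⟩ := exists_ne (0 : TangentSpace I x)
  have : IsManifold I (minSmoothness ℝ 3) M := by simpa using inferInstanceAs (IsManifold I 3 M)
  let Z := FiberBundle.extend E v
  have hZ : CMDiffAt 2 (T% Z) x := FiberBundle.contMDiffAt_extend I E v
  have hfx : MDiffAt f x := hf.mdifferentiableAt two_ne_zero
  have jacobi (W : ∀ x : M, TangentSpace I x) (hW : CMDiffAt 2 (T% W) x) :=
    leibniz_identity_mlieBracket_apply (I := I) (U := X) (V := Y) (W := W) (x := x)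
      (by simpa using hX) (by simpa using hY) (by simpa using hW)
  have hfZ := jacobi (f • Z) (hf.smul_section hZ)
  rw [mlieBracket_mlieBracket_smul_right hf hY hZ, mlieBracket_mlieBracket_smul_right hf hX hZ,
    mlieBracket_smul_right hfx (hZ.mdifferentiableAt two_ne_zero), jacobi Z hZ] at hfZ
  have hZx : Z x = v := FiberBundle.extend_apply_self _ v
  rw [hZx] at hfZ
  refine sub_eq_zero.1 ((smul_eq_zero.1 ?_).resolve_right hv)
  linear_combination (norm := module) (-1 : ℝ) • hfZ

theorem exists_mvfderiv_eq [FiniteDimensional ℝ E] [T2Space M] (x : M)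
    (ξ : TangentSpace I x →L[ℝ] ℝ) : ∃ f : M → ℝ, CMDiff ∞ f ∧ d% f x = ξ := by
  obtain ⟨χ⟩ : Nonempty (SmoothBumpFunction I x) := inferInstance
  let η : E →L[ℝ] ℝ := ξ
  refine ⟨fun y ↦ χ y • η (extChartAt I x y),
    χ.contMDiff_smul (η.contDiff.contMDiff.comp_contMDiffOn contMDiffOn_extChartAt), ?_⟩
  have hχ : (fun y ↦ χ y • η (extChartAt I x y)) =ᶠ[𝓝 x] η ∘ extChartAt I x := by
    filter_upwards [χ.eventuallyEq_one] with y hy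
    simp [hy]
  rw [mvfderiv_congr_of_eventuallyEq hχ]
  ext v
  rw [mvfderiv_comp_apply x η.differentiableAt.mdifferentiableAt
    (mdifferentiableAt_extChartAt (mem_chart_source H x)), mfderiv_extChartAt_self]
  simp only [mvfderiv, mfderiv_eq_fderiv, η.fderiv]
  rfl

theorem contMDiffAt_vectorField_of_mfderiv
    {E' : Type*} [NormedAddCommGroup E'] [NormedSpace ℝ E']
    {H' : Type*} [TopologicalSpace H'] {I' : ModelWithCorners ℝ E' H'}
    {M' : Type*} [TopologicalSpace M'] [ChartedSpace H' M'] [IsManifold I' ∞ M']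
    [FiniteDimensional ℝ E] [FiniteDimensional ℝ E']
    {j : M → M'} {X : ∀ x : M, TangentSpace I x} {x₀ : M} (hj : CMDiffAt ∞ j x₀)
    (hinj : Function.Injective (mfderiv% j x₀))
    (hX : CMDiffAt ∞ (fun x ↦ TotalSpace.mk' E' (E := (TangentSpace I' : M' → Type _)) (j x)
      (mfderiv% j x (X x))) x₀) :
    CMDiffAt ∞ (T% X) x₀ :=
  contMDiffAt_section_of_injective_inCoordinates
    (V := (TangentSpace I : M → Type _)) (W := (TangentSpace I' : M' → Type _))
    (φ := fun x ↦ mfderiv% j x) (hj.mfderiv_const (m := ∞) (by simp)) hinj hX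
end Calculus

/-! ### Global sections, local frames and derivations -/

section Sections

variable {E : Type*} [NormedAddCommGroup E] [NormedSpace ℝ E]
  {H : Type*} [TopologicalSpace H] {I : ModelWithCorners ℝ E H}
  {M : Type*} [TopologicalSpace M] [ChartedSpace H M]
  {F : Type*} [NormedAddCommGroup F] [NormedSpace ℝ F]
  {V : M → Type*} [TopologicalSpace (TotalSpace F V)]
  [∀ x, AddCommGroup (V x)] [∀ x, Module ℝ (V x)] [∀ x, TopologicalSpace (V x)]
  [FiberBundle F V] [VectorBundle ℝ F V]

theorem exists_contMDiff_bump [FiniteDimensional ℝ E] [IsManifold I ∞ M] [T2Space M] {x₀ : M}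
    {U : Set M} (hU : U ∈ 𝓝 x₀) :
    ∃ χ : C^∞⟮I, M; 𝓘(ℝ, ℝ), ℝ⟯, (∀ᶠ x in 𝓝 x₀, χ x = 1) ∧ tsupport χ ⊆ U := by
  obtain ⟨χ, hχ, -⟩ := (SmoothBumpFunction.nhds_basis_support (I := I) hU).mem_iff.1 univ_mem
  exact ⟨⟨χ, χ.contMDiff⟩, χ.eventuallyEq_one, hχ⟩

/-- The product of a smooth function and a smooth section, the `C^∞(M)`-module structure of the
sections. -/
def sectionSMul (f : C^∞⟮I, M; 𝓘(ℝ, ℝ), ℝ⟯) (s : Cₛ^∞⟮I; F, V⟯) : Cₛ^∞⟮I; F, V⟯ :=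
  ⟨fun x ↦ f x • s x, f.contMDiff.smul_section s.contMDiff⟩

@[simp]
theorem sectionSMul_apply (f : C^∞⟮I, M; 𝓘(ℝ, ℝ), ℝ⟯) (s : Cₛ^∞⟮I; F, V⟯) (x : M) :
    sectionSMul f s x = f x • s x := rfl

variable (I F V) in
/-- Evaluation of the smooth sections at a point. -/
def sectionEval (x : M) : Cₛ^∞⟮I; F, V⟯ →ₗ[ℝ] V x where
  toFun s := s x
  map_add' _ _ := rfl
  map_smul' _ _ := rfl

@[simp]
theorem sectionEval_apply (x : M) (s : Cₛ^∞⟮I; F, V⟯) : sectionEval I F V x s = s x := rfl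

theorem section_sum_apply {κ : Type*} (t : Finset κ) (s : κ → Cₛ^∞⟮I; F, V⟯) (x : M) :
    (∑ i ∈ t, s i) x = ∑ i ∈ t, s i x :=
  map_sum (sectionEval I F V x) s t

end Sections

section Frames

variable {E : Type*} [NormedAddCommGroup E] [NormedSpace ℝ E]
  {H : Type*} [TopologicalSpace H] {I : ModelWithCorners ℝ E H}
  {M : Type*} [TopologicalSpace M] [ChartedSpace H M]
  {F : Type*} [NormedAddCommGroup F] [NormedSpace ℝ F]
  {V : M → Type*} [TopologicalSpace (TotalSpace F V)]
  [∀ x, AddCommGroup (V x)] [∀ x, Module ℝ (V x)] [∀ x, TopologicalSpace (V x)]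
  [FiberBundle F V] [VectorBundle ℝ F V]

variable (I F V) in
/-- A local frame near `x₀` made of globally defined smooth sections `e i` of `V`, together with
globally defined smooth sections `c i` of the dual bundle: near `x₀` they are dual bases of the
fibres. Being global, the `e i` can be fed to operators on sections. -/
structure LocalDualFrame (x₀ : M) where
  e : Fin (Module.finrank ℝ F) → Cₛ^∞⟮I; F, V⟯
  c : Fin (Module.finrank ℝ F) → ∀ x, V x →L[ℝ] ℝ
  contMDiff_c (i) :
    CMDiff ∞ (fun x ↦ TotalSpace.mk' (F →L[ℝ] ℝ) (E := fun x ↦ V x →L[ℝ] ℝ) x (c i x))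
  sum_c : ∀ᶠ x in 𝓝 x₀, ∀ v : V x, ∑ i, c i x v • e i x = v
  linearIndependent : ∀ᶠ x in 𝓝 x₀, LinearIndependent ℝ fun i ↦ e i x

/-- The coefficients of a section with respect to a frame. -/
def LocalDualFrame.coeff {x₀ : M} (B : LocalDualFrame I F V x₀)
    (i : Fin (Module.finrank ℝ F)) (s : Cₛ^∞⟮I; F, V⟯) : C^∞⟮I, M; 𝓘(ℝ, ℝ), ℝ⟯ :=
  ⟨fun x ↦ B.c i x (s x), fun x ↦
    contMDiffAt_hom_const_apply contMDiffAt_id (B.contMDiff_c i x) (s.contMDiff x)⟩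

theorem LocalDualFrame.coeff_apply {x₀ : M} (B : LocalDualFrame I F V x₀)
    (i : Fin (Module.finrank ℝ F)) (s : Cₛ^∞⟮I; F, V⟯) (x : M) :
    B.coeff i s x = B.c i x (s x) := rfl

variable [FiniteDimensional ℝ F]

theorem contMDiff_smul_trivialization_coord {t : Trivialization F (π F V)}
    [MemTrivializationAtlas t] [ContMDiffVectorBundle ∞ F V I] {χ : M → ℝ} (hχ : CMDiff ∞ χ)
    (hsupp : tsupport χ ⊆ t.baseSet) (l : F →L[ℝ] ℝ) :
    CMDiff ∞ (fun x ↦ TotalSpace.mk' (F →L[ℝ] ℝ) (E := fun x ↦ V x →L[ℝ] ℝ) x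
      (χ x • l.comp (t.continuousLinearMapAt ℝ x))) := by
  refine fun y ↦ contMDiffAt_hom_const_of_apply fun s hs ↦ ?_
  by_cases hy : y ∈ tsupport χ
  · have hls : CMDiffAt ∞ (fun x ↦ l (t ⟨x, s x⟩).2) y :=
      l.contDiff.contMDiff.contMDiffAt.comp y ((t.contMDiffAt_section_iff (hsupp hy)).1 hs)
    refine (hχ.contMDiffAt.mul hls).congr_of_eventuallyEq ?_
    filter_upwards [t.open_baseSet.mem_nhds (hsupp hy)] with x hx
    simp [t.coe_linearMapAt_of_mem hx]
  · refine (contMDiffAt_const (c := (0 : ℝ))).congr_of_eventuallyEq ?_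
    filter_upwards [(isClosed_tsupport χ).isOpen_compl.mem_nhds hy] with x hx
    simp [image_eq_zero_of_notMem_tsupport hx]

variable [FiniteDimensional ℝ E] [IsManifold I ∞ M] [T2Space M] [ContMDiffVectorBundle ∞ F V I]

theorem nonempty_localDualFrame (x₀ : M) : Nonempty (LocalDualFrame I F V x₀) := by
  let t := trivializationAt F V x₀
  have ht : ∀ᶠ x in 𝓝 x₀, x ∈ t.baseSet :=
    t.open_baseSet.mem_nhds (FiberBundle.mem_baseSet_trivializationAt' x₀)
  obtain ⟨χ, hχ, hsupp⟩ := exists_contMDiff_bump (I := I) ht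
  let b := Module.finBasis ℝ F
  refine ⟨{
    e i := ⟨(χ : M → ℝ) • t.localFrame b i, χ.contMDiff.contMDiffOn.smul_section_of_tsupport
      t.open_baseSet hsupp (t.contMDiffOn_localFrame_baseSet _ b i)⟩
    c i x := χ x • (LinearMap.toContinuousLinearMap (b.coord i)).comp
      (t.continuousLinearMapAt ℝ x)
    contMDiff_c i := contMDiff_smul_trivialization_coord χ.contMDiff hsupp _
    sum_c := ?_
    linearIndependent := ?_ }⟩
  · filter_upwards [hχ, ht] with x hx hxt v
    simpa [hx, hxt, t.coe_linearMapAt_of_mem hxt, Bundle.Trivialization.basisAt] using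
      (t.basisAt b hxt).sum_repr v
  · filter_upwards [hχ, ht] with x hx hxt
    simpa [hx, hxt] using (t.basisAt b hxt).linearIndependent

variable (I F) in
theorem exists_section_eq (x : M) (v : V x) : ∃ s : Cₛ^∞⟮I; F, V⟯, s x = v := by
  obtain ⟨B⟩ := nonempty_localDualFrame (I := I) (F := F) (V := V) x
  refine ⟨∑ i, B.c i x v • B.e i, ?_⟩
  simpa only [section_sum_apply, ContMDiffSection.coe_smul, Pi.smul_apply] using
    B.sum_c.self_of_nhds v

end Frames

section Derivations

variable {E : Type*} [NormedAddCommGroup E] [NormedSpace ℝ E]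
  {H : Type*} [TopologicalSpace H] {I : ModelWithCorners ℝ E H}
  {M : Type*} [TopologicalSpace M] [ChartedSpace H M]
  {F : Type*} [NormedAddCommGroup F] [NormedSpace ℝ F]
  {V : M → Type*} [TopologicalSpace (TotalSpace F V)]
  [∀ x, AddCommGroup (V x)] [∀ x, Module ℝ (V x)] [∀ x, TopologicalSpace (V x)]
  [FiberBundle F V] [VectorBundle ℝ F V]

/-- `K` is a derivation at `x` on the sections of `V`, with symbol the tangent vector `w`, like
`t ↦ [s, t] x` for a section `s` of a Lie algebroid. -/
def IsDerivationAt {x : M} (w : TangentSpace I x) (K : Cₛ^∞⟮I; F, V⟯ →ₗ[ℝ] V x) : Prop :=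
  ∀ (f : C^∞⟮I, M; 𝓘(ℝ, ℝ), ℝ⟯) (t : Cₛ^∞⟮I; F, V⟯),
    K (sectionSMul f t) = f x • K t + d% f x w • t x

namespace IsDerivationAt

variable [FiniteDimensional ℝ E] [IsManifold I ∞ M] [T2Space M]
  {x : M} {w : TangentSpace I x} {K : Cₛ^∞⟮I; F, V⟯ →ₗ[ℝ] V x}

theorem congr (hK : IsDerivationAt w K) {t t' : Cₛ^∞⟮I; F, V⟯} (h : ∀ᶠ y in 𝓝 x, t y = t' y) :
    K t = K t' := by
  obtain ⟨χ, hχ, hsupp⟩ := exists_contMDiff_bump (I := I) h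
  have hcut : sectionSMul χ (t - t') = 0 := by
    ext y
    by_cases hy : y ∈ tsupport χ
    · have : t y = t' y := hsupp hy
      simp [this]
    · simp [image_eq_zero_of_notMem_tsupport hy]
  have hleibniz := hK χ (t - t')
  rw [hcut, map_zero, hχ.self_of_nhds, ContMDiffSection.coe_sub, Pi.sub_apply, h.self_of_nhds,
    sub_self, smul_zero, add_zero, one_smul, map_sub] at hleibniz
  exact sub_eq_zero.1 hleibniz.symm

theorem eq_sum (hK : IsDerivationAt w K) {x₀ : M} (B : LocalDualFrame I F V x₀)
    (hx : ∀ᶠ y in 𝓝 x, ∀ v : V y, ∑ i, B.c i y v • B.e i y = v) (t : Cₛ^∞⟮I; F, V⟯) :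
    K t = ∑ i, (B.coeff i t x • K (B.e i) + d% (B.coeff i t) x w • B.e i x) := by
  have hsum : K t = K (∑ i, sectionSMul (B.coeff i t) (B.e i)) := by
    refine hK.congr ?_
    filter_upwards [hx] with y hy
    rw [section_sum_apply]
    exact (hy (t y)).symm
  rw [hsum, map_sum]
  exact Finset.sum_congr rfl fun i _ ↦ hK _ _

end IsDerivationAt

end Derivations

section Algebroid

variable {E : Type*} [NormedAddCommGroup E] [NormedSpace ℝ E]
  {M : Type*} [TopologicalSpace M] [ChartedSpace E M] [IsManifold 𝓘(ℝ, E) ∞ M]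
  {F : Type*} [NormedAddCommGroup F] [NormedSpace ℝ F]
  {V : M → Type*} [TopologicalSpace (TotalSpace F V)]
  [∀ x, AddCommGroup (V x)] [∀ x, Module ℝ (V x)] [∀ x, TopologicalSpace (V x)]
  [FiberBundle F V] [VectorBundle ℝ F V]

namespace LieAlgebroid

theorem ext {𝒜 ℬ : LieAlgebroid E F V} (hanchor : ∀ x a, 𝒜.anchor x a = ℬ.anchor x a)
    (hbracket : ∀ s t x, 𝒜.bracket s t x = ℬ.bracket s t x) : 𝒜 = ℬ := by
  have hanchor' : 𝒜.anchor = ℬ.anchor := funext fun x ↦ ContinuousLinearMap.ext (hanchor x)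
  have hbracket' : 𝒜.bracket = ℬ.bracket :=
    LinearMap.ext₂ fun s t ↦ ContMDiffSection.ext (hbracket s t)
  cases 𝒜; cases ℬ
  congr

variable (𝒜 : LieAlgebroid E F V)

theorem bracket_swap (s t : Cₛ^∞⟮𝓘(ℝ, E); F, V⟯) : 𝒜.bracket s t = -𝒜.bracket t s :=
  (LinearMap.IsAlt.neg 𝒜.bracket_self t s).symm

theorem bracket_swap_apply (s t : Cₛ^∞⟮𝓘(ℝ, E); F, V⟯) (x : M) :
    𝒜.bracket s t x = -𝒜.bracket t s x := by
  rw [𝒜.bracket_swap s t, ContMDiffSection.coe_neg, Pi.neg_apply]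

theorem contMDiff_anchor_apply (s : Cₛ^∞⟮𝓘(ℝ, E); F, V⟯) :
    CMDiff ∞ (T% fun x ↦ 𝒜.anchor x (s x)) :=
  𝒜.anchor_contMDiff.clm_bundle_apply s.contMDiff

theorem bracket_sectionSMul_right (f : C^∞⟮𝓘(ℝ, E), M; 𝓘(ℝ, ℝ), ℝ⟯)
    (s t : Cₛ^∞⟮𝓘(ℝ, E); F, V⟯) (x : M) : 𝒜.bracket s (sectionSMul f t) x =
      f x • 𝒜.bracket s t x + d% f x (𝒜.anchor x (s x)) • t x :=
  𝒜.leibniz s t _ f f.contMDiff (fun _ ↦ rfl) x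

theorem bracket_sectionSMul_left (f : C^∞⟮𝓘(ℝ, E), M; 𝓘(ℝ, ℝ), ℝ⟯)
    (s t : Cₛ^∞⟮𝓘(ℝ, E); F, V⟯) (x : M) : 𝒜.bracket (sectionSMul f s) t x =
      f x • 𝒜.bracket s t x - d% f x (𝒜.anchor x (t x)) • s x := by
  rw [bracket_swap_apply, bracket_sectionSMul_right, 𝒜.bracket_swap_apply s t]
  module

theorem isDerivationAt_bracket (s : Cₛ^∞⟮𝓘(ℝ, E); F, V⟯) (x : M) :
    IsDerivationAt (𝒜.anchor x (s x)) (sectionEval 𝓘(ℝ, E) F V x ∘ₗ 𝒜.bracket s) :=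
  fun f t ↦ 𝒜.bracket_sectionSMul_right f s t x

theorem bracket_congr_right [FiniteDimensional ℝ E] [T2Space M] (s : Cₛ^∞⟮𝓘(ℝ, E); F, V⟯)
    {t t' : Cₛ^∞⟮𝓘(ℝ, E); F, V⟯} {x : M} (h : ∀ᶠ y in 𝓝 x, t y = t' y) :
    𝒜.bracket s t x = 𝒜.bracket s t' x :=
  (𝒜.isDerivationAt_bracket s x).congr h

end LieAlgebroid

end Algebroid

/-! ### Extension of derivations to a pullback bundle -/

section RelatedVectorFields

variable {E : Type*} [NormedAddCommGroup E] [NormedSpace ℝ E]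
  {H : Type*} [TopologicalSpace H] {I : ModelWithCorners ℝ E H}
  {M : Type*} [TopologicalSpace M] [ChartedSpace H M] [IsManifold I ∞ M]
  {E' : Type*} [NormedAddCommGroup E'] [NormedSpace ℝ E']
  {H' : Type*} [TopologicalSpace H'] {I' : ModelWithCorners ℝ E' H'}
  {N : Type*} [TopologicalSpace N] [ChartedSpace H' N] [IsManifold I' ∞ N]
  {j : N → M} {X Y : ∀ x : N, TangentSpace I' x} {X' Y' : ∀ x : M, TangentSpace I x} {x : N}

theorem mvfderiv_mvfderiv_comp_of_related {f : M → ℝ} (hj : CMDiffAt 2 j x)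
    (hf : CMDiffAt 2 f (j x)) (hX' : CMDiffAt 2 (T% X') (j x))
    (hXX' : ∀ᶠ y in 𝓝 x, mfderiv% j y (X y) = X' (j y)) (v : TangentSpace I' x) :
    d% (fun y ↦ d% (f ∘ j) y (X y)) x v =
      d% (fun y ↦ d% f y (X' y)) (j x) (mfderiv% j x v) := by
  have hXf : MDiffAt (fun y ↦ d% f y (X' y)) (j x) :=
    (contMDiffAt_mvfderiv_apply (m := 1) hf (hX'.of_le one_le_two)
      (by norm_num)).mdifferentiableAt one_ne_zero
  rw [← mvfderiv_comp_apply x hXf (hj.mdifferentiableAt two_ne_zero)]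
  refine congrArg (fun L : TangentSpace I' x →L[ℝ] ℝ ↦ L v)
    (mvfderiv_congr_of_eventuallyEq ?_)
  filter_upwards [hXX', (contMDiffAt_iff_contMDiffAt_nhds (by simp)).1 hj,
    hj.continuousAt.eventually ((contMDiffAt_iff_contMDiffAt_nhds (by simp)).1 hf)]
    with y hy hjy hfy
  rw [mvfderiv_comp_apply y (hfy.mdifferentiableAt two_ne_zero)
    (hjy.mdifferentiableAt two_ne_zero), hy, Function.comp_apply]

theorem mfderiv_mlieBracket_of_related [FiniteDimensional ℝ E] [T2Space M] [CompleteSpace E']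
    (hj : CMDiffAt 2 j x)
    (hX : CMDiffAt 2 (T% X) x) (hY : CMDiffAt 2 (T% Y) x)
    (hX' : CMDiffAt 2 (T% X') (j x)) (hY' : CMDiffAt 2 (T% Y') (j x))
    (hXX' : ∀ᶠ y in 𝓝 x, mfderiv% j y (X y) = X' (j y))
    (hYY' : ∀ᶠ y in 𝓝 x, mfderiv% j y (Y y) = Y' (j y)) :
    mfderiv% j x (mlieBracket I' X Y x) = mlieBracket I X' Y' (j x) := by
  refine (SeparatingDual.eq_iff_forall_dual_eq (R := ℝ) (V := E)).2 fun ξ ↦ ?_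
  obtain ⟨f, hf, rfl⟩ := exists_mvfderiv_eq (I := I) (j x) ξ
  have hf₂ : CMDiffAt 2 f (j x) := hf.contMDiffAt.of_le (by norm_cast)
  calc
    _ = d% (f ∘ j) x (mlieBracket I' X Y x) :=
      (mvfderiv_comp_apply x (hf₂.mdifferentiableAt two_ne_zero)
        (hj.mdifferentiableAt two_ne_zero) _).symm
    _ = d% f (j x) (mlieBracket I X' Y' (j x)) := ?_
  rw [mvfderiv_mlieBracket hf₂ hX' hY', mvfderiv_mlieBracket (hf₂.comp x hj) hX hY,
    mvfderiv_mvfderiv_comp_of_related hj hf₂ hY' hYY',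
    mvfderiv_mvfderiv_comp_of_related hj hf₂ hX' hXX', hXX'.self_of_nhds, hYY'.self_of_nhds]

end RelatedVectorFields

section Pullback

variable {E : Type*} [NormedAddCommGroup E] [NormedSpace ℝ E]
  {H : Type*} [TopologicalSpace H] {I : ModelWithCorners ℝ E H}
  {M : Type*} [TopologicalSpace M] [ChartedSpace H M]
  {F : Type*} [NormedAddCommGroup F] [NormedSpace ℝ F]
  {V : M → Type*} [TopologicalSpace (TotalSpace F V)]
  [∀ x, AddCommGroup (V x)] [∀ x, TopologicalSpace (V x)] [FiberBundle F V]
  {E' : Type*} [NormedAddCommGroup E'] [NormedSpace ℝ E']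
  {H' : Type*} [TopologicalSpace H'] {I' : ModelWithCorners ℝ E' H'}
  {N : Type*} [TopologicalSpace N] [ChartedSpace H' N]
  (ι : C^∞⟮I', N; I, M⟯)

theorem contMDiffAt_pullback_section_iff {s : ∀ x : N, (ι *ᵖ V) x} {x₀ : N} :
    CMDiffAt ∞ (fun x ↦ TotalSpace.mk' F (E := ι *ᵖ V) x (s x)) x₀ ↔
      CMDiffAt ∞ (fun x ↦ TotalSpace.mk' F (E := V) (ι x) (s x)) x₀ := by
  rw [contMDiffAt_section, contMDiffAt_totalSpace]
  exact (and_iff_right ι.contMDiff.contMDiffAt).symm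

/-- The pullback of a smooth section along a smooth map of the base. -/
def pullbackSection (a : Cₛ^∞⟮I; F, V⟯) : Cₛ^∞⟮I'; F, (ι *ᵖ V)⟯ :=
  ⟨fun x ↦ a (ι x), fun x ↦ (contMDiffAt_pullback_section_iff ι).2
    (a.contMDiff.contMDiffAt.comp x ι.contMDiff.contMDiffAt)⟩

variable [∀ x, Module ℝ (V x)] [VectorBundle ℝ F V] [FiniteDimensional ℝ F]

theorem contMDiff_pullback_dual {c : ∀ x, V x →L[ℝ] ℝ}
    (hc : CMDiff ∞ (fun x ↦ TotalSpace.mk' (F →L[ℝ] ℝ) (E := fun x ↦ V x →L[ℝ] ℝ) x (c x))) :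
    CMDiff ∞ (fun x : N ↦ TotalSpace.mk' (F →L[ℝ] ℝ) (E := fun x : N ↦ (ι *ᵖ V) x →L[ℝ] ℝ) x
      (c (ι x))) := fun x₀ ↦
  contMDiffAt_hom_const_of_apply (V := ι *ᵖ V) fun _ hs ↦
    contMDiffAt_hom_const_apply (V := V) ι.contMDiff.contMDiffAt
      (hc.contMDiffAt.comp x₀ ι.contMDiff.contMDiffAt)
      ((contMDiffAt_pullback_section_iff ι).1 hs)

/-- The pullback of a frame along a smooth map of the base. -/
def LocalDualFrame.pullback {x₀ : N} (B : LocalDualFrame I F V (ι x₀)) :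
    LocalDualFrame I' F (ι *ᵖ V) x₀ where
  e i := pullbackSection ι (B.e i)
  c i x := B.c i (ι x)
  contMDiff_c i := contMDiff_pullback_dual ι (B.contMDiff_c i)
  sum_c := ι.contMDiff.continuous.continuousAt.eventually B.sum_c
  linearIndependent := ι.contMDiff.continuous.continuousAt.eventually B.linearIndependent

variable [FiniteDimensional ℝ E] [T2Space M] [IsManifold I ∞ M] [ContMDiffVectorBundle ∞ F V I]

theorem pullback_section_induction (x : N) {Q : Cₛ^∞⟮I'; F, (ι *ᵖ V)⟯ → Prop}
    (pullback : ∀ a : Cₛ^∞⟮I; F, V⟯, Q (pullbackSection ι a))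
    (add : ∀ s t, Q s → Q t → Q (s + t))
    (smul : ∀ f s, Q s → Q (sectionSMul f s))
    (congr : ∀ s t : Cₛ^∞⟮I'; F, (ι *ᵖ V)⟯, (∀ᶠ y in 𝓝 x, s y = t y) → Q s → Q t)
    (s : Cₛ^∞⟮I'; F, (ι *ᵖ V)⟯) : Q s := by
  classical
  obtain ⟨B₀⟩ := nonempty_localDualFrame (I := I) (F := F) (V := V) (ι x)
  let B := B₀.pullback ι
  have hsum (t : Finset (Fin (Module.finrank ℝ F))) :
      Q (∑ i ∈ t, sectionSMul (B.coeff i s) (B.e i)) := by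
    induction t using Finset.induction_on with
    | empty => exact pullback 0
    | insert i t hi h =>
      rw [Finset.sum_insert hi]
      exact add _ _ (smul _ _ (pullback _)) h
  refine congr _ _ ?_ (hsum Finset.univ)
  filter_upwards [B.sum_c] with y hy
  rw [section_sum_apply]
  exact hy (s y)

end Pullback

section Coefficients

variable {E : Type*} [NormedAddCommGroup E] [NormedSpace ℝ E]
  {H : Type*} [TopologicalSpace H] {I : ModelWithCorners ℝ E H}
  {M : Type*} [TopologicalSpace M] [ChartedSpace H M]
  {F : Type*} [NormedAddCommGroup F] [NormedSpace ℝ F]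
  {V : M → Type*} [TopologicalSpace (TotalSpace F V)]
  [∀ x, AddCommGroup (V x)] [∀ x, Module ℝ (V x)] [∀ x, TopologicalSpace (V x)]
  [FiberBundle F V] [VectorBundle ℝ F V]

namespace LocalDualFrame

variable {x₀ : M} (B : LocalDualFrame I F V x₀)

theorem sum_coeff (s : Cₛ^∞⟮I; F, V⟯) : ∑ i, B.coeff i s x₀ • B.e i x₀ = s x₀ :=
  B.sum_c.self_of_nhds (s x₀)

theorem coeff_add (i : Fin (Module.finrank ℝ F)) (s t : Cₛ^∞⟮I; F, V⟯) :
    ⇑(B.coeff i (s + t)) = B.coeff i s + B.coeff i t := by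
  ext y
  simp [coeff_apply]

theorem coeff_sectionSMul (i : Fin (Module.finrank ℝ F)) (f : C^∞⟮I, M; 𝓘(ℝ, ℝ), ℝ⟯)
    (s : Cₛ^∞⟮I; F, V⟯) : ⇑(B.coeff i (sectionSMul f s)) = f * B.coeff i s := by
  ext y
  simp [coeff_apply]

theorem mdifferentiableAt_coeff (i : Fin (Module.finrank ℝ F)) (s : Cₛ^∞⟮I; F, V⟯) (x : M) :
    MDiffAt (B.coeff i s) x :=
  (B.coeff i s).contMDiff.mdifferentiableAt (by simp)

/-- The derivation on the sections of `V` with symbol `v` which takes the value `k i` on the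
`i`-th section of the frame `B`. -/
def derivation {x : M} (v : TangentSpace I x) (k : Fin (Module.finrank ℝ F) → V x) :
    Cₛ^∞⟮I; F, V⟯ →ₗ[ℝ] V x where
  toFun s := ∑ i, (B.coeff i s x • k i + d% (B.coeff i s) x v • B.e i x)
  map_add' s t := by
    rw [← Finset.sum_add_distrib]
    refine Finset.sum_congr rfl fun i _ ↦ ?_
    rw [coeff_add, mvfderiv_add (B.mdifferentiableAt_coeff i s x) (B.mdifferentiableAt_coeff i t x),
      Pi.add_apply, add_apply]
    module
  map_smul' r s := by
    rw [RingHom.id_apply, Finset.smul_sum]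
    refine Finset.sum_congr rfl fun i _ ↦ ?_
    have h : ⇑(B.coeff i (r • s)) = (fun _ ↦ r) * ⇑(B.coeff i s) := by
      ext y
      simp [coeff_apply]
    rw [h, mvfderiv_mul mdifferentiableAt_const (B.mdifferentiableAt_coeff i s x), mvfderiv_const]
    simp only [Pi.mul_apply, add_apply, smul_apply, zero_apply, smul_eq_mul]
    module

theorem derivation_apply {x : M} (v : TangentSpace I x) (k : Fin (Module.finrank ℝ F) → V x)
    (s : Cₛ^∞⟮I; F, V⟯) : B.derivation v k s =
      ∑ i, (B.coeff i s x • k i + d% (B.coeff i s) x v • B.e i x) := rfl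

theorem derivation_add {x : M} (v v' : TangentSpace I x)
    (k k' : Fin (Module.finrank ℝ F) → V x) :
    B.derivation (v + v') (k + k') = B.derivation v k + B.derivation v' k' := by
  ext s
  simp only [derivation_apply, LinearMap.add_apply, ← Finset.sum_add_distrib, map_add,
    Pi.add_apply]
  exact Finset.sum_congr rfl fun i _ ↦ by module

theorem derivation_smul {x : M} (r : ℝ) (v : TangentSpace I x)
    (k : Fin (Module.finrank ℝ F) → V x) : B.derivation (r • v) (r • k) = r • B.derivation v k := by
  ext s
  simp only [derivation_apply, LinearMap.smul_apply, Finset.smul_sum, map_smul, smul_eq_mul,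
    Pi.smul_apply]
  exact Finset.sum_congr rfl fun i _ ↦ by module

theorem isDerivationAt_derivation (v : TangentSpace I x₀)
    (k : Fin (Module.finrank ℝ F) → V x₀) : IsDerivationAt v (B.derivation v k) := by
  intro f s
  rw [derivation_apply, derivation_apply, ← B.sum_coeff s, Finset.smul_sum, Finset.smul_sum,
    ← Finset.sum_add_distrib]
  refine Finset.sum_congr rfl fun i _ ↦ ?_
  rw [coeff_sectionSMul, mvfderiv_mul (f.contMDiff.mdifferentiableAt (by simp))
    (B.mdifferentiableAt_coeff i s x₀)]
  simp only [Pi.mul_apply, add_apply, smul_apply, smul_eq_mul]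
  module

end LocalDualFrame

end Coefficients

section Extension

variable {E : Type*} [NormedAddCommGroup E] [NormedSpace ℝ E] [FiniteDimensional ℝ E]
  {H : Type*} [TopologicalSpace H] {I : ModelWithCorners ℝ E H}
  {M : Type*} [TopologicalSpace M] [ChartedSpace H M] [IsManifold I ∞ M] [T2Space M]
  {F : Type*} [NormedAddCommGroup F] [NormedSpace ℝ F] [FiniteDimensional ℝ F]
  {V : M → Type*} [TopologicalSpace (TotalSpace F V)]
  [∀ x, AddCommGroup (V x)] [∀ x, Module ℝ (V x)] [∀ x, TopologicalSpace (V x)]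
  [FiberBundle F V] [VectorBundle ℝ F V] [ContMDiffVectorBundle ∞ F V I]
  {E' : Type*} [NormedAddCommGroup E'] [NormedSpace ℝ E']
  {H' : Type*} [TopologicalSpace H'] {I' : ModelWithCorners ℝ E' H'}
  {N : Type*} [TopologicalSpace N] [ChartedSpace H' N]
  {ι : C^∞⟮I', N; I, M⟯}

variable (I F V) in
/-- A choice of a frame near each point. -/
def localDualFrameAt (x : M) : LocalDualFrame I F V x := (nonempty_localDualFrame x).some

variable (ι) in
/-- The derivation with symbol `v` on the sections of the pullback of `V` that extends a
derivation `K` on the sections of `V` with symbol `dι v`; it is the only one, because the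
pullbacks of sections of `V` contain local frames. -/
def extendDerivation {x : N} (v : TangentSpace I' x) (K : Cₛ^∞⟮I; F, V⟯ →ₗ[ℝ] (ι *ᵖ V) x) :
    Cₛ^∞⟮I'; F, (ι *ᵖ V)⟯ →ₗ[ℝ] (ι *ᵖ V) x :=
  ((localDualFrameAt I F V (ι x)).pullback ι).derivation v
    fun i ↦ K ((localDualFrameAt I F V (ι x)).e i)

theorem isDerivationAt_extendDerivation {x : N} (v : TangentSpace I' x)
    (K : Cₛ^∞⟮I; F, V⟯ →ₗ[ℝ] (ι *ᵖ V) x) : IsDerivationAt v (extendDerivation ι v K) :=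
  LocalDualFrame.isDerivationAt_derivation _ v _

theorem extendDerivation_pullback {x : N} {v : TangentSpace I' x}
    {K : Cₛ^∞⟮I; F, V⟯ →ₗ[ℝ] (ι *ᵖ V) x} (hK : IsDerivationAt (V := V) (mfderiv% ι x v) K)
    (a : Cₛ^∞⟮I; F, V⟯) : extendDerivation ι v K (pullbackSection ι a) = K a := by
  let B := localDualFrameAt I F V (ι x)
  refine Eq.trans ?_ (hK.eq_sum B B.sum_c a).symm
  rw [extendDerivation, LocalDualFrame.derivation_apply]
  refine Finset.sum_congr rfl fun i _ ↦ ?_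
  rw [← mvfderiv_comp_apply x (B.mdifferentiableAt_coeff i a (ι x))
    (ι.contMDiff.mdifferentiableAt (by simp))]
  rfl

theorem extendDerivation_add {x : N} (v v' : TangentSpace I' x)
    (K K' : Cₛ^∞⟮I; F, V⟯ →ₗ[ℝ] (ι *ᵖ V) x) :
    extendDerivation ι (v + v') (K + K') = extendDerivation ι v K + extendDerivation ι v' K' :=
  LocalDualFrame.derivation_add _ v v' _ _

theorem extendDerivation_smul {x : N} (r : ℝ) (v : TangentSpace I' x)
    (K : Cₛ^∞⟮I; F, V⟯ →ₗ[ℝ] (ι *ᵖ V) x) :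
    extendDerivation ι (r • v) (r • K) = r • extendDerivation ι v K :=
  LocalDualFrame.derivation_smul _ r v _

theorem contMDiff_extendDerivation [FiniteDimensional ℝ E'] [IsManifold I' ∞ N] [T2Space N]
    {X : ∀ x : N, TangentSpace I' x} (hX : CMDiff ∞ (T% X))
    {K : ∀ x : N, Cₛ^∞⟮I; F, V⟯ →ₗ[ℝ] (ι *ᵖ V) x}
    (hK : ∀ x, IsDerivationAt (V := V) (mfderiv% ι x (X x)) (K x))
    (hKs : ∀ a, CMDiff ∞ (fun x ↦ TotalSpace.mk' F (E := ι *ᵖ V) x (K x a)))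
    (s : Cₛ^∞⟮I'; F, (ι *ᵖ V)⟯) :
    CMDiff ∞ (fun x ↦ TotalSpace.mk' F (E := ι *ᵖ V) x (extendDerivation ι (X x) (K x) s)) := by
  intro x₀
  let B₀ := localDualFrameAt I F V (ι x₀)
  let B := B₀.pullback ι
  have hsum : CMDiffAt ∞ (fun x ↦ TotalSpace.mk' F (E := ι *ᵖ V) x
      (∑ i, (B.coeff i s x • (K x (B₀.e i) : (ι *ᵖ V) x) + d% (B.coeff i s) x (X x) • B.e i x)))
      x₀ :=
    ContMDiffAt.sum_section fun i _ ↦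
      ((B.coeff i s).contMDiff.contMDiffAt.smul_section (hKs _ x₀)).add_section
        ((contMDiffAt_mvfderiv_apply (B.coeff i s).contMDiff.contMDiffAt (hX x₀)
          (by simp)).smul_section ((B.e i).contMDiff x₀))
  refine hsum.congr_of_eventuallyEq ?_
  filter_upwards [eventually_eventually_nhds.2 B.sum_c] with x hx
  congr 1
  rw [(isDerivationAt_extendDerivation (X x) (K x)).eq_sum B hx]
  refine Finset.sum_congr rfl fun i _ ↦ ?_
  congr 2
  exact extendDerivation_pullback (hK x) _

theorem IsDerivationAt.eq_of_pullback [FiniteDimensional ℝ E'] [IsManifold I' ∞ N] [T2Space N]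
    {x : N} {v : TangentSpace I' x} {K K' : Cₛ^∞⟮I'; F, (ι *ᵖ V)⟯ →ₗ[ℝ] (ι *ᵖ V) x}
    (hK : IsDerivationAt v K) (hK' : IsDerivationAt v K')
    (h : ∀ a : Cₛ^∞⟮I; F, V⟯, K (pullbackSection ι a) = K' (pullbackSection ι a)) : K = K' := by
  ext s
  exact pullback_section_induction ι x (Q := fun s ↦ K s = K' s) h
    (fun s t hs ht ↦ by rw [map_add, map_add, hs, ht])
    (fun f s hs ↦ by rw [hK, hK', hs])
    (fun s t hst hs ↦ by rw [← hK.congr hst, ← hK'.congr hst, hs]) s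

end Extension

/-! ### Restriction of a Lie algebroid -/

section CyclicInduction

variable {E : Type*} [NormedAddCommGroup E] [NormedSpace ℝ E] [FiniteDimensional ℝ E]
  {H : Type*} [TopologicalSpace H] {I : ModelWithCorners ℝ E H}
  {M : Type*} [TopologicalSpace M] [ChartedSpace H M] [IsManifold I ∞ M] [T2Space M]
  {F : Type*} [NormedAddCommGroup F] [NormedSpace ℝ F] [FiniteDimensional ℝ F]
  {V : M → Type*} [TopologicalSpace (TotalSpace F V)]
  [∀ x, AddCommGroup (V x)] [∀ x, Module ℝ (V x)] [∀ x, TopologicalSpace (V x)]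
  [FiberBundle F V] [VectorBundle ℝ F V] [ContMDiffVectorBundle ∞ F V I]
  {E' : Type*} [NormedAddCommGroup E'] [NormedSpace ℝ E']
  {H' : Type*} [TopologicalSpace H'] {I' : ModelWithCorners ℝ E' H'}
  {N : Type*} [TopologicalSpace N] [ChartedSpace H' N]

theorem pullback_section_cyclic_eq_zero (ι : C^∞⟮I', N; I, M⟯)
    {A : Type*} [AddCommGroup A] [Module ℝ A] (x : N)
    {Φ : Cₛ^∞⟮I'; F, (ι *ᵖ V)⟯ → Cₛ^∞⟮I'; F, (ι *ᵖ V)⟯ → Cₛ^∞⟮I'; F, (ι *ᵖ V)⟯ → A}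
    (cyclic : ∀ s t w, Φ s t w = Φ t w s)
    (add : ∀ s t w w', Φ s t (w + w') = Φ s t w + Φ s t w')
    (smul : ∀ s t f w, Φ s t (sectionSMul f w) = f x • Φ s t w)
    (congr : ∀ s t w w', (∀ᶠ y in 𝓝 x, w y = w' y) → Φ s t w = Φ s t w')
    (pullback : ∀ a b c : Cₛ^∞⟮I; F, V⟯,
      Φ (pullbackSection ι a) (pullbackSection ι b) (pullbackSection ι c) = 0)
    (s t w : Cₛ^∞⟮I'; F, (ι *ᵖ V)⟯) : Φ s t w = 0 := by
  have extend (s t) (h : ∀ c : Cₛ^∞⟮I; F, V⟯, Φ s t (pullbackSection ι c) = 0) (w) :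
      Φ s t w = 0 :=
    pullback_section_induction ι x (Q := fun w ↦ Φ s t w = 0) h
      (fun w w' hw hw' ↦ by rw [add, hw, hw', add_zero])
      (fun f w hw ↦ by rw [smul, hw, smul_zero])
      (fun w w' hww' hw ↦ by rw [← congr s t w w' hww', hw]) w
  have pullback₂ (a b : Cₛ^∞⟮I; F, V⟯) (w) :
      Φ (pullbackSection ι a) (pullbackSection ι b) w = 0 :=
    extend _ _ (pullback a b) w
  have pullback₁ (a : Cₛ^∞⟮I; F, V⟯) (s t) : Φ s (pullbackSection ι a) t = 0 :=
    extend _ _ (fun b ↦ by rw [cyclic, pullback₂]) t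
  exact extend s t (fun a ↦ by rw [cyclic, pullback₁]) w

end CyclicInduction

section Jacobiator

variable {A : Type*} [AddCommGroup A] [Module ℝ A] (B : A →ₗ[ℝ] A →ₗ[ℝ] A)

/-- The cyclic sum whose vanishing is the Jacobi identity for the bracket `B`. -/
def jacobiator (a b c : A) : A := B a (B b c) + B b (B c a) + B c (B a b)

theorem jacobiator_cyclic (a b c : A) : jacobiator B a b c = jacobiator B b c a := by
  simp only [jacobiator]
  abel

theorem jacobiator_add_right (a b c c' : A) :
    jacobiator B a b (c + c') = jacobiator B a b c + jacobiator B a b c' := by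
  simp only [jacobiator, map_add, LinearMap.add_apply]
  abel

variable {B}

theorem jacobiator_eq_zero_iff (hB : B.IsAlt) (a b c : A) :
    jacobiator B a b c = 0 ↔ B a (B b c) = B (B a b) c + B b (B a c) := by
  rw [jacobiator, ← hB.neg c a, ← hB.neg (B a b) c, map_neg, ← sub_eq_zero (a := B a (B b c))]
  refine Eq.congr_left ?_
  abel

end Jacobiator

section Restriction

variable {E : Type*} [NormedAddCommGroup E] [NormedSpace ℝ E]
  {M : Type*} [TopologicalSpace M] [ChartedSpace E M] [IsManifold 𝓘(ℝ, E) ∞ M]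
  {F : Type*} [NormedAddCommGroup F] [NormedSpace ℝ F]
  {V : M → Type*} [TopologicalSpace (TotalSpace F V)]
  [∀ x, AddCommGroup (V x)] [∀ x, Module ℝ (V x)] [∀ x, TopologicalSpace (V x)]
  [FiberBundle F V] [VectorBundle ℝ F V]
  {E' : Type*} [NormedAddCommGroup E'] [NormedSpace ℝ E']
  {N : Type*} [TopologicalSpace N] [ChartedSpace E' N]
  {𝒜 : LieAlgebroid E F V} {ι : C^∞⟮𝓘(ℝ, E'), N; 𝓘(ℝ, E), M⟯}

/-- `ι` is an immersion to whose image the anchor of `𝒜` is tangent; these are the submanifolds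
to which a Lie algebroid can be restricted. -/
structure LieAlgebroid.IsInvariantImmersion (𝒜 : LieAlgebroid E F V)
    (ι : C^∞⟮𝓘(ℝ, E'), N; 𝓘(ℝ, E), M⟯) : Prop where
  immersion (x : N) : Function.Injective (mfderiv% ι x)
  tangent (x : N) : range (𝒜.anchor (ι x)) ⊆ range (mfderiv% ι x)

namespace LieAlgebroid.IsInvariantImmersion

variable [FiniteDimensional ℝ E] (h𝒜 : 𝒜.IsInvariantImmersion ι)

include h𝒜 in
theorem hasLeftInverse_mfderiv (x : N) : (mfderiv% ι x).HasLeftInverse :=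
  haveI : FiniteDimensional ℝ (TangentSpace 𝓘(ℝ, E) (ι x)) :=
    inferInstanceAs (FiniteDimensional ℝ E)
  haveI : T2Space (TangentSpace 𝓘(ℝ, E) (ι x)) := inferInstanceAs (T2Space E)
  .of_injective_of_finiteDimensional (h𝒜.immersion x)

/-- The anchor of `𝒜`, with values in the tangent spaces of the immersed submanifold. -/
def restrictAnchor (x : N) : (ι *ᵖ V) x →L[ℝ] TangentSpace 𝓘(ℝ, E') x :=
  (h𝒜.hasLeftInverse_mfderiv x).leftInverse.comp (𝒜.anchor (ι x))

theorem mfderiv_restrictAnchor (x : N) (a : (ι *ᵖ V) x) :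
    mfderiv% ι x (h𝒜.restrictAnchor x a) = 𝒜.anchor (ι x) a := by
  obtain ⟨v, hv⟩ := h𝒜.tangent x (mem_range_self a)
  have hav : h𝒜.restrictAnchor x a = v :=
    (congrArg _ hv.symm).trans ((h𝒜.hasLeftInverse_mfderiv x).leftInverse_leftInverse v)
  rw [hav, hv]

section Anchor

variable [FiniteDimensional ℝ E'] [IsManifold 𝓘(ℝ, E') ∞ N] [FiniteDimensional ℝ F]

theorem contMDiff_restrictAnchor :
    CMDiff ∞ (fun x ↦ TotalSpace.mk' (F →L[ℝ] E')
      (E := fun x ↦ (ι *ᵖ V) x →L[ℝ] TangentSpace 𝓘(ℝ, E') x) x (h𝒜.restrictAnchor x)) := by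
  intro x₀
  refine contMDiffAt_hom_of_apply (V := ι *ᵖ V) (W := (TangentSpace 𝓘(ℝ, E') : N → Type _))
    fun s hs ↦ contMDiffAt_vectorField_of_mfderiv ι.contMDiff.contMDiffAt (h𝒜.immersion x₀) ?_
  simp only [h𝒜.mfderiv_restrictAnchor]
  exact ContMDiffAt.clm_bundle_apply (E₁ := V) (b := ι)
    (𝒜.anchor_contMDiff.contMDiffAt.comp x₀ ι.contMDiff.contMDiffAt)
    ((contMDiffAt_pullback_section_iff ι).1 hs)

theorem contMDiff_restrictAnchor_apply (s : Cₛ^∞⟮𝓘(ℝ, E'); F, (ι *ᵖ V)⟯) :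
    CMDiff ∞ (T% fun x ↦ h𝒜.restrictAnchor x (s x)) :=
  h𝒜.contMDiff_restrictAnchor.clm_bundle_apply s.contMDiff

end Anchor

theorem isDerivationAt_bracket_pullback (b : Cₛ^∞⟮𝓘(ℝ, E); F, V⟯) (x : N) :
    IsDerivationAt (mfderiv% ι x (h𝒜.restrictAnchor x (pullbackSection ι b x)))
      (sectionEval 𝓘(ℝ, E) F V (ι x) ∘ₗ 𝒜.bracket b) := by
  rw [h𝒜.mfderiv_restrictAnchor]
  exact 𝒜.isDerivationAt_bracket b (ι x)

variable [FiniteDimensional ℝ F] [T2Space M] [ContMDiffVectorBundle ∞ F V 𝓘(ℝ, E)]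

/-- The derivation `s ↦ [ι^* b, s] x`, determined by `[ι^* b, ι^* a] = ι^* [b, a]`. -/
def bracketOfPullback (b : Cₛ^∞⟮𝓘(ℝ, E); F, V⟯) (x : N) :
    Cₛ^∞⟮𝓘(ℝ, E'); F, (ι *ᵖ V)⟯ →ₗ[ℝ] (ι *ᵖ V) x :=
  extendDerivation ι (h𝒜.restrictAnchor x (pullbackSection ι b x))
    (sectionEval 𝓘(ℝ, E) F V (ι x) ∘ₗ 𝒜.bracket b)

theorem isDerivationAt_bracketOfPullback (b : Cₛ^∞⟮𝓘(ℝ, E); F, V⟯) (x : N) :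
    IsDerivationAt (h𝒜.restrictAnchor x (pullbackSection ι b x)) (h𝒜.bracketOfPullback b x) :=
  isDerivationAt_extendDerivation _ _

theorem bracketOfPullback_pullback (a b : Cₛ^∞⟮𝓘(ℝ, E); F, V⟯) (x : N) :
    h𝒜.bracketOfPullback b x (pullbackSection ι a) = pullbackSection ι (𝒜.bracket b a) x :=
  extendDerivation_pullback (h𝒜.isDerivationAt_bracket_pullback b x) a

/-- The map `b ↦ [s, ι^* b] x`, linear in `s` too. -/
def bracketWithPullback (x : N) :
    Cₛ^∞⟮𝓘(ℝ, E'); F, (ι *ᵖ V)⟯ →ₗ[ℝ] Cₛ^∞⟮𝓘(ℝ, E); F, V⟯ →ₗ[ℝ] (ι *ᵖ V) x :=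
  -LinearMap.flip
    { toFun b := h𝒜.bracketOfPullback b x
      map_add' b b' := (congrArg₂ (extendDerivation ι)
        (map_add (h𝒜.restrictAnchor x) (pullbackSection ι b x) (pullbackSection ι b' x))
        (map_add (𝒜.bracket.compr₂ (sectionEval 𝓘(ℝ, E) F V (ι x))) b b')).trans
          (extendDerivation_add _ _ _ _)
      map_smul' r b := (congrArg₂ (extendDerivation ι)
        (map_smul (h𝒜.restrictAnchor x) r (pullbackSection ι b x))
        (map_smul (𝒜.bracket.compr₂ (sectionEval 𝓘(ℝ, E) F V (ι x))) r b)).trans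
          (extendDerivation_smul _ _ _) }

variable [FiniteDimensional ℝ E'] [IsManifold 𝓘(ℝ, E') ∞ N] [T2Space N]

theorem contMDiff_bracketOfPullback (b : Cₛ^∞⟮𝓘(ℝ, E); F, V⟯)
    (s : Cₛ^∞⟮𝓘(ℝ, E'); F, (ι *ᵖ V)⟯) :
    CMDiff ∞ (fun x ↦ TotalSpace.mk' F (E := ι *ᵖ V) x (h𝒜.bracketOfPullback b x s)) :=
  contMDiff_extendDerivation (h𝒜.contMDiff_restrictAnchor_apply _)
    (h𝒜.isDerivationAt_bracket_pullback b)
    (fun a ↦ (pullbackSection ι (𝒜.bracket b a)).contMDiff) s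

theorem bracketOfPullback_sectionSMul_left (f : C^∞⟮𝓘(ℝ, E), M; 𝓘(ℝ, ℝ), ℝ⟯)
    (b : Cₛ^∞⟮𝓘(ℝ, E); F, V⟯) (s : Cₛ^∞⟮𝓘(ℝ, E'); F, (ι *ᵖ V)⟯) (x : N) :
    h𝒜.bracketOfPullback (sectionSMul f b) x s = f (ι x) • h𝒜.bracketOfPullback b x s -
      d% f (ι x) (mfderiv% ι x (h𝒜.restrictAnchor x (s x))) • pullbackSection ι b x := by
  have hsymbol : h𝒜.restrictAnchor x (pullbackSection ι (sectionSMul f b) x) =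
      f (ι x) • h𝒜.restrictAnchor x (pullbackSection ι b x) :=
    map_smul (h𝒜.restrictAnchor x) (f (ι x)) (pullbackSection ι b x)
  have hfb := h𝒜.isDerivationAt_bracketOfPullback (sectionSMul f b) x
  have hb := h𝒜.isDerivationAt_bracketOfPullback b x
  rw [hsymbol] at hfb
  refine pullback_section_induction ι x (Q := fun s ↦ h𝒜.bracketOfPullback (sectionSMul f b) x s =
    f (ι x) • h𝒜.bracketOfPullback b x s -
      d% f (ι x) (mfderiv% ι x (h𝒜.restrictAnchor x (s x))) • pullbackSection ι b x) ?_ ?_ ?_ ?_ s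
  · intro a
    rw [bracketOfPullback_pullback, bracketOfPullback_pullback, h𝒜.mfderiv_restrictAnchor]
    exact 𝒜.bracket_sectionSMul_left f b a (ι x)
  · intro s t hs ht
    rw [map_add, map_add, hs, ht, ContMDiffSection.coe_add, Pi.add_apply, map_add, map_add,
      map_add]
    module
  · intro g s hs
    rw [hfb, hb, hs, sectionSMul_apply, map_smul, map_smul, map_smul, map_smul, smul_eq_mul,
      smul_eq_mul]
    module
  · intro s t hst hs
    rw [← hfb.congr hst, ← hb.congr hst, ← hst.self_of_nhds, hs]

theorem isDerivationAt_bracketWithPullback (s : Cₛ^∞⟮𝓘(ℝ, E'); F, (ι *ᵖ V)⟯) (x : N) :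
    IsDerivationAt (V := V) (mfderiv% ι x (h𝒜.restrictAnchor x (s x)))
      (h𝒜.bracketWithPullback x s) := by
  intro f b
  calc
    _ = -h𝒜.bracketOfPullback (sectionSMul f b) x s := rfl
    _ = f (ι x) • -h𝒜.bracketOfPullback b x s +
        d% f (ι x) (mfderiv% ι x (h𝒜.restrictAnchor x (s x))) • pullbackSection ι b x := by
      rw [bracketOfPullback_sectionSMul_left]
      module

/-- The bracket of the restriction of a Lie algebroid: `[s, ·]` extends `b ↦ [s, ι^* b]`. -/
def restrictBracket : Cₛ^∞⟮𝓘(ℝ, E'); F, (ι *ᵖ V)⟯ →ₗ[ℝ] Cₛ^∞⟮𝓘(ℝ, E'); F, (ι *ᵖ V)⟯ →ₗ[ℝ]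
    Cₛ^∞⟮𝓘(ℝ, E'); F, (ι *ᵖ V)⟯ :=
  LinearMap.mk₂ ℝ
    (fun s t ↦
      ⟨fun x ↦ extendDerivation ι (h𝒜.restrictAnchor x (s x)) (h𝒜.bracketWithPullback x s) t,
        contMDiff_extendDerivation (h𝒜.contMDiff_restrictAnchor_apply s)
          (h𝒜.isDerivationAt_bracketWithPullback s)
          (fun b ↦ (-(⟨_, h𝒜.contMDiff_bracketOfPullback b s⟩ :
            Cₛ^∞⟮𝓘(ℝ, E'); F, (ι *ᵖ V)⟯)).contMDiff) t⟩)
    (fun s s' t ↦ by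
      ext x
      simp only [ContMDiffSection.coe_add, Pi.add_apply, map_add, extendDerivation_add,
        LinearMap.add_apply, ContMDiffSection.coeFn_mk])
    (fun r s t ↦ by
      ext x
      simp only [ContMDiffSection.coe_smul, Pi.smul_apply, map_smul, extendDerivation_smul,
        LinearMap.smul_apply, ContMDiffSection.coeFn_mk])
    (fun s t t' ↦ by
      ext x
      exact map_add (extendDerivation ι _ _) t t')
    (fun r s t ↦ by
      ext x
      exact map_smul (extendDerivation ι _ _) r t)

theorem restrictBracket_pullback_right (s : Cₛ^∞⟮𝓘(ℝ, E'); F, (ι *ᵖ V)⟯)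
    (b : Cₛ^∞⟮𝓘(ℝ, E); F, V⟯) (x : N) :
    h𝒜.restrictBracket s (pullbackSection ι b) x = -h𝒜.bracketOfPullback b x s :=
  extendDerivation_pullback (h𝒜.isDerivationAt_bracketWithPullback s x) b

theorem isDerivationAt_restrictBracket (s : Cₛ^∞⟮𝓘(ℝ, E'); F, (ι *ᵖ V)⟯) (x : N) :
    IsDerivationAt (h𝒜.restrictAnchor x (s x))
      (sectionEval 𝓘(ℝ, E') F (ι *ᵖ V) x ∘ₗ h𝒜.restrictBracket s) :=
  isDerivationAt_extendDerivation (h𝒜.restrictAnchor x (s x)) (h𝒜.bracketWithPullback x s)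

theorem restrictBracket_sectionSMul_right (f : C^∞⟮𝓘(ℝ, E'), N; 𝓘(ℝ, ℝ), ℝ⟯)
    (s t : Cₛ^∞⟮𝓘(ℝ, E'); F, (ι *ᵖ V)⟯) (x : N) :
    h𝒜.restrictBracket s (sectionSMul f t) x =
      f x • h𝒜.restrictBracket s t x + d% f x (h𝒜.restrictAnchor x (s x)) • t x :=
  h𝒜.isDerivationAt_restrictBracket s x f t

theorem restrictBracket_congr_right (s : Cₛ^∞⟮𝓘(ℝ, E'); F, (ι *ᵖ V)⟯)
    {t t' : Cₛ^∞⟮𝓘(ℝ, E'); F, (ι *ᵖ V)⟯} {x : N} (h : ∀ᶠ y in 𝓝 x, t y = t' y) :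
    h𝒜.restrictBracket s t x = h𝒜.restrictBracket s t' x :=
  (h𝒜.isDerivationAt_restrictBracket s x).congr h

theorem restrictBracket_pullback_left (b : Cₛ^∞⟮𝓘(ℝ, E); F, V⟯)
    (s : Cₛ^∞⟮𝓘(ℝ, E'); F, (ι *ᵖ V)⟯) (x : N) :
    h𝒜.restrictBracket (pullbackSection ι b) s x = h𝒜.bracketOfPullback b x s := by
  have h := (h𝒜.isDerivationAt_restrictBracket (pullbackSection ι b) x).eq_of_pullback
    (h𝒜.isDerivationAt_bracketOfPullback b x) fun a ↦ by
      rw [LinearMap.comp_apply, sectionEval_apply, restrictBracket_pullback_right,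
        bracketOfPullback_pullback, bracketOfPullback_pullback, 𝒜.bracket_swap b a]
      rfl
  exact LinearMap.congr_fun h s

theorem restrictBracket_pullback (a b : Cₛ^∞⟮𝓘(ℝ, E); F, V⟯) :
    h𝒜.restrictBracket (pullbackSection ι a) (pullbackSection ι b) =
      pullbackSection ι (𝒜.bracket a b) := by
  ext x
  rw [restrictBracket_pullback_left, bracketOfPullback_pullback]

end LieAlgebroid.IsInvariantImmersion

end Restriction

section RestrictedAlgebroid

variable {E : Type*} [NormedAddCommGroup E] [NormedSpace ℝ E]
  {M : Type*} [TopologicalSpace M] [ChartedSpace E M] [IsManifold 𝓘(ℝ, E) ∞ M]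
  {F : Type*} [NormedAddCommGroup F] [NormedSpace ℝ F]
  {V : M → Type*} [TopologicalSpace (TotalSpace F V)]
  [∀ x, AddCommGroup (V x)] [∀ x, Module ℝ (V x)] [∀ x, TopologicalSpace (V x)]
  [FiberBundle F V] [VectorBundle ℝ F V]
  {E' : Type*} [NormedAddCommGroup E'] [NormedSpace ℝ E']
  {N : Type*} [TopologicalSpace N] [ChartedSpace E' N] [IsManifold 𝓘(ℝ, E') ∞ N]
  {𝒜 : LieAlgebroid E F V} {ι : C^∞⟮𝓘(ℝ, E'), N; 𝓘(ℝ, E), M⟯}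

theorem LieAlgebroid.IsRestriction.bracket_pullback {𝒜N : LieAlgebroid E' F (ι *ᵖ V)}
    (h : 𝒜.IsRestriction ι 𝒜N) (a b : Cₛ^∞⟮𝓘(ℝ, E); F, V⟯) :
    𝒜N.bracket (pullbackSection ι a) (pullbackSection ι b) = pullbackSection ι (𝒜.bracket a b) :=
  ContMDiffSection.ext fun x ↦ h.bracket_eq a b _ _ (fun _ ↦ rfl) (fun _ ↦ rfl) x

variable [FiniteDimensional ℝ E] [T2Space M] [FiniteDimensional ℝ F]
  [ContMDiffVectorBundle ∞ F V 𝓘(ℝ, E)] [FiniteDimensional ℝ E'] [T2Space N]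

namespace LieAlgebroid.IsInvariantImmersion

variable (h𝒜 : 𝒜.IsInvariantImmersion ι)

theorem restrictBracket_sectionSMul_left (f : C^∞⟮𝓘(ℝ, E'), N; 𝓘(ℝ, ℝ), ℝ⟯)
    (s t : Cₛ^∞⟮𝓘(ℝ, E'); F, (ι *ᵖ V)⟯) (x : N) :
    h𝒜.restrictBracket (sectionSMul f s) t x =
      f x • h𝒜.restrictBracket s t x - d% f x (h𝒜.restrictAnchor x (t x)) • s x := by
  refine pullback_section_induction ι x (Q := fun t ↦ h𝒜.restrictBracket (sectionSMul f s) t x =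
    f x • h𝒜.restrictBracket s t x - d% f x (h𝒜.restrictAnchor x (t x)) • s x) ?_ ?_ ?_ ?_ t
  · intro b
    rw [restrictBracket_pullback_right, restrictBracket_pullback_right,
      h𝒜.isDerivationAt_bracketOfPullback b x]
    module
  · intro t t' ht ht'
    rw [map_add, map_add, ContMDiffSection.coe_add, ContMDiffSection.coe_add,
      ContMDiffSection.coe_add, Pi.add_apply, Pi.add_apply, Pi.add_apply, ht, ht', map_add,
      map_add]
    module
  · intro g t ht
    rw [restrictBracket_sectionSMul_right, restrictBracket_sectionSMul_right, ht,
      sectionSMul_apply, sectionSMul_apply, map_smul, map_smul, map_smul, map_smul, smul_eq_mul,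
      smul_eq_mul]
    module
  · intro t t' htt' ht
    rw [← h𝒜.restrictBracket_congr_right _ htt', ← h𝒜.restrictBracket_congr_right s htt',
      ← htt'.self_of_nhds, ht]

theorem restrictBracket_swap (s t : Cₛ^∞⟮𝓘(ℝ, E'); F, (ι *ᵖ V)⟯) :
    h𝒜.restrictBracket s t = -h𝒜.restrictBracket t s := by
  ext x
  have hleft : IsDerivationAt (h𝒜.restrictAnchor x (s x))
      (-(sectionEval 𝓘(ℝ, E') F (ι *ᵖ V) x ∘ₗ h𝒜.restrictBracket.flip s)) := by
    intro f t
    simp only [LinearMap.neg_apply, LinearMap.comp_apply, LinearMap.flip_apply, sectionEval_apply,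
      restrictBracket_sectionSMul_left]
    module
  refine LinearMap.congr_fun ((h𝒜.isDerivationAt_restrictBracket s x).eq_of_pullback hleft
    fun b ↦ ?_) t
  simp only [LinearMap.neg_apply, LinearMap.comp_apply, LinearMap.flip_apply, sectionEval_apply,
    restrictBracket_pullback_left, restrictBracket_pullback_right]

theorem restrictBracket_self (s : Cₛ^∞⟮𝓘(ℝ, E'); F, (ι *ᵖ V)⟯) : h𝒜.restrictBracket s s = 0 :=
  haveI : IsAddTorsionFree Cₛ^∞⟮𝓘(ℝ, E'); F, (ι *ᵖ V)⟯ := .of_isTorsionFree ℝ _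
  self_eq_neg.1 (h𝒜.restrictBracket_swap s s)

theorem restrictBracket_congr_left {s s' : Cₛ^∞⟮𝓘(ℝ, E'); F, (ι *ᵖ V)⟯}
    (t : Cₛ^∞⟮𝓘(ℝ, E'); F, (ι *ᵖ V)⟯) {x : N} (h : ∀ᶠ y in 𝓝 x, s y = s' y) :
    h𝒜.restrictBracket s t x = h𝒜.restrictBracket s' t x := by
  rw [restrictBracket_swap, h𝒜.restrictBracket_swap s', ContMDiffSection.coe_neg,
    ContMDiffSection.coe_neg, Pi.neg_apply, Pi.neg_apply, h𝒜.restrictBracket_congr_right t h]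

theorem restrictAnchor_restrictBracket_of_pullback (s : Cₛ^∞⟮𝓘(ℝ, E'); F, (ι *ᵖ V)⟯) (x : N)
    (h : ∀ b : Cₛ^∞⟮𝓘(ℝ, E); F, V⟯,
      h𝒜.restrictAnchor x (h𝒜.restrictBracket s (pullbackSection ι b) x) =
        mlieBracket 𝓘(ℝ, E') (fun y ↦ h𝒜.restrictAnchor y (s y))
          (fun y ↦ h𝒜.restrictAnchor y (pullbackSection ι b y)) x)
    (t : Cₛ^∞⟮𝓘(ℝ, E'); F, (ι *ᵖ V)⟯) :
    h𝒜.restrictAnchor x (h𝒜.restrictBracket s t x) =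
      mlieBracket 𝓘(ℝ, E') (fun y ↦ h𝒜.restrictAnchor y (s y))
        (fun y ↦ h𝒜.restrictAnchor y (t y)) x := by
  have hdiff (t : Cₛ^∞⟮𝓘(ℝ, E'); F, (ι *ᵖ V)⟯) :
      MDiffAt (T% fun y ↦ h𝒜.restrictAnchor y (t y)) x :=
    (h𝒜.contMDiff_restrictAnchor_apply t).mdifferentiableAt (by simp)
  refine pullback_section_induction ι x (Q := fun t ↦
    h𝒜.restrictAnchor x (h𝒜.restrictBracket s t x) =
      mlieBracket 𝓘(ℝ, E') (fun y ↦ h𝒜.restrictAnchor y (s y))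
        (fun y ↦ h𝒜.restrictAnchor y (t y)) x) h ?_ ?_ ?_ t
  · intro t t' ht ht'
    have hadd : (fun y ↦ h𝒜.restrictAnchor y ((t + t') y)) =
        (fun y ↦ h𝒜.restrictAnchor y (t y)) + fun y ↦ h𝒜.restrictAnchor y (t' y) :=
      funext fun y ↦ map_add (h𝒜.restrictAnchor y) (t y) (t' y)
    rw [hadd, mlieBracket_add_right (hdiff t) (hdiff t'), map_add, ContMDiffSection.coe_add,
      Pi.add_apply, map_add, ht, ht']
  · intro f t ht
    have hsmul : (fun y ↦ h𝒜.restrictAnchor y (sectionSMul f t y)) =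
        (f : N → ℝ) • fun y ↦ h𝒜.restrictAnchor y (t y) :=
      funext fun y ↦ map_smul (h𝒜.restrictAnchor y) (f y) (t y)
    rw [hsmul, mlieBracket_smul_right (f.contMDiff.mdifferentiableAt (by simp)) (hdiff t),
      restrictBracket_sectionSMul_right, map_add, map_smul, map_smul, ht, add_comm]
  · intro t t' htt' ht
    rw [← h𝒜.restrictBracket_congr_right s htt', ht]
    refine Filter.EventuallyEq.mlieBracket_vectorField_eq (EventuallyEq.refl _ _) ?_
    filter_upwards [htt'] with y hy
    rw [hy]

theorem restrictAnchor_restrictBracket (s t : Cₛ^∞⟮𝓘(ℝ, E'); F, (ι *ᵖ V)⟯) (x : N) :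
    h𝒜.restrictAnchor x (h𝒜.restrictBracket s t x) =
      mlieBracket 𝓘(ℝ, E') (fun y ↦ h𝒜.restrictAnchor y (s y))
        (fun y ↦ h𝒜.restrictAnchor y (t y)) x := by
  refine h𝒜.restrictAnchor_restrictBracket_of_pullback s x (fun b ↦ ?_) t
  rw [mlieBracket_swap_apply, restrictBracket_swap, ContMDiffSection.coe_neg, Pi.neg_apply,
    map_neg]
  refine congrArg Neg.neg (h𝒜.restrictAnchor_restrictBracket_of_pullback _ x (fun a ↦ ?_) s)
  apply h𝒜.immersion x
  have hle : (2 : WithTop ℕ∞) ≤ ∞ := by norm_cast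
  have hsmooth (t : Cₛ^∞⟮𝓘(ℝ, E'); F, (ι *ᵖ V)⟯) :
      CMDiffAt 2 (T% fun y ↦ h𝒜.restrictAnchor y (t y)) x :=
    (h𝒜.contMDiff_restrictAnchor_apply t x).of_le hle
  have hrelated (c : Cₛ^∞⟮𝓘(ℝ, E); F, V⟯) : ∀ᶠ y in 𝓝 x,
      mfderiv% ι y (h𝒜.restrictAnchor y (pullbackSection ι c y)) = 𝒜.anchor (ι y) (c (ι y)) :=
    Eventually.of_forall fun y ↦ h𝒜.mfderiv_restrictAnchor y _
  rw [mfderiv_mlieBracket_of_related ((ι.contMDiff x).of_le hle) (hsmooth _) (hsmooth _)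
    ((𝒜.contMDiff_anchor_apply b _).of_le hle) ((𝒜.contMDiff_anchor_apply a _).of_le hle)
    (hrelated b) (hrelated a), mfderiv_restrictAnchor, restrictBracket_pullback]
  exact 𝒜.anchor_bracket b a (ι x)

/-- The derivative of a function along the image of a section under the restricted anchor. -/
def anchorDeriv (s : Cₛ^∞⟮𝓘(ℝ, E'); F, (ι *ᵖ V)⟯) (f : C^∞⟮𝓘(ℝ, E'), N; 𝓘(ℝ, ℝ), ℝ⟯) :
    C^∞⟮𝓘(ℝ, E'), N; 𝓘(ℝ, ℝ), ℝ⟯ :=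
  ⟨fun x ↦ d% f x (h𝒜.restrictAnchor x (s x)), fun x ↦
    contMDiffAt_mvfderiv_apply (f.contMDiff x) (h𝒜.contMDiff_restrictAnchor_apply s x) (by simp)⟩

theorem restrictBracket_sectionSMul (f : C^∞⟮𝓘(ℝ, E'), N; 𝓘(ℝ, ℝ), ℝ⟯)
    (s t : Cₛ^∞⟮𝓘(ℝ, E'); F, (ι *ᵖ V)⟯) :
    h𝒜.restrictBracket s (sectionSMul f t) =
      sectionSMul f (h𝒜.restrictBracket s t) + sectionSMul (h𝒜.anchorDeriv s f) t :=
  ContMDiffSection.ext fun x ↦ h𝒜.restrictBracket_sectionSMul_right f s t x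

theorem anchorDeriv_restrictBracket (f : C^∞⟮𝓘(ℝ, E'), N; 𝓘(ℝ, ℝ), ℝ⟯)
    (s t : Cₛ^∞⟮𝓘(ℝ, E'); F, (ι *ᵖ V)⟯) (x : N) :
    h𝒜.anchorDeriv (h𝒜.restrictBracket s t) f x =
      h𝒜.anchorDeriv s (h𝒜.anchorDeriv t f) x - h𝒜.anchorDeriv t (h𝒜.anchorDeriv s f) x := by
  have hle : (2 : WithTop ℕ∞) ≤ ∞ := by norm_cast
  exact (congrArg (d% f x) (h𝒜.restrictAnchor_restrictBracket s t x)).trans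
    (mvfderiv_mlieBracket ((f.contMDiff x).of_le hle)
      ((h𝒜.contMDiff_restrictAnchor_apply s x).of_le hle)
      ((h𝒜.contMDiff_restrictAnchor_apply t x).of_le hle))

theorem jacobiator_restrictBracket_sectionSMul (f : C^∞⟮𝓘(ℝ, E'), N; 𝓘(ℝ, ℝ), ℝ⟯)
    (s t w : Cₛ^∞⟮𝓘(ℝ, E'); F, (ι *ᵖ V)⟯) (x : N) :
    jacobiator h𝒜.restrictBracket s t (sectionSMul f w) x =
      f x • jacobiator h𝒜.restrictBracket s t w x := by
  have hleft : h𝒜.restrictBracket (sectionSMul f w) (h𝒜.restrictBracket s t) x =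
      f x • h𝒜.restrictBracket w (h𝒜.restrictBracket s t) x -
        h𝒜.anchorDeriv (h𝒜.restrictBracket s t) f x • w x :=
    h𝒜.restrictBracket_sectionSMul_left f w _ x
  rw [h𝒜.anchorDeriv_restrictBracket] at hleft
  simp only [jacobiator, ContMDiffSection.coe_add, Pi.add_apply, hleft]
  rw [h𝒜.restrictBracket_swap _ s, h𝒜.restrictBracket_swap w s]
  simp only [map_neg, restrictBracket_sectionSMul, map_add, ContMDiffSection.coe_add, Pi.add_apply,
    ContMDiffSection.coe_neg, Pi.neg_apply, sectionSMul_apply]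
  module

theorem jacobiator_restrictBracket_congr (s t : Cₛ^∞⟮𝓘(ℝ, E'); F, (ι *ᵖ V)⟯)
    {w w' : Cₛ^∞⟮𝓘(ℝ, E'); F, (ι *ᵖ V)⟯} {x : N} (h : ∀ᶠ y in 𝓝 x, w y = w' y) :
    jacobiator h𝒜.restrictBracket s t w x = jacobiator h𝒜.restrictBracket s t w' x := by
  have hright : ∀ᶠ y in 𝓝 x, h𝒜.restrictBracket t w y = h𝒜.restrictBracket t w' y :=
    h.eventually_nhds.mono fun _ ↦ h𝒜.restrictBracket_congr_right t
  have hleft : ∀ᶠ y in 𝓝 x, h𝒜.restrictBracket w s y = h𝒜.restrictBracket w' s y :=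
    h.eventually_nhds.mono fun _ ↦ h𝒜.restrictBracket_congr_left s
  simp only [jacobiator, ContMDiffSection.coe_add, Pi.add_apply,
    h𝒜.restrictBracket_congr_right s hright, h𝒜.restrictBracket_congr_right t hleft,
    h𝒜.restrictBracket_congr_left _ h]

theorem jacobiator_restrictBracket (s t w : Cₛ^∞⟮𝓘(ℝ, E'); F, (ι *ᵖ V)⟯) :
    jacobiator h𝒜.restrictBracket s t w = 0 := by
  ext x
  refine pullback_section_cyclic_eq_zero ι x
    (Φ := fun s t w ↦ jacobiator h𝒜.restrictBracket s t w x)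
    (fun s t w ↦ by rw [jacobiator_cyclic])
    (fun s t w w' ↦ by rw [jacobiator_add_right, ContMDiffSection.coe_add, Pi.add_apply])
    (fun s t f w ↦ h𝒜.jacobiator_restrictBracket_sectionSMul f s t w x)
    (fun s t w w' ↦ h𝒜.jacobiator_restrictBracket_congr s t) (fun a b c ↦ ?_) s t w
  have h := (jacobiator_eq_zero_iff 𝒜.bracket_self a b c).2 (𝒜.jacobi a b c)
  simp only [jacobiator, restrictBracket_pullback] at h ⊢
  exact congrArg (fun s ↦ pullbackSection ι s x) h

/-- The restriction of a Lie algebroid to an immersed submanifold to which its anchor is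
tangent. -/
def restrict : LieAlgebroid E' F (ι *ᵖ V) where
  anchor := h𝒜.restrictAnchor
  anchor_contMDiff := h𝒜.contMDiff_restrictAnchor
  bracket := h𝒜.restrictBracket
  bracket_self := h𝒜.restrictBracket_self
  jacobi s t w := (jacobiator_eq_zero_iff h𝒜.restrictBracket_self s t w).1
    (h𝒜.jacobiator_restrictBracket s t w)
  anchor_bracket := h𝒜.restrictAnchor_restrictBracket
  leibniz s t ft f hf hft x := by
    obtain rfl : ft = sectionSMul ⟨f, hf⟩ t := ContMDiffSection.ext hft
    exact h𝒜.restrictBracket_sectionSMul_right _ s t x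

theorem isRestriction_restrict : 𝒜.IsRestriction ι h𝒜.restrict where
  anchor_eq := h𝒜.mfderiv_restrictAnchor
  bracket_eq s t s' t' hs ht x := by
    obtain rfl : s' = pullbackSection ι s := ContMDiffSection.ext hs
    obtain rfl : t' = pullbackSection ι t := ContMDiffSection.ext ht
    exact congrArg (fun w : Cₛ^∞⟮𝓘(ℝ, E'); F, (ι *ᵖ V)⟯ ↦ w x) (h𝒜.restrictBracket_pullback s t)

end LieAlgebroid.IsInvariantImmersion

theorem LieAlgebroid.IsRestriction.eq {𝒜₁ 𝒜₂ : LieAlgebroid E' F (ι *ᵖ V)}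
    (hι : ∀ x, Function.Injective (mfderiv% ι x))
    (h₁ : 𝒜.IsRestriction ι 𝒜₁) (h₂ : 𝒜.IsRestriction ι 𝒜₂) : 𝒜₁ = 𝒜₂ := by
  have hanchor (x a) : 𝒜₁.anchor x a = 𝒜₂.anchor x a := hι x <| by
    rw [h₁.anchor_eq, h₂.anchor_eq]
  have bracket_eq_of_pullback (s : Cₛ^∞⟮𝓘(ℝ, E'); F, (ι *ᵖ V)⟯) (x : N)
      (h : ∀ b, 𝒜₁.bracket s (pullbackSection ι b) x = 𝒜₂.bracket s (pullbackSection ι b) x) (t) :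
      𝒜₁.bracket s t x = 𝒜₂.bracket s t x := by
    have h₂s : IsDerivationAt (𝒜₁.anchor x (s x))
        (sectionEval 𝓘(ℝ, E') F (ι *ᵖ V) x ∘ₗ 𝒜₂.bracket s) :=
      hanchor x (s x) ▸ 𝒜₂.isDerivationAt_bracket s x
    exact LinearMap.congr_fun ((𝒜₁.isDerivationAt_bracket s x).eq_of_pullback h₂s h) t
  refine LieAlgebroid.ext hanchor fun s t x ↦ bracket_eq_of_pullback s x (fun b ↦ ?_) t
  rw [𝒜₁.bracket_swap_apply, 𝒜₂.bracket_swap_apply,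
    bracket_eq_of_pullback _ x (fun a ↦ by rw [h₁.bracket_pullback, h₂.bracket_pullback]) s]

end RestrictedAlgebroid

/-! ### Restriction of a symplectic form -/

section TwoForm

variable {E : Type*} [NormedAddCommGroup E] [NormedSpace ℝ E]
  {M : Type*} [TopologicalSpace M] [ChartedSpace E M]
  {F : Type*} [NormedAddCommGroup F] [NormedSpace ℝ F]
  {V : M → Type*} [TopologicalSpace (TotalSpace F V)]
  [∀ x, AddCommGroup (V x)] [∀ x, Module ℝ (V x)] [∀ x, TopologicalSpace (V x)]
  [FiberBundle F V] [VectorBundle ℝ F V] {Ψ : ∀ x, V x →L[ℝ] V x →L[ℝ] ℝ}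

theorem mvfderiv_form_swap (hskew : ∀ x a b, Ψ x a b = -Ψ x b a) (s t : ∀ x, V x) (x : M) :
    d% (fun y ↦ Ψ y (s y) (t y)) x = -d% (fun y ↦ Ψ y (t y) (s y)) x := by
  rw [← mvfderiv_neg]
  exact congrArg (d% · x) (funext fun y ↦ hskew y (s y) (t y))

section Smooth

variable (hΨ : CMDiff ∞ (fun x ↦ TotalSpace.mk' (F →L[ℝ] F →L[ℝ] ℝ)
  (E := fun x ↦ V x →L[ℝ] V x →L[ℝ] ℝ) x (Ψ x)))
include hΨ

theorem contMDiff_form_apply (s t : Cₛ^∞⟮𝓘(ℝ, E); F, V⟯) :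
    CMDiff ∞ (fun x ↦ Ψ x (s x) (t x)) := fun x ↦
  contMDiffAt_hom_hom_const_apply contMDiffAt_id (hΨ x) (s.contMDiff x) (t.contMDiff x)

theorem mvfderiv_form_add_right (s t t' : Cₛ^∞⟮𝓘(ℝ, E); F, V⟯) (x : M) :
    d% (fun y ↦ Ψ y (s y) ((t + t') y)) x =
      d% (fun y ↦ Ψ y (s y) (t y)) x + d% (fun y ↦ Ψ y (s y) (t' y)) x := by
  rw [← mvfderiv_add ((contMDiff_form_apply hΨ s t).mdifferentiableAt (by simp))
    ((contMDiff_form_apply hΨ s t').mdifferentiableAt (by simp))]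
  exact congrArg (d% · x) (funext fun y ↦ map_add (Ψ y (s y)) (t y) (t' y))

theorem mvfderiv_form_sectionSMul_right (f : C^∞⟮𝓘(ℝ, E), M; 𝓘(ℝ, ℝ), ℝ⟯)
    (s t : Cₛ^∞⟮𝓘(ℝ, E); F, V⟯) (x : M) :
    d% (fun y ↦ Ψ y (s y) (sectionSMul f t y)) x =
      f x • d% (fun y ↦ Ψ y (s y) (t y)) x + Ψ x (s x) (t x) • d% f x := by
  rw [← mvfderiv_mul (f.contMDiff.mdifferentiableAt (by simp))
    ((contMDiff_form_apply hΨ s t).mdifferentiableAt (by simp))]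
  exact congrArg (d% · x) (funext fun y ↦ map_smul (Ψ y (s y)) (f y) (t y))

end Smooth

variable {E' : Type*} [NormedAddCommGroup E'] [NormedSpace ℝ E']
  {N : Type*} [TopologicalSpace N] [ChartedSpace E' N]
  (ι : C^∞⟮𝓘(ℝ, E'), N; 𝓘(ℝ, E), M⟯)

/-- The 2-form on the pulled back bundle whose value at `x` is that of `Ψ` at `ι x`. -/
def pullbackForm (Ψ : ∀ x, V x →L[ℝ] V x →L[ℝ] ℝ) (x : N) :
    (ι *ᵖ V) x →L[ℝ] (ι *ᵖ V) x →L[ℝ] ℝ :=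
  Ψ (ι x)

variable {ι} in
theorem contMDiff_pullbackForm [FiniteDimensional ℝ F]
    (hΨ : CMDiff ∞ (fun x ↦ TotalSpace.mk' (F →L[ℝ] F →L[ℝ] ℝ)
      (E := fun x ↦ V x →L[ℝ] V x →L[ℝ] ℝ) x (Ψ x))) :
    CMDiff ∞ (fun x : N ↦ TotalSpace.mk' (F →L[ℝ] F →L[ℝ] ℝ)
      (E := fun x : N ↦ (ι *ᵖ V) x →L[ℝ] (ι *ᵖ V) x →L[ℝ] ℝ) x (pullbackForm ι Ψ x)) := by
  intro x₀
  refine contMDiffAt_hom_of_apply (V := ι *ᵖ V) (W := fun x : N ↦ (ι *ᵖ V) x →L[ℝ] ℝ)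
    fun s hs ↦ contMDiffAt_hom_const_of_apply (V := ι *ᵖ V) fun t ht ↦ ?_
  exact contMDiffAt_hom_hom_const_apply (V := V) (V' := V) (ι.contMDiff x₀)
    ((hΨ _).comp x₀ (ι.contMDiff x₀)) ((contMDiffAt_pullback_section_iff ι).1 hs)
    ((contMDiffAt_pullback_section_iff ι).1 ht)

variable [IsManifold 𝓘(ℝ, E) ∞ M]

namespace LieAlgebroid

variable (𝒜 : LieAlgebroid E F V)

/-- The Lie algebroid differential of the 2-form `Ψ`, evaluated on three sections. -/
def twoFormDifferential (Ψ : ∀ x, V x →L[ℝ] V x →L[ℝ] ℝ) (s t w : Cₛ^∞⟮𝓘(ℝ, E); F, V⟯)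
    (x : M) : ℝ :=
  d% (fun y ↦ Ψ y (t y) (w y)) x (𝒜.anchor x (s x))
    - d% (fun y ↦ Ψ y (s y) (w y)) x (𝒜.anchor x (t x))
    + d% (fun y ↦ Ψ y (s y) (t y)) x (𝒜.anchor x (w x))
    - Ψ x (𝒜.bracket s t x) (w x) + Ψ x (𝒜.bracket s w x) (t x) - Ψ x (𝒜.bracket t w x) (s x)

theorem twoFormDifferential_cyclic (hskew : ∀ x a b, Ψ x a b = -Ψ x b a)
    (s t w : Cₛ^∞⟮𝓘(ℝ, E); F, V⟯) (x : M) :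
    𝒜.twoFormDifferential Ψ s t w x = 𝒜.twoFormDifferential Ψ t w s x := by
  simp only [twoFormDifferential, mvfderiv_form_swap hskew w s, mvfderiv_form_swap hskew t s,
    𝒜.bracket_swap_apply t s, 𝒜.bracket_swap_apply w s, map_neg, neg_apply]
  ring

theorem twoFormDifferential_congr_right [FiniteDimensional ℝ E] [T2Space M]
    (s t : Cₛ^∞⟮𝓘(ℝ, E); F, V⟯) {w w' : Cₛ^∞⟮𝓘(ℝ, E); F, V⟯} {x : M}
    (h : ∀ᶠ y in 𝓝 x, w y = w' y) :
    𝒜.twoFormDifferential Ψ s t w x = 𝒜.twoFormDifferential Ψ s t w' x := by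
  have hd (s : Cₛ^∞⟮𝓘(ℝ, E); F, V⟯) :
      d% (fun y ↦ Ψ y (s y) (w y)) x = d% (fun y ↦ Ψ y (s y) (w' y)) x :=
    mvfderiv_congr_of_eventuallyEq (h.mono fun y hy ↦ congrArg (Ψ y (s y)) hy)
  simp only [twoFormDifferential, hd, 𝒜.bracket_congr_right _ h, h.self_of_nhds]

variable (hΨ : CMDiff ∞ (fun x ↦ TotalSpace.mk' (F →L[ℝ] F →L[ℝ] ℝ)
  (E := fun x ↦ V x →L[ℝ] V x →L[ℝ] ℝ) x (Ψ x)))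
include hΨ

theorem twoFormDifferential_add_right (s t w w' : Cₛ^∞⟮𝓘(ℝ, E); F, V⟯) (x : M) :
    𝒜.twoFormDifferential Ψ s t (w + w') x =
      𝒜.twoFormDifferential Ψ s t w x + 𝒜.twoFormDifferential Ψ s t w' x := by
  simp only [twoFormDifferential, mvfderiv_form_add_right hΨ]
  simp only [map_add, ContMDiffSection.coe_add, Pi.add_apply, add_apply]
  ring

theorem twoFormDifferential_sectionSMul_right (hskew : ∀ x a b, Ψ x a b = -Ψ x b a)
    (f : C^∞⟮𝓘(ℝ, E), M; 𝓘(ℝ, ℝ), ℝ⟯) (s t w : Cₛ^∞⟮𝓘(ℝ, E); F, V⟯) (x : M) :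
    𝒜.twoFormDifferential Ψ s t (sectionSMul f w) x =
      f x • 𝒜.twoFormDifferential Ψ s t w x := by
  simp only [twoFormDifferential, mvfderiv_form_sectionSMul_right hΨ]
  simp only [bracket_sectionSMul_right, sectionSMul_apply, map_add, map_smul, add_apply,
    smul_apply, smul_eq_mul, hskew x (w x) (t x), hskew x (w x) (s x)]
  ring

end LieAlgebroid

variable {ι} {𝒜 : LieAlgebroid E F V}
variable (hΨ : CMDiff ∞ (fun x ↦ TotalSpace.mk' (F →L[ℝ] F →L[ℝ] ℝ)
  (E := fun x ↦ V x →L[ℝ] V x →L[ℝ] ℝ) x (Ψ x)))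
include hΨ

namespace LieAlgebroid.IsRestriction

variable [IsManifold 𝓘(ℝ, E') ∞ N] {𝒜N : LieAlgebroid E' F (ι *ᵖ V)}
  (h𝒜N : 𝒜.IsRestriction ι 𝒜N)
include h𝒜N

theorem mvfderiv_pullbackForm_anchor (a b c : Cₛ^∞⟮𝓘(ℝ, E); F, V⟯) (x : N) :
    d% (fun y ↦ pullbackForm ι Ψ y (pullbackSection ι a y) (pullbackSection ι b y)) x
        (𝒜N.anchor x (pullbackSection ι c x)) =
      d% (fun y ↦ Ψ y (a y) (b y)) (ι x) (𝒜.anchor (ι x) (c (ι x))) :=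
  (mvfderiv_comp_apply x ((contMDiff_form_apply hΨ a b).mdifferentiableAt (by simp))
    (ι.contMDiff.mdifferentiableAt (by simp)) _).trans
    (congrArg (d% (fun y ↦ Ψ y (a y) (b y)) (ι x)) (h𝒜N.anchor_eq x _))

theorem twoFormDifferential_pullbackSection (a b c : Cₛ^∞⟮𝓘(ℝ, E); F, V⟯) (x : N) :
    𝒜N.twoFormDifferential (pullbackForm ι Ψ) (pullbackSection ι a) (pullbackSection ι b)
        (pullbackSection ι c) x = 𝒜.twoFormDifferential Ψ a b c (ι x) := by
  simp only [twoFormDifferential, h𝒜N.mvfderiv_pullbackForm_anchor hΨ, h𝒜N.bracket_pullback]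
  rfl

theorem twoFormDifferential_pullbackForm_eq_zero [FiniteDimensional ℝ E] [T2Space M]
    [FiniteDimensional ℝ F] [ContMDiffVectorBundle ∞ F V 𝓘(ℝ, E)]
    [FiniteDimensional ℝ E'] [T2Space N] (hskew : ∀ x a b, Ψ x a b = -Ψ x b a)
    (hclosed : ∀ a b c x, 𝒜.twoFormDifferential Ψ a b c x = 0)
    (s t w : Cₛ^∞⟮𝓘(ℝ, E'); F, (ι *ᵖ V)⟯) (x : N) :
    𝒜N.twoFormDifferential (pullbackForm ι Ψ) s t w x = 0 := by
  have hskewN (x : N) (a b : (ι *ᵖ V) x) : pullbackForm ι Ψ x a b = -pullbackForm ι Ψ x b a :=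
    hskew (ι x) a b
  refine pullback_section_cyclic_eq_zero ι x
    (Φ := fun s t w ↦ 𝒜N.twoFormDifferential (pullbackForm ι Ψ) s t w x)
    (fun s t w ↦ 𝒜N.twoFormDifferential_cyclic hskewN s t w x)
    (fun s t w w' ↦ 𝒜N.twoFormDifferential_add_right (contMDiff_pullbackForm hΨ) s t w w' x)
    (fun s t f w ↦ 𝒜N.twoFormDifferential_sectionSMul_right (contMDiff_pullbackForm hΨ) hskewN
      f s t w x)
    (fun s t _ _ ↦ 𝒜N.twoFormDifferential_congr_right s t) (fun a b c ↦ ?_) s t w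
  rw [h𝒜N.twoFormDifferential_pullbackSection hΨ, hclosed]

end LieAlgebroid.IsRestriction

end TwoForm

section RestrictedForm

variable {E : Type*} [NormedAddCommGroup E] [NormedSpace ℝ E]
  {M : Type*} [TopologicalSpace M] [ChartedSpace E M] [IsManifold 𝓘(ℝ, E) ∞ M]
  {F : Type*} [NormedAddCommGroup F] [NormedSpace ℝ F]
  {V : M → Type*} [TopologicalSpace (TotalSpace F V)]
  [∀ x, AddCommGroup (V x)] [∀ x, Module ℝ (V x)] [∀ x, TopologicalSpace (V x)]
  [FiberBundle F V] [VectorBundle ℝ F V] {𝒜 : LieAlgebroid E F V}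

namespace SymplecticForm

theorem ext {Ω Ω' : SymplecticForm 𝒜} (h : ∀ x, Ω.form x = Ω'.form x) : Ω = Ω' := by
  have hform : Ω.form = Ω'.form := funext h
  cases Ω; cases Ω'
  congr

variable (Ω : SymplecticForm 𝒜)

theorem form_swap (x : M) (a b : V x) : Ω.form x a b = -Ω.form x b a := by
  have h := Ω.alternating x (a + b)
  simp only [map_add, add_apply, Ω.alternating, zero_add, add_zero] at h
  linarith

theorem eq_of_form_eq {x : M} {a a' : V x} (h : ∀ b, Ω.form x a b = Ω.form x a' b) : a = a' := by
  rw [← sub_eq_zero]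
  refine Ω.nondegenerate x _ fun b ↦ ?_
  rw [map_sub, sub_apply, h, sub_self]

/-- The restriction of a symplectic form to the restriction of a Lie algebroid. -/
def restrict [FiniteDimensional ℝ E] [T2Space M] [FiniteDimensional ℝ F]
    [ContMDiffVectorBundle ∞ F V 𝓘(ℝ, E)]
    {E' : Type*} [NormedAddCommGroup E'] [NormedSpace ℝ E'] [FiniteDimensional ℝ E']
    {N : Type*} [TopologicalSpace N] [ChartedSpace E' N] [IsManifold 𝓘(ℝ, E') ∞ N] [T2Space N]
    {ι : C^∞⟮𝓘(ℝ, E'), N; 𝓘(ℝ, E), M⟯} {𝒜N : LieAlgebroid E' F (ι *ᵖ V)}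
    (h𝒜N : 𝒜.IsRestriction ι 𝒜N) : SymplecticForm 𝒜N where
  form := pullbackForm ι Ω.form
  contMDiff := contMDiff_pullbackForm Ω.contMDiff
  alternating x a := Ω.alternating (ι x) a
  nondegenerate x a h := Ω.nondegenerate (ι x) a h
  closed := h𝒜N.twoFormDifferential_pullbackForm_eq_zero Ω.contMDiff Ω.form_swap Ω.closed

end SymplecticForm

end RestrictedForm

/-! ### The Poisson structure of a symplectic Lie algebroid -/

section LieDerivative

variable {E : Type*} [NormedAddCommGroup E] [NormedSpace ℝ E]
  {M : Type*} [TopologicalSpace M] [ChartedSpace E M] [IsManifold 𝓘(ℝ, E) ∞ M]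

/-- Smooth differential 1-forms on `M`. -/
abbrev OneForm (E : Type*) [NormedAddCommGroup E] [NormedSpace ℝ E] (M : Type*)
    [TopologicalSpace M] [ChartedSpace E M] [IsManifold 𝓘(ℝ, E) ∞ M] : Type _ :=
  Cₛ^∞⟮𝓘(ℝ, E); E →L[ℝ] ℝ, (fun x : M ↦ TangentSpace 𝓘(ℝ, E) x →L[ℝ] ℝ)⟯

/-- The differential of a smooth function, as a 1-form. -/
def mvfderivForm {f : M → ℝ} (hf : CMDiff ∞ f) : OneForm E M :=
  ⟨fun x ↦ d% f x, fun x ↦ contMDiffAt_mvfderiv (hf x) (by simp)⟩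

theorem mdifferentiableAt_oneForm_apply (β : OneForm E M) {X : ∀ x : M, TangentSpace 𝓘(ℝ, E) x}
    {x : M} (hX : MDiffAt (T% X) x) : MDiffAt (fun y ↦ β y (X y)) x :=
  (mdifferentiableAt_section 𝓘(ℝ, E) (F := ℝ) (E := fun _ : M ↦ ℝ) _).1
    (MDifferentiableAt.clm_bundle_apply (E₂ := fun _ : M ↦ ℝ)
      (β.contMDiff.mdifferentiableAt (by simp)) hX)

variable [FiniteDimensional ℝ E]

theorem tensorialAt_lieDerivOneForm (Y : ∀ x : M, TangentSpace 𝓘(ℝ, E) x) (β : OneForm E M)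
    (x : M) : TensorialAt 𝓘(ℝ, E) E (fun X ↦ lieDerivOneForm Y β X x) x where
  smul {f X} hf hX := by
    have hβ : (fun y ↦ β y ((f • X) y)) = f * fun y ↦ β y (X y) :=
      funext fun y ↦ map_smul (β y) (f y) (X y)
    rw [lieDerivOneForm, hβ, mvfderiv_mul hf (mdifferentiableAt_oneForm_apply β hX),
      mlieBracket_smul_right hf hX]
    simp only [lieDerivOneForm, add_apply, smul_apply, map_add, map_smul, smul_eq_mul]
    ring
  add {X X'} hX hX' := by
    have hβ : (fun y ↦ β y ((X + X') y)) = (fun y ↦ β y (X y)) + fun y ↦ β y (X' y) :=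
      funext fun y ↦ map_add (β y) (X y) (X' y)
    rw [lieDerivOneForm, hβ, mvfderiv_add (mdifferentiableAt_oneForm_apply β hX)
      (mdifferentiableAt_oneForm_apply β hX'), mlieBracket_add_right hX hX']
    simp only [lieDerivOneForm, add_apply, map_add]
    ring

theorem lieDerivOneForm_congr (Y : ∀ x : M, TangentSpace 𝓘(ℝ, E) x) (β : OneForm E M) {x : M}
    {X X' : ∀ x : M, TangentSpace 𝓘(ℝ, E) x} (hX : MDiffAt (T% X) x) (hX' : MDiffAt (T% X') x)
    (h : X x = X' x) : lieDerivOneForm Y β X x = lieDerivOneForm Y β X' x :=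
  haveI : ContMDiffVectorBundle 1 E (TangentSpace 𝓘(ℝ, E) : M → Type _) 𝓘(ℝ, E) :=
    .of_le (m := 1) (n := ∞) (by simp)
  (tensorialAt_lieDerivOneForm Y β x).pointwise hX hX' h

end LieDerivative

section Sharp

variable {E : Type*} [NormedAddCommGroup E] [NormedSpace ℝ E]
  {M : Type*} [TopologicalSpace M] [ChartedSpace E M] [IsManifold 𝓘(ℝ, E) ∞ M]
  {F : Type*} [NormedAddCommGroup F] [NormedSpace ℝ F]
  {V : M → Type*} [TopologicalSpace (TotalSpace F V)]
  [∀ x, AddCommGroup (V x)] [∀ x, Module ℝ (V x)] [∀ x, TopologicalSpace (V x)]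
  [FiberBundle F V] [VectorBundle ℝ F V] {𝒜 : LieAlgebroid E F V} (Ω : SymplecticForm 𝒜)

theorem PoissonStructure.ext {P Q : PoissonStructure E M} (h : ∀ x, P.bivector x = Q.bivector x) :
    P = Q := by
  have hbivector : P.bivector = Q.bivector := funext h
  cases P; cases Q
  congr

namespace SymplecticForm

/-- The symplectic form on a fibre, as a bilinear form. -/
def bilinForm (x : M) : LinearMap.BilinForm ℝ (V x) :=
  LinearMap.mk₂ ℝ (fun a b ↦ Ω.form x a b) (fun a a' b ↦ by simp) (fun r a b ↦ by simp)
    (fun a b b' ↦ by simp) (fun r a b ↦ by simp)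

theorem bilinForm_nondegenerate (x : M) : (Ω.bilinForm x).Nondegenerate :=
  ⟨Ω.nondegenerate x, fun a h ↦ Ω.nondegenerate x a fun b ↦ by
    rw [Ω.form_swap, neg_eq_zero]; exact h b⟩

theorem negPullContraction_apply {lam : ∀ x : M, TangentSpace 𝓘(ℝ, E) x →L[ℝ] V x} {x : M}
    (a : V x) (v : TangentSpace 𝓘(ℝ, E) x) :
    Ω.negPullContraction lam x a v = -Ω.form x a (lam x v) := rfl

end SymplecticForm

variable [FiniteDimensional ℝ E] [FiniteDimensional ℝ F]
  [∀ x, IsTopologicalAddGroup (V x)] [∀ x, ContinuousSMul ℝ (V x)]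

namespace SymplecticForm

/-- The linear map underlying `sharp`. -/
def sharpₗ (x : M) : (TangentSpace 𝓘(ℝ, E) x →L[ℝ] ℝ) →ₗ[ℝ] V x :=
  haveI := VectorBundle.finiteDimensional ℝ F V x
  ((Ω.bilinForm x).toDual (Ω.bilinForm_nondegenerate x)).symm.toLinearMap ∘ₗ
    { toFun α := -(α.toLinearMap ∘ₗ (𝒜.anchor x).toLinearMap)
      map_add' α β := by ext a; simp [add_comm]
      map_smul' r α := by ext a; simp }

/-- The map `♯ : T*M → V` with `ω(♯α, b) = -α(ρ b)`. -/
def sharp (x : M) : (TangentSpace 𝓘(ℝ, E) x →L[ℝ] ℝ) →L[ℝ] V x :=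
  haveI : FiniteDimensional ℝ (TangentSpace 𝓘(ℝ, E) x →L[ℝ] ℝ) :=
    inferInstanceAs (FiniteDimensional ℝ (E →L[ℝ] ℝ))
  LinearMap.toContinuousLinearMap (Ω.sharpₗ x)

theorem form_sharp {x : M} (α : TangentSpace 𝓘(ℝ, E) x →L[ℝ] ℝ) (b : V x) :
    Ω.form x (Ω.sharp x α) b = -α (𝒜.anchor x b) :=
  haveI := VectorBundle.finiteDimensional ℝ F V x
  LinearMap.BilinForm.apply_toDual_symm_apply (B := Ω.bilinForm x)
    (hB := Ω.bilinForm_nondegenerate x) _ b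

theorem sharp_eq_iff {x : M} {α : TangentSpace 𝓘(ℝ, E) x →L[ℝ] ℝ} {a : V x} :
    Ω.sharp x α = a ↔ ∀ b, Ω.form x a b = -α (𝒜.anchor x b) := by
  refine ⟨fun h b ↦ by rw [← h, form_sharp], fun h ↦ Ω.eq_of_form_eq fun b ↦ ?_⟩
  rw [form_sharp, h]

theorem contMDiff_sharp :
    CMDiff ∞ (fun x ↦ TotalSpace.mk' ((E →L[ℝ] ℝ) →L[ℝ] F)
      (E := fun x : M ↦ (TangentSpace 𝓘(ℝ, E) x →L[ℝ] ℝ) →L[ℝ] V x) x (Ω.sharp x)) := by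
  intro x₀
  refine contMDiffAt_hom_of_apply (V := fun x : M ↦ TangentSpace 𝓘(ℝ, E) x →L[ℝ] ℝ) (W := V)
    fun α hα ↦ ?_
  refine contMDiffAt_section_of_injective (W := fun x ↦ V x →L[ℝ] ℝ) (φ := Ω.form)
    (Ω.contMDiff x₀) (fun a a' h ↦ Ω.eq_of_form_eq fun b ↦ congr($h b)) ?_
  refine contMDiffAt_hom_const_of_apply fun s hs ↦ ?_
  simp only [form_sharp]
  exact (contMDiffAt_hom_const_apply contMDiffAt_id hα
    ((𝒜.anchor_contMDiff x₀).clm_bundle_apply hs)).neg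

/-- The map `♯` on sections. -/
def sharpSection : OneForm E M →ₗ[ℝ] Cₛ^∞⟮𝓘(ℝ, E); F, V⟯ where
  toFun α :=
    ⟨fun x ↦ Ω.sharp x (α x), fun x ↦ (Ω.contMDiff_sharp x).clm_bundle_apply (α.contMDiff x)⟩
  map_add' α β := ContMDiffSection.ext fun x ↦ map_add (Ω.sharp x) (α x) (β x)
  map_smul' r α := ContMDiffSection.ext fun x ↦ map_smul (Ω.sharp x) r (α x)

@[simp]
theorem sharpSection_apply (α : OneForm E M) (x : M) :
    Ω.sharpSection α x = Ω.sharp x (α x) := rfl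

/-- The bivector `π(α, β) = ω(♯α, ♯β)`. -/
def bivector (x : M) : (TangentSpace 𝓘(ℝ, E) x →L[ℝ] ℝ) →L[ℝ]
    (TangentSpace 𝓘(ℝ, E) x →L[ℝ] ℝ) →L[ℝ] ℝ :=
  (ContinuousLinearMap.precomp ℝ (Ω.sharp x)).comp ((Ω.form x).comp (Ω.sharp x))

theorem bivector_apply {x : M} (α β : TangentSpace 𝓘(ℝ, E) x →L[ℝ] ℝ) :
    Ω.bivector x α β = Ω.form x (Ω.sharp x α) (Ω.sharp x β) := rfl

theorem bivector_eq_apply_anchor_sharp {x : M} (α β : TangentSpace 𝓘(ℝ, E) x →L[ℝ] ℝ) :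
    Ω.bivector x α β = β (𝒜.anchor x (Ω.sharp x α)) := by
  rw [bivector_apply, form_swap, form_sharp, neg_neg]

/-- The Hamiltonian section of a smooth function. -/
def hamiltonian {f : M → ℝ} (hf : CMDiff ∞ f) : Cₛ^∞⟮𝓘(ℝ, E); F, V⟯ :=
  -Ω.sharpSection (mvfderivForm hf)

theorem hamiltonian_apply {f : M → ℝ} (hf : CMDiff ∞ f) (x : M) :
    Ω.hamiltonian hf x = -Ω.sharp x (d% f x) := rfl

theorem isHamiltonian_hamiltonian {f : M → ℝ} (hf : CMDiff ∞ f) :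
    Ω.IsHamiltonian f (Ω.hamiltonian hf) := by
  intro x b
  rw [hamiltonian_apply, map_neg, neg_apply, form_sharp, neg_neg]

variable {Ω} in
theorem IsHamiltonian.eq_hamiltonian {f : M → ℝ} {s : Cₛ^∞⟮𝓘(ℝ, E); F, V⟯}
    (h : Ω.IsHamiltonian f s) (hf : CMDiff ∞ f) : s = Ω.hamiltonian hf := by
  ext x
  refine Ω.eq_of_form_eq fun b ↦ ?_
  rw [← h, ← Ω.isHamiltonian_hamiltonian hf]

variable {f g h : M → ℝ} (hf : CMDiff ∞ f) (hg : CMDiff ∞ g) (hh : CMDiff ∞ h)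

theorem bivector_mvfderiv (x : M) :
    Ω.bivector x (d% f x) (d% g x) = Ω.form x (Ω.hamiltonian hf x) (Ω.hamiltonian hg x) := by
  simp [bivector_apply, hamiltonian_apply]

include hf in
theorem bivector_mvfderiv_bivector (x : M) :
    Ω.bivector x (d% f x) (d% (fun y ↦ Ω.bivector y (d% g y) (d% h y)) x) =
      -d% (fun y ↦ Ω.form y (Ω.hamiltonian hg y) (Ω.hamiltonian hh y)) x
        (𝒜.anchor x (Ω.hamiltonian hf x)) := by
  rw [bivector_eq_apply_anchor_sharp, hamiltonian_apply, map_neg, map_neg, neg_neg]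
  simp only [Ω.bivector_mvfderiv hg hh]

theorem mvfderiv_mvfderiv_anchor_hamiltonian (x : M) (v : TangentSpace 𝓘(ℝ, E) x) :
    d% (fun y ↦ d% g y (𝒜.anchor y (Ω.hamiltonian hf y))) x v =
      -d% (fun y ↦ Ω.form y (Ω.hamiltonian hf y) (Ω.hamiltonian hg y)) x v := by
  rw [mvfderiv_form_swap Ω.form_swap, neg_apply, neg_neg]
  simp only [Ω.isHamiltonian_hamiltonian hg _ _]

theorem form_bracket_hamiltonian (x : M) :
    Ω.form x (𝒜.bracket (Ω.hamiltonian hf) (Ω.hamiltonian hg) x) (Ω.hamiltonian hh x) =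
      d% (fun y ↦ Ω.form y (Ω.hamiltonian hg y) (Ω.hamiltonian hh y)) x
          (𝒜.anchor x (Ω.hamiltonian hf x)) -
        d% (fun y ↦ Ω.form y (Ω.hamiltonian hf y) (Ω.hamiltonian hh y)) x
          (𝒜.anchor x (Ω.hamiltonian hg x)) := by
  have hanchor (s : Cₛ^∞⟮𝓘(ℝ, E); F, V⟯) : CMDiffAt 2 (T% fun y ↦ 𝒜.anchor y (s y)) x :=
    (𝒜.contMDiff_anchor_apply s x).of_le (by norm_cast)
  rw [form_swap, ← Ω.isHamiltonian_hamiltonian hh, 𝒜.anchor_bracket,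
    mvfderiv_mlieBracket ((hh x).of_le (by norm_cast)) (hanchor _) (hanchor _),
    Ω.mvfderiv_mvfderiv_anchor_hamiltonian hg hh, Ω.mvfderiv_mvfderiv_anchor_hamiltonian hf hh]
  ring

-- The closedness of `ω` on the Hamiltonian sections of `f`, `g`, `h` is the Jacobi identity.
include hf hg hh in
theorem bivector_jacobi (x : M) :
    Ω.bivector x (d% f x) (d% (fun y ↦ Ω.bivector y (d% g y) (d% h y)) x)
      + Ω.bivector x (d% g x) (d% (fun y ↦ Ω.bivector y (d% h y) (d% f y)) x)
      + Ω.bivector x (d% h x) (d% (fun y ↦ Ω.bivector y (d% f y) (d% g y)) x) = 0 := by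
  have hclosed := Ω.closed (Ω.hamiltonian hf) (Ω.hamiltonian hg) (Ω.hamiltonian hh) x
  have hswap {k l : M → ℝ} (hk : CMDiff ∞ k) (hl : CMDiff ∞ l) (v : TangentSpace 𝓘(ℝ, E) x) :
      d% (fun y ↦ Ω.form y (Ω.hamiltonian hk y) (Ω.hamiltonian hl y)) x v =
        -d% (fun y ↦ Ω.form y (Ω.hamiltonian hl y) (Ω.hamiltonian hk y)) x v := by
    rw [mvfderiv_form_swap Ω.form_swap, neg_apply]
  rw [form_bracket_hamiltonian, form_bracket_hamiltonian, form_bracket_hamiltonian,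
    hswap hf hh, hswap hh hg, hswap hg hf] at hclosed
  rw [Ω.bivector_mvfderiv_bivector hf hg hh, Ω.bivector_mvfderiv_bivector hg hh hf,
    Ω.bivector_mvfderiv_bivector hh hf hg]
  linarith

/-- The Poisson structure on the base of a symplectic Lie algebroid. -/
def poisson : PoissonStructure E M where
  bivector := Ω.bivector
  contMDiff α β := contMDiff_form_apply Ω.contMDiff (Ω.sharpSection α) (Ω.sharpSection β)
  alternating x _ := Ω.alternating x _
  jacobi _ _ _ hf hg hh x := Ω.bivector_jacobi hf hg hh x

theorem isInducedBy_poisson : Ω.poisson.IsInducedBy Ω where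
  existsUnique_hamiltonian _ hf :=
    ⟨Ω.hamiltonian hf, Ω.isHamiltonian_hamiltonian hf, fun _ hs ↦ hs.eq_hamiltonian hf⟩
  bracket_eq f g hf hg a b ha hb x := by
    rw [ha.eq_hamiltonian hf, hb.eq_hamiltonian hg]
    exact Ω.bivector_mvfderiv hf hg x

end SymplecticForm

variable {Ω} in
theorem PoissonStructure.IsInducedBy.bivector_eq [T2Space M] {P : PoissonStructure E M}
    (h : P.IsInducedBy Ω) (x : M) : P.bivector x = Ω.bivector x := by
  ext α β
  obtain ⟨f, hf, rfl⟩ := exists_mvfderiv_eq x α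
  obtain ⟨g, hg, rfl⟩ := exists_mvfderiv_eq x β
  rw [h.bracket_eq f g hf hg _ _ (Ω.isHamiltonian_hamiltonian hf) (Ω.isHamiltonian_hamiltonian hg),
    Ω.bivector_mvfderiv hf hg]

theorem SymplecticForm.existsUnique_isInducedBy [T2Space M] :
    ∃! P : PoissonStructure E M, P.IsInducedBy Ω :=
  ⟨Ω.poisson, Ω.isInducedBy_poisson, fun _ hP ↦ PoissonStructure.ext hP.bivector_eq⟩

end Sharp

/-! ### The cotangent Lie algebroid -/

section Cotangent

variable {E : Type*} [NormedAddCommGroup E] [NormedSpace ℝ E] [FiniteDimensional ℝ E]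
  {M : Type*} [TopologicalSpace M] [ChartedSpace E M] [IsManifold 𝓘(ℝ, E) ∞ M]

theorem lieDerivOneForm_eq_zero (Y : ∀ x : M, TangentSpace 𝓘(ℝ, E) x) (β : OneForm E M) {x : M}
    {X : ∀ x : M, TangentSpace 𝓘(ℝ, E) x} (hX : MDiffAt (T% X) x) (h : X x = 0) :
    lieDerivOneForm Y β X x = 0 := by
  have hzero : lieDerivOneForm Y β (fun _ ↦ 0) x = 0 :=
    (tensorialAt_lieDerivOneForm Y β x).zero
  rw [← hzero]
  exact lieDerivOneForm_congr Y β hX (mdifferentiable_zeroSection ..) h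

theorem LieAlgebroid.IsCotangent.eq [T2Space M]
    {𝒞 𝒞' : LieAlgebroid E (E →L[ℝ] ℝ) (fun x : M ↦ TangentSpace 𝓘(ℝ, E) x →L[ℝ] ℝ)}
    {P : PoissonStructure E M} (h : 𝒞.IsCotangent P) (h' : 𝒞'.IsCotangent P) : 𝒞 = 𝒞' := by
  have hanchor (x : M) (α) : 𝒞.anchor x α = 𝒞'.anchor x α :=
    (SeparatingDual.eq_iff_forall_dual_eq (R := ℝ) (V := E)).2 fun β ↦
      (h.anchor_eq x α β).trans (h'.anchor_eq x α β).symm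
  refine LieAlgebroid.ext hanchor fun α β x ↦ ?_
  ext v
  obtain ⟨X, rfl⟩ := exists_section_eq 𝓘(ℝ, E) E (V := (TangentSpace 𝓘(ℝ, E) : M → Type _)) x v
  rw [h.bracket_eq, h'.bracket_eq]
  simp only [hanchor]

variable {F : Type*} [NormedAddCommGroup F] [NormedSpace ℝ F] [FiniteDimensional ℝ F]
  {V : M → Type*} [TopologicalSpace (TotalSpace F V)]
  [∀ x, AddCommGroup (V x)] [∀ x, Module ℝ (V x)] [∀ x, TopologicalSpace (V x)]
  [FiberBundle F V] [VectorBundle ℝ F V]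
  [∀ x, IsTopologicalAddGroup (V x)] [∀ x, ContinuousSMul ℝ (V x)]
  {𝒜 : LieAlgebroid E F V} (Ω : SymplecticForm 𝒜)

namespace SymplecticForm

theorem sharp_mem_compl_isotropy {x : M} (α : TangentSpace 𝓘(ℝ, E) x →L[ℝ] ℝ) :
    Ω.sharp x α ∈ Ω.compl (𝒜.isotropy x) := by
  intro b (hb : 𝒜.anchor x b = 0)
  rw [form_sharp, hb, map_zero, neg_zero]

/- This is `dω(♯α, ♯β, c) = 0` solved for `ω([♯α, ♯β], c)`: it says that the transported bracket
`[♯α, ♯β]` is `♯[α, β]_π`. -/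
theorem neg_form_bracket_sharpSection (α β : OneForm E M) (c : Cₛ^∞⟮𝓘(ℝ, E); F, V⟯) (x : M) :
    -Ω.form x (𝒜.bracket (Ω.sharpSection α) (Ω.sharpSection β) x) (c x) =
      lieDerivOneForm (fun y ↦ 𝒜.anchor y (Ω.sharp y (α y))) β (fun y ↦ 𝒜.anchor y (c y)) x
        - lieDerivOneForm (fun y ↦ 𝒜.anchor y (Ω.sharp y (β y))) α (fun y ↦ 𝒜.anchor y (c y)) x
        - d% (fun y ↦ Ω.bivector y (α y) (β y)) x (𝒜.anchor x (c x)) := by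
  have hd (α : OneForm E M) (v : TangentSpace 𝓘(ℝ, E) x) :
      d% (fun y ↦ Ω.form y (Ω.sharpSection α y) (c y)) x v =
        -d% (fun y ↦ α y (𝒜.anchor y (c y))) x v := by
    rw [← neg_apply, ← mvfderiv_neg]
    exact congr(d% $(funext fun y ↦ Ω.form_sharp (α y) (c y)) x v)
  have hclosed := Ω.closed (Ω.sharpSection α) (Ω.sharpSection β) c x
  rw [hd α, hd β, Ω.form_swap x (𝒜.bracket (Ω.sharpSection α) c x),
    Ω.form_swap x (𝒜.bracket (Ω.sharpSection β) c x)] at hclosed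
  simp only [sharpSection_apply, form_sharp, 𝒜.anchor_bracket] at hclosed
  simp only [lieDerivOneForm, bivector_apply, form_sharp]
  linarith

section Splitting

variable {lam : ∀ x : M, TangentSpace 𝓘(ℝ, E) x →L[ℝ] V x}
  (hlam : ∀ x v, 𝒜.anchor x (lam x v) = v)
include hlam

theorem negPullContraction_sharp {x : M} (α : TangentSpace 𝓘(ℝ, E) x →L[ℝ] ℝ) :
    Ω.negPullContraction lam x (Ω.sharp x α) = α := by
  ext v
  rw [negPullContraction_apply, form_sharp, neg_neg, hlam]

theorem sharp_negPullContraction {x : M} {a : V x} (ha : a ∈ Ω.compl (𝒜.isotropy x)) :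
    Ω.sharp x (Ω.negPullContraction lam x a) = a := by
  rw [sharp_eq_iff]
  intro b
  have hmem : b - lam x (𝒜.anchor x b) ∈ 𝒜.isotropy x := by
    change 𝒜.anchor x (b - lam x (𝒜.anchor x b)) = 0
    rw [map_sub, hlam, sub_self]
  have h := ha _ hmem
  rwa [map_sub, sub_eq_zero, ← neg_neg (Ω.form x a (lam x _))] at h

theorem sharp_injective (x : M) : Function.Injective (Ω.sharp x) :=
  Function.LeftInverse.injective (Ω.negPullContraction_sharp hlam)

theorem range_sharp (x : M) :
    LinearMap.range (Ω.sharp x).toLinearMap = Ω.compl (𝒜.isotropy x) := by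
  refine le_antisymm ?_ fun a ha ↦ ⟨_, Ω.sharp_negPullContraction hlam ha⟩
  rintro _ ⟨α, rfl⟩
  exact Ω.sharp_mem_compl_isotropy α

theorem bijective_negPullContraction (x : M) :
    Function.Bijective ((Ω.negPullContraction lam x).domRestrict (Ω.compl (𝒜.isotropy x))) :=
  Function.bijective_iff_has_inverse.2
    ⟨fun α ↦ ⟨Ω.sharp x α, Ω.sharp_mem_compl_isotropy α⟩,
      fun a ↦ Subtype.ext (Ω.sharp_negPullContraction hlam a.2), Ω.negPullContraction_sharp hlam⟩

theorem contMDiffAt_negPullContraction_iff {s : ∀ x, V x} {x₀ : M}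
    (h : ∀ᶠ x in 𝓝 x₀, s x ∈ Ω.compl (𝒜.isotropy x)) :
    CMDiffAt ∞ (fun x ↦ TotalSpace.mk' (E →L[ℝ] ℝ)
        (E := fun x : M ↦ TangentSpace 𝓘(ℝ, E) x →L[ℝ] ℝ) x (Ω.negPullContraction lam x (s x))) x₀ ↔
      CMDiffAt ∞ (T% s) x₀ := by
  have hsharp : (T% s) =ᶠ[𝓝 x₀]
      T% fun x ↦ Ω.sharp x (Ω.negPullContraction lam x (s x)) := by
    filter_upwards [h] with x hx
    rw [Ω.sharp_negPullContraction hlam hx]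
  rw [hsharp.contMDiffAt_iff]
  exact ⟨(Ω.contMDiff_sharp x₀).clm_bundle_apply,
    contMDiffAt_section_of_injective (V := fun x : M ↦ TangentSpace 𝓘(ℝ, E) x →L[ℝ] ℝ)
      (W := V) (Ω.contMDiff_sharp x₀) (Ω.sharp_injective hlam x₀)⟩

theorem exists_sharpSection_eq {s : Cₛ^∞⟮𝓘(ℝ, E); F, V⟯}
    (hs : ∀ x, s x ∈ Ω.compl (𝒜.isotropy x)) : ∃ α, Ω.sharpSection α = s :=
  ⟨⟨fun x ↦ Ω.negPullContraction lam x (s x), fun x ↦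
    (Ω.contMDiffAt_negPullContraction_iff hlam (.of_forall hs)).2 (s.contMDiff x)⟩,
    ContMDiffSection.ext fun x ↦ Ω.sharp_negPullContraction hlam (hs x)⟩

theorem sharpSection_injective : Function.Injective Ω.sharpSection := fun _ _ h ↦
  ContMDiffSection.ext fun x ↦ Ω.sharp_injective hlam x congr($h x)

variable [T2Space M]

theorem isSmoothSubbundle_compl_isotropy :
    IsSmoothSubbundle E F fun x ↦ Ω.compl (𝒜.isotropy x) := by
  intro x₀
  obtain ⟨B⟩ := nonempty_localDualFrame (I := 𝓘(ℝ, E)) (F := E →L[ℝ] ℝ)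
    (V := fun x : M ↦ TangentSpace 𝓘(ℝ, E) x →L[ℝ] ℝ) x₀
  refine ⟨_, fun i ↦ Ω.sharpSection (B.e i), ?_⟩
  filter_upwards [B.sum_c, B.linearIndependent] with x hsum hli
  have hspan : Submodule.span ℝ (range fun i ↦ B.e i x) = ⊤ :=
    Submodule.eq_top_iff'.2 fun α ↦ hsum α ▸ Submodule.sum_mem _ fun i _ ↦
      Submodule.smul_mem _ _ (Submodule.subset_span ⟨i, rfl⟩)
  refine ⟨hli.map' (Ω.sharp x).toLinearMap (LinearMap.ker_eq_bot.2 (Ω.sharp_injective hlam x)), ?_⟩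
  rw [← Ω.range_sharp hlam, LinearMap.range_eq_map, ← hspan, Submodule.map_span, ← range_comp]
  rfl

end Splitting

variable [T2Space M] [ContMDiffVectorBundle ∞ F V 𝓘(ℝ, E)]

theorem bracket_sharpSection_mem_compl_isotropy (α β : OneForm E M) (x : M) :
    𝒜.bracket (Ω.sharpSection α) (Ω.sharpSection β) x ∈ Ω.compl (𝒜.isotropy x) := by
  intro b (hb : 𝒜.anchor x b = 0)
  obtain ⟨c, rfl⟩ := exists_section_eq 𝓘(ℝ, E) F x b
  have hc : MDiffAt (T% fun y ↦ 𝒜.anchor y (c y)) x :=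
    (𝒜.contMDiff_anchor_apply c).mdifferentiableAt (by simp)
  rw [← neg_eq_zero, neg_form_bracket_sharpSection, lieDerivOneForm_eq_zero _ β hc hb,
    lieDerivOneForm_eq_zero _ α hc hb, hb, map_zero, sub_zero, sub_zero]

variable {lam : ∀ x : M, TangentSpace 𝓘(ℝ, E) x →L[ℝ] V x}
  (hlam : ∀ x v, 𝒜.anchor x (lam x v) = v)
include hlam

theorem isSubalgebroid_compl_isotropy :
    𝒜.IsSubalgebroid fun x ↦ Ω.compl (𝒜.isotropy x) where
  isSmoothSubbundle := Ω.isSmoothSubbundle_compl_isotropy hlam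
  bracket_mem s t hs ht x := by
    obtain ⟨α, rfl⟩ := Ω.exists_sharpSection_eq hlam hs
    obtain ⟨β, rfl⟩ := Ω.exists_sharpSection_eq hlam ht
    exact Ω.bracket_sharpSection_mem_compl_isotropy α β x

/-- The bracket of 1-forms obtained by transport along `♯`, whose values do not depend on the
splitting `lam` of the anchor. -/
def transportedBracket (α β : OneForm E M) : OneForm E M where
  toFun x := Ω.negPullContraction lam x (𝒜.bracket (Ω.sharpSection α) (Ω.sharpSection β) x)
  contMDiff_toFun x := (Ω.contMDiffAt_negPullContraction_iff hlam
    (.of_forall (Ω.bracket_sharpSection_mem_compl_isotropy α β))).2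
      ((𝒜.bracket (Ω.sharpSection α) (Ω.sharpSection β)).contMDiff x)

theorem sharpSection_transportedBracket (α β : OneForm E M) :
    Ω.sharpSection (Ω.transportedBracket hlam α β) =
      𝒜.bracket (Ω.sharpSection α) (Ω.sharpSection β) :=
  ContMDiffSection.ext fun x ↦
    Ω.sharp_negPullContraction hlam (Ω.bracket_sharpSection_mem_compl_isotropy α β x)

/-- The cotangent Lie algebroid of the Poisson structure of a symplectic Lie algebroid with
surjective anchor: `♯` embeds it into the given one. -/
def cotangent : LieAlgebroid E (E →L[ℝ] ℝ) (fun x : M ↦ TangentSpace 𝓘(ℝ, E) x →L[ℝ] ℝ) where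
  anchor x := (𝒜.anchor x).comp (Ω.sharp x)
  anchor_contMDiff x₀ :=
    contMDiffAt_hom_of_apply (V := fun x : M ↦ TangentSpace 𝓘(ℝ, E) x →L[ℝ] ℝ)
      (W := (TangentSpace 𝓘(ℝ, E) : M → Type _)) fun _ hα ↦
      (𝒜.anchor_contMDiff x₀).clm_bundle_apply ((Ω.contMDiff_sharp x₀).clm_bundle_apply hα)
  bracket := LinearMap.mk₂ ℝ (Ω.transportedBracket hlam)
    (fun α α' β ↦ Ω.sharpSection_injective hlam (by
      simp only [map_add, sharpSection_transportedBracket, LinearMap.add_apply]))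
    (fun r α β ↦ Ω.sharpSection_injective hlam (by
      simp only [map_smul, sharpSection_transportedBracket, LinearMap.smul_apply]))
    (fun α β β' ↦ Ω.sharpSection_injective hlam (by
      simp only [map_add, sharpSection_transportedBracket]))
    (fun r α β ↦ Ω.sharpSection_injective hlam (by
      simp only [map_smul, sharpSection_transportedBracket]))
  bracket_self α := Ω.sharpSection_injective hlam (by
    rw [LinearMap.mk₂_apply, sharpSection_transportedBracket, 𝒜.bracket_self, map_zero])
  jacobi α β γ := Ω.sharpSection_injective hlam (by
    simp only [LinearMap.mk₂_apply, map_add, sharpSection_transportedBracket]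
    exact 𝒜.jacobi _ _ _)
  anchor_bracket α β x := by
    have h := 𝒜.anchor_bracket (Ω.sharpSection α) (Ω.sharpSection β) x
    rwa [← Ω.sharpSection_transportedBracket hlam] at h
  leibniz α β fβ f hf hfβ x := by
    have h := 𝒜.leibniz (Ω.sharpSection α) (Ω.sharpSection β) (Ω.sharpSection fβ) f hf
      (fun y ↦ by rw [sharpSection_apply, hfβ, map_smul, sharpSection_apply]) x
    rw [← Ω.sharpSection_transportedBracket hlam, ← Ω.sharpSection_transportedBracket hlam] at h
    apply Ω.sharp_injective hlam x
    rw [map_add, map_smul, map_smul]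
    exact h

theorem sharpSection_cotangent_bracket (α β : OneForm E M) :
    Ω.sharpSection ((Ω.cotangent hlam).bracket α β) =
      𝒜.bracket (Ω.sharpSection α) (Ω.sharpSection β) :=
  Ω.sharpSection_transportedBracket hlam α β

variable {P : PoissonStructure E M} (hP : P.IsInducedBy Ω)
include hP

theorem isCotangent_cotangent : (Ω.cotangent hlam).IsCotangent P where
  anchor_eq x α β := by
    rw [hP.bivector_eq, bivector_eq_apply_anchor_sharp]
    rfl
  bracket_eq α β X x := by
    obtain ⟨c, hc⟩ := exists_section_eq 𝓘(ℝ, E) F x (lam x (X x))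
    have hcX : 𝒜.anchor x (c x) = X x := by rw [hc, hlam]
    have hc' : MDiffAt (T% fun y ↦ 𝒜.anchor y (c y)) x :=
      (𝒜.contMDiff_anchor_apply c).mdifferentiableAt (by simp)
    have hX : MDiffAt (T% fun y ↦ X y) x := X.contMDiff.mdifferentiableAt (by simp)
    have h := Ω.neg_form_bracket_sharpSection α β c x
    rw [lieDerivOneForm_congr _ β hc' hX hcX, lieDerivOneForm_congr _ α hc' hX hcX, hcX, hc] at h
    simp only [hP.bivector_eq]
    exact h

theorem existsUnique_isCotangent :
    ∃! 𝒞 : LieAlgebroid E (E →L[ℝ] ℝ) (fun x : M ↦ TangentSpace 𝓘(ℝ, E) x →L[ℝ] ℝ),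
      𝒞.IsCotangent P :=
  ⟨Ω.cotangent hlam, Ω.isCotangent_cotangent hlam hP,
    fun _ h ↦ h.eq (Ω.isCotangent_cotangent hlam hP)⟩

theorem isIsoOnSubalgebroid_negPullContraction
    {𝒞 : LieAlgebroid E (E →L[ℝ] ℝ) (fun x : M ↦ TangentSpace 𝓘(ℝ, E) x →L[ℝ] ℝ)}
    (h𝒞 : 𝒞.IsCotangent P) :
    𝒜.IsIsoOnSubalgebroid (fun x ↦ Ω.compl (𝒜.isotropy x)) 𝒞 (Ω.negPullContraction lam) where
  isSubalgebroid := Ω.isSubalgebroid_compl_isotropy hlam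
  bijective := Ω.bijective_negPullContraction hlam
  contMDiffOn_iff U hU s hs := by
    have hiff (x) (hx : x ∈ U) := Ω.contMDiffAt_negPullContraction_iff hlam
      (eventually_of_mem (hU.mem_nhds hx) hs)
    exact ⟨fun h x hx ↦ ((hiff x hx).2 (h.contMDiffAt (hU.mem_nhds hx))).contMDiffWithinAt,
      fun h x hx ↦ ((hiff x hx).1 (h.contMDiffAt (hU.mem_nhds hx))).contMDiffWithinAt⟩
  anchor_eq x a ha := by
    obtain rfl := h𝒞.eq (Ω.isCotangent_cotangent hlam hP)
    exact congrArg (𝒜.anchor x) (Ω.sharp_negPullContraction hlam ha)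
  bracket_eq s t hs ht α β hα hβ x := by
    obtain rfl := h𝒞.eq (Ω.isCotangent_cotangent hlam hP)
    have hαs : Ω.sharpSection α = s := ContMDiffSection.ext fun y ↦ by
      rw [sharpSection_apply, hα, Ω.sharp_negPullContraction hlam (hs y)]
    have hβt : Ω.sharpSection β = t := ContMDiffSection.ext fun y ↦ by
      rw [sharpSection_apply, hβ, Ω.sharp_negPullContraction hlam (ht y)]
    rw [← hαs, ← hβt, ← Ω.sharpSection_cotangent_bracket hlam, sharpSection_apply,
      Ω.negPullContraction_sharp hlam]

end SymplecticForm

end Cotangent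

/-! ### The decomposition of the fibres -/

theorem existsUnique_rightInverse_of_isCompl_ker {V W : Type*}
    [AddCommGroup V] [Module ℝ V] [TopologicalSpace V] [IsTopologicalAddGroup V]
    [ContinuousSMul ℝ V] [AddCommGroup W] [Module ℝ W] [TopologicalSpace W]
    [IsTopologicalAddGroup W] [ContinuousSMul ℝ W] [T2Space W] [FiniteDimensional ℝ W]
    {f : V →L[ℝ] W} (hf : Function.Surjective f) {S : Submodule ℝ V}
    (hS : IsCompl S (LinearMap.ker (f : V →ₗ[ℝ] W))) :
    ∃! g : W →L[ℝ] V, ∀ w, g w ∈ S ∧ f (g w) = w := by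
  let e : S ≃ₗ[ℝ] W := ((f : V →ₗ[ℝ] W).kerComplementEquivRange hS).trans
    (LinearEquiv.ofTop _ (LinearMap.range_eq_top.2 hf))
  have hfe (a : S) : f a = e a := rfl
  refine ⟨LinearMap.toContinuousLinearMap (S.subtype ∘ₗ e.symm.toLinearMap),
    fun w ↦ ⟨(e.symm w).2, (hfe _).trans (e.apply_symm_apply w)⟩, fun g hg ↦ ?_⟩
  ext w
  have h : e ⟨g w, (hg w).1⟩ = w := (hg w).2
  exact congrArg Subtype.val ((e.eq_symm_apply).2 h)

theorem finrank_sup_of_disjoint {K V : Type*} [DivisionRing K] [AddCommGroup V] [Module K V]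
    {S T : Submodule K V} [FiniteDimensional K S] [FiniteDimensional K T] (h : Disjoint S T) :
    Module.finrank K ↥(S ⊔ T) = Module.finrank K S + Module.finrank K T := by
  rw [← Submodule.finrank_sup_add_finrank_inf_eq, h.eq_bot, finrank_bot, add_zero]

section Decomposition

variable {E : Type*} [NormedAddCommGroup E] [NormedSpace ℝ E]
  {M : Type*} [TopologicalSpace M] [ChartedSpace E M] [IsManifold 𝓘(ℝ, E) ∞ M]
  {F : Type*} [NormedAddCommGroup F] [NormedSpace ℝ F]
  {V : M → Type*} [TopologicalSpace (TotalSpace F V)]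
  [∀ x, AddCommGroup (V x)] [∀ x, Module ℝ (V x)] [∀ x, TopologicalSpace (V x)]
  [FiberBundle F V] [VectorBundle ℝ F V]
  {𝒜 : LieAlgebroid E F V}

theorem SymplecticForm.finrank_compl [FiniteDimensional ℝ F] (Ω : SymplecticForm 𝒜) {x : M}
    (S : Submodule ℝ (V x)) :
    Module.finrank ℝ (Ω.compl S) + Module.finrank ℝ S = Module.finrank ℝ (V x) := by
  have := VectorBundle.finiteDimensional ℝ F V x
  have hcompl : Ω.compl S = (Ω.bilinForm x).orthogonal S := by
    ext a
    exact forall₂_congr fun b _ ↦ by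
      rw [Ω.form_swap, neg_eq_zero]
      rfl
  rw [hcompl, LinearMap.BilinForm.finrank_orthogonal (Ω.bilinForm_nondegenerate x),
    Nat.sub_add_cancel S.finrank_le]

variable [∀ x, IsTopologicalAddGroup (V x)] [∀ x, ContinuousSMul ℝ (V x)]

namespace CompatibleTriple

variable (T : CompatibleTriple 𝒜) {x : M}

theorem eq_zero_of_inner_self {a : V x} (h : T.g.inner x a a = 0) : a = 0 := by
  by_contra ha
  exact (T.g.pos x a ha).ne' h

theorem eq_zero_of_form_J {a : V x} (h : T.Ω.form x (T.J x a) a = 0) : a = 0 := by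
  rw [T.Ω.form_swap, T.form_eq, T.J_J, map_neg, neg_neg] at h
  exact T.eq_zero_of_inner_self h

theorem J_mem_E1 {a : V x} (ha : a ∈ T.L1 x) : T.J x a ∈ T.E1 x := Submodule.mem_map_of_mem ha

theorem disjoint_isotropy_E1 : Disjoint (𝒜.isotropy x) (T.E1 x) := by
  rw [Submodule.disjoint_def]
  rintro _ hL ⟨l, hl, rfl⟩
  have h : T.Ω.form x (T.J x l) l = 0 := by
    rw [T.Ω.form_swap]
    exact neg_eq_zero.2 (hl.2 _ hL)
  rw [T.eq_zero_of_form_J h]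
  exact map_zero _

theorem disjoint_E1_E2 : Disjoint (T.E1 x) (T.E2 x) := by
  rw [Submodule.disjoint_def]
  rintro _ ⟨l, hl, rfl⟩ hE2
  have h : T.Ω.form x (T.J x l) l = 0 := hE2 l (Submodule.mem_sup_left hl.1)
  rw [T.eq_zero_of_form_J h]
  exact map_zero _

theorem disjoint_E2_L1 : Disjoint (T.E2 x) (T.L1 x) := by
  rw [Submodule.disjoint_def]
  intro f hE2 hL1
  refine T.eq_zero_of_form_J ?_
  rw [T.Ω.form_swap, hE2 _ (Submodule.mem_sup_right (T.J_mem_E1 hL1)), neg_zero]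

theorem disjoint_E_isotropy : Disjoint (T.E1 x ⊔ T.E2 x) (𝒜.isotropy x) := by
  rw [Submodule.disjoint_def]
  intro a ha hL
  obtain ⟨_, ⟨l, hl, rfl⟩, f, hf, rfl⟩ := Submodule.mem_sup.1 ha
  have hform : T.Ω.form x (T.J x l + f) l = 0 := by
    rw [T.Ω.form_swap]
    exact neg_eq_zero.2 (hl.2 _ hL)
  rw [map_add, add_apply, hf l (Submodule.mem_sup_left hl.1), add_zero] at hform
  obtain rfl := T.eq_zero_of_form_J hform
  have hf0 : (T.J x : V x →ₗ[ℝ] V x) 0 + f = f := by rw [map_zero, zero_add]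
  rw [hf0] at hL ⊢
  exact Submodule.disjoint_def.1 T.disjoint_E2_L1 f hf
    ⟨hL, fun b hb ↦ hf b (Submodule.mem_sup_left hb)⟩

theorem J_injective : Function.Injective (T.J x : V x →ₗ[ℝ] V x) := fun a b h ↦ by
  have hJJ : T.J x (T.J x a) = T.J x (T.J x b) := congrArg (T.J x) h
  rwa [T.J_J, T.J_J, neg_inj] at hJJ

theorem finrank_E1 : Module.finrank ℝ (T.E1 x) = Module.finrank ℝ (T.L1 x) :=
  (Submodule.equivMapOfInjective _ T.J_injective _).finrank_eq.symm

theorem disjoint_L1_L2 : Disjoint (T.L1 x) (T.L2 x) :=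
  Submodule.disjoint_def.2 fun a hL1 hL2 ↦ T.eq_zero_of_inner_self (hL2.2 a hL1)

/-- The metric on a fibre, as a bilinear form. -/
def metricForm (x : M) : LinearMap.BilinForm ℝ (V x) :=
  LinearMap.mk₂ ℝ (fun a b ↦ T.g.inner x a b) (fun a a' b ↦ by simp) (fun r a b ↦ by simp)
    (fun a b b' ↦ by simp) (fun r a b ↦ by simp)

theorem L2_eq : T.L2 x = (T.metricForm x).orthogonal (T.L1 x) ⊓ 𝒜.isotropy x := by
  ext a
  rw [inf_comm]
  exact and_congr_right fun _ ↦ forall₂_congr fun b _ ↦ by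
    rw [T.g.symm]
    rfl

variable [FiniteDimensional ℝ F]

theorem isCompl_orthogonal_metricForm (S : Submodule ℝ (V x)) :
    IsCompl S ((T.metricForm x).orthogonal S) := by
  have := VectorBundle.finiteDimensional ℝ F V x
  have hrefl : (T.metricForm x).IsRefl := fun a b h ↦ (T.g.symm x b a).trans h
  rw [LinearMap.BilinForm.isCompl_orthogonal_iff_disjoint hrefl, Submodule.disjoint_def]
  exact fun a ha ha' ↦ T.eq_zero_of_inner_self (ha' a ha)

theorem L1_sup_L2 : T.L1 x ⊔ T.L2 x = 𝒜.isotropy x := by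
  have hle : T.L1 x ≤ 𝒜.isotropy x := inf_le_left
  rw [L2_eq, ← sup_inf_assoc_of_le _ hle, (T.isCompl_orthogonal_metricForm _).sup_eq_top,
    top_inf_eq]

theorem finrank_E2 : Module.finrank ℝ (T.E2 x) +
    (Module.finrank ℝ (𝒜.isotropy x) + Module.finrank ℝ (T.L1 x)) = Module.finrank ℝ (V x) := by
  have := VectorBundle.finiteDimensional ℝ F V x
  rw [← finrank_E1, ← finrank_sup_of_disjoint T.disjoint_isotropy_E1]
  exact T.Ω.finrank_compl _

theorem isCompl_E_isotropy : IsCompl (T.E1 x ⊔ T.E2 x) (𝒜.isotropy x) := by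
  have := VectorBundle.finiteDimensional ℝ F V x
  refine (Submodule.isCompl_iff_disjoint _ _ ?_).2 T.disjoint_E_isotropy
  rw [finrank_sup_of_disjoint T.disjoint_E1_E2, finrank_E1, ← T.finrank_E2]
  lia

theorem E2_sup_L1 : T.E2 x ⊔ T.L1 x = T.Ω.compl (𝒜.isotropy x) := by
  have := VectorBundle.finiteDimensional ℝ F V x
  refine Submodule.eq_of_le_of_finrank_eq (sup_le
    (fun a ha b hb ↦ ha b (Submodule.mem_sup_left hb)) inf_le_right) ?_
  have hcompl := T.Ω.finrank_compl (𝒜.isotropy x)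
  rw [finrank_sup_of_disjoint T.disjoint_E2_L1]
  have hE2 := T.finrank_E2 (x := x)
  lia

theorem hasDecomposition (x : M) : T.HasDecomposition x where
  disjoint_E := T.disjoint_E1_E2
  disjoint_L := T.disjoint_L1_L2
  sup_L := T.L1_sup_L2
  isCompl := T.isCompl_E_isotropy

end CompatibleTriple

end Decomposition

section Splitting

variable {E : Type*} [NormedAddCommGroup E] [NormedSpace ℝ E]
  {M : Type*} [TopologicalSpace M] [ChartedSpace E M] [IsManifold 𝓘(ℝ, E) ∞ M]
  {F : Type*} [NormedAddCommGroup F] [NormedSpace ℝ F]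
  {V : M → Type*} [TopologicalSpace (TotalSpace F V)]
  [∀ x, AddCommGroup (V x)] [∀ x, Module ℝ (V x)] [∀ x, TopologicalSpace (V x)]
  [FiberBundle F V] [VectorBundle ℝ F V]
  {E' : Type*} [NormedAddCommGroup E'] [NormedSpace ℝ E']
  {N : Type*} [TopologicalSpace N] [ChartedSpace E' N] [IsManifold 𝓘(ℝ, E') ∞ N]
  {ι : C^∞⟮𝓘(ℝ, E'), N; 𝓘(ℝ, E), M⟯} {𝒜 : LieAlgebroid E F V}
  {𝒜N : LieAlgebroid E' F (ι *ᵖ V)} (h𝒜N : 𝒜.IsRestriction ι 𝒜N)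
include h𝒜N

namespace LieAlgebroid.IsRestriction

theorem anchor_surjective {x : N} (himm : Function.Injective (mfderiv% ι x))
    (htan : range (mfderiv% ι x) = range (𝒜.anchor (ι x))) :
    Function.Surjective (𝒜N.anchor x) := by
  intro v
  obtain ⟨a, ha⟩ : mfderiv% ι x v ∈ range (𝒜.anchor (ι x)) := htan ▸ mem_range_self v
  exact ⟨a, himm ((h𝒜N.anchor_eq x a).trans ha)⟩

theorem isotropy_eq {x : N} (himm : Function.Injective (mfderiv% ι x)) :
    𝒜N.isotropy x = 𝒜.isotropy (ι x) := by
  ext a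
  change 𝒜N.anchor x a = 0 ↔ 𝒜.anchor (ι x) a = 0
  rw [← h𝒜N.anchor_eq, map_eq_zero_iff _ himm]

end LieAlgebroid.IsRestriction

namespace CompatibleTriple

variable [∀ x, IsTopologicalAddGroup (V x)] [∀ x, ContinuousSMul ℝ (V x)]
  [FiniteDimensional ℝ F] (T : CompatibleTriple 𝒜)
  (himm : ∀ x, Function.Injective (mfderiv% ι x))
include himm

theorem existsUnique_isSplitting [FiniteDimensional ℝ E']
    (htan : ∀ x, range (mfderiv% ι x) = range (𝒜.anchor (ι x))) :
    ∃! lam : ∀ x : N, TangentSpace 𝓘(ℝ, E') x →L[ℝ] (ι *ᵖ V) x, T.IsSplitting ι 𝒜N lam := by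
  have hfibre (x : N) : ∃! l : TangentSpace 𝓘(ℝ, E') x →L[ℝ] (ι *ᵖ V) x,
      ∀ v, l v ∈ T.E1 (ι x) ⊔ T.E2 (ι x) ∧ 𝒜N.anchor x (l v) = v := by
    have : T2Space (TangentSpace 𝓘(ℝ, E') x) := inferInstanceAs (T2Space E')
    have : FiniteDimensional ℝ (TangentSpace 𝓘(ℝ, E') x) :=
      inferInstanceAs (FiniteDimensional ℝ E')
    have hcompl : IsCompl (T.E1 (ι x) ⊔ T.E2 (ι x) : Submodule ℝ ((ι *ᵖ V) x))
        (𝒜N.isotropy x) := by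
      rw [h𝒜N.isotropy_eq (himm x)]
      exact T.isCompl_E_isotropy
    exact existsUnique_rightInverse_of_isCompl_ker
      (h𝒜N.anchor_surjective (himm x) (htan x)) hcompl
  choose lam hlam using fun x ↦ (hfibre x).exists
  exact ⟨lam, hlam, fun lam' hlam' ↦ funext fun x ↦ (hfibre x).unique (hlam' x) (hlam x)⟩

theorem restrictedE2L1_eq {ωN : SymplecticForm 𝒜N} (hωN : ∀ x, ωN.form x = T.Ω.form (ι x)) :
    T.restrictedE2L1 ι = fun x ↦ ωN.compl (𝒜N.isotropy x) := by
  funext x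
  refine T.E2_sup_L1.trans ?_
  rw [h𝒜N.isotropy_eq (himm x)]
  ext a
  change _ ↔ ∀ b ∈ 𝒜.isotropy (ι x), ωN.form x a b = 0
  rw [hωN]
  rfl

end CompatibleTriple

end Splitting

end

theorem mainTheorem3_general
    {E : Type*} [NormedAddCommGroup E] [NormedSpace ℝ E] [FiniteDimensional ℝ E]
    {M : Type*} [TopologicalSpace M] [ChartedSpace E M] [IsManifold 𝓘(ℝ, E) ∞ M]
    [T2Space M]
    {F : Type*} [NormedAddCommGroup F] [NormedSpace ℝ F] [FiniteDimensional ℝ F]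
    {V : M → Type*} [TopologicalSpace (TotalSpace F V)]
    [∀ x, AddCommGroup (V x)] [∀ x, Module ℝ (V x)] [∀ x, TopologicalSpace (V x)]
    [∀ x, IsTopologicalAddGroup (V x)] [∀ x, ContinuousSMul ℝ (V x)]
    [FiberBundle F V] [VectorBundle ℝ F V] [ContMDiffVectorBundle ∞ F V 𝓘(ℝ, E)]
    {E' : Type*} [NormedAddCommGroup E'] [NormedSpace ℝ E'] [FiniteDimensional ℝ E']
    {N : Type*} [TopologicalSpace N] [ChartedSpace E' N] [IsManifold 𝓘(ℝ, E') ∞ N]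
    [T2Space N]
    (𝒜 : LieAlgebroid E F V) (T : CompatibleTriple 𝒜)
    (ι : C^∞⟮𝓘(ℝ, E'), N; 𝓘(ℝ, E), M⟯)
    (himm : ∀ x, Function.Injective (mfderiv% ι x))
    (htan : ∀ x, range (mfderiv% ι x) = range (𝒜.anchor (ι x))) :
    (∀ p : M, T.HasDecomposition p) ∧
    (∃! 𝒜N : LieAlgebroid E' F (ι *ᵖ V), 𝒜.IsRestriction ι 𝒜N) ∧
    ∀ 𝒜N : LieAlgebroid E' F (ι *ᵖ V), 𝒜.IsRestriction ι 𝒜N →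
      (∃! ωN : SymplecticForm 𝒜N, ∀ x, ωN.form x = T.Ω.form (ι x)) ∧
      ∀ ωN : SymplecticForm 𝒜N, (∀ x, ωN.form x = T.Ω.form (ι x)) →
        (∃! P : PoissonStructure E' N, P.IsInducedBy ωN) ∧
        ∀ P : PoissonStructure E' N, P.IsInducedBy ωN →
          (∃! 𝒞 : LieAlgebroid E' (E' →L[ℝ] ℝ) (fun x : N ↦ TangentSpace 𝓘(ℝ, E') x →L[ℝ] ℝ),
            𝒞.IsCotangent P) ∧
          ∀ 𝒞 : LieAlgebroid E' (E' →L[ℝ] ℝ) (fun x : N ↦ TangentSpace 𝓘(ℝ, E') x →L[ℝ] ℝ),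
            𝒞.IsCotangent P →
            (∃! lam : ∀ x : N, TangentSpace 𝓘(ℝ, E') x →L[ℝ] (ι *ᵖ V) x,
              T.IsSplitting ι 𝒜N lam) ∧
            ∀ lam : ∀ x : N, TangentSpace 𝓘(ℝ, E') x →L[ℝ] (ι *ᵖ V) x,
              T.IsSplitting ι 𝒜N lam →
              𝒜N.IsIsoOnSubalgebroid (T.restrictedE2L1 ι) 𝒞 (ωN.negPullContraction lam) := by
  have hι : 𝒜.IsInvariantImmersion ι := ⟨himm, fun x ↦ (htan x).superset⟩
  refine ⟨T.hasDecomposition,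
    ⟨hι.restrict, hι.isRestriction_restrict, fun _ h ↦ h.eq himm hι.isRestriction_restrict⟩,
    fun 𝒜N h𝒜N ↦ ⟨⟨T.Ω.restrict h𝒜N, fun _ ↦ rfl, fun ωN hωN ↦ SymplecticForm.ext hωN⟩,
      fun ωN hωN ↦ ⟨ωN.existsUnique_isInducedBy, fun P hP ↦ ?_⟩⟩⟩
  have hsplit := T.existsUnique_isSplitting h𝒜N himm htan
  have ⟨lam₀, hlam₀, _⟩ := hsplit
  refine ⟨ωN.existsUnique_isCotangent (fun x v ↦ (hlam₀ x v).2) hP,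
    fun 𝒞 h𝒞 ↦ ⟨hsplit, fun lam hlam ↦ ?_⟩⟩
  rw [T.restrictedE2L1_eq h𝒜N himm hωN]
  exact ωN.isIsoOnSubalgebroid_negPullContraction (fun x v ↦ (hlam x v).2) hP h𝒞

theorem mainTheorem3
    {E : Type*} [NormedAddCommGroup E] [NormedSpace ℝ E] [FiniteDimensional ℝ E]
    {M : Type u} [TopologicalSpace M] [ChartedSpace E M] [IsManifold 𝓘(ℝ, E) ∞ M]
    [T2Space M] [SecondCountableTopology M]
    {F : Type*} [NormedAddCommGroup F] [NormedSpace ℝ F] [FiniteDimensional ℝ F]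
    {V : M → Type*} [TopologicalSpace (TotalSpace F V)]
    [∀ x, AddCommGroup (V x)] [∀ x, Module ℝ (V x)] [∀ x, TopologicalSpace (V x)]
    [∀ x, IsTopologicalAddGroup (V x)] [∀ x, ContinuousSMul ℝ (V x)]
    [FiberBundle F V] [VectorBundle ℝ F V] [ContMDiffVectorBundle ∞ F V 𝓘(ℝ, E)]
    {E' : Type*} [NormedAddCommGroup E'] [NormedSpace ℝ E'] [FiniteDimensional ℝ E']
    {N : Type v} [TopologicalSpace N] [ChartedSpace E' N] [IsManifold 𝓘(ℝ, E') ∞ N]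
    [T2Space N] [SecondCountableTopology N]
    (𝒜 : LieAlgebroid E F V) (T : CompatibleTriple 𝒜)
    (ι : C^∞⟮𝓘(ℝ, E'), N; 𝓘(ℝ, E), M⟯) (hι : 𝒜.IsLeaf ι) :
    (∀ p : M, T.HasDecomposition p) ∧
    -- the restricted Lie algebroid `𝒜_N`
    (∃! 𝒜N : LieAlgebroid E' F (ι *ᵖ V), 𝒜.IsRestriction ι 𝒜N) ∧
    ∀ 𝒜N : LieAlgebroid E' F (ι *ᵖ V), 𝒜.IsRestriction ι 𝒜N →
      -- the restricted symplectic form `ω_N`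
      (∃! ωN : SymplecticForm 𝒜N, ∀ x, ωN.form x = T.Ω.form (ι x)) ∧
      ∀ ωN : SymplecticForm 𝒜N, (∀ x, ωN.form x = T.Ω.form (ι x)) →
        -- the induced Poisson structure on `N` and its cotangent Lie algebroid
        (∃! P : PoissonStructure E' N, P.IsInducedBy ωN) ∧
        ∀ P : PoissonStructure E' N, P.IsInducedBy ωN →
          (∃! 𝒞 : LieAlgebroid E' (E' →L[ℝ] ℝ) (fun x : N ↦ TangentSpace 𝓘(ℝ, E') x →L[ℝ] ℝ),
            𝒞.IsCotangent P) ∧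
          ∀ 𝒞 : LieAlgebroid E' (E' →L[ℝ] ℝ) (fun x : N ↦ TangentSpace 𝓘(ℝ, E') x →L[ℝ] ℝ),
            𝒞.IsCotangent P →
            -- the splitting `λ`, and the isomorphism `a ↦ -λ^*(i_a ω)`
            (∃! lam : ∀ x : N, TangentSpace 𝓘(ℝ, E') x →L[ℝ] (ι *ᵖ V) x,
              T.IsSplitting ι 𝒜N lam) ∧
            ∀ lam : ∀ x : N, TangentSpace 𝓘(ℝ, E') x →L[ℝ] (ι *ᵖ V) x,
              T.IsSplitting ι 𝒜N lam →
              𝒜N.IsIsoOnSubalgebroid (T.restrictedE2L1 ι) 𝒞 (ωN.negPullContraction lam) :=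
  mainTheorem3_general 𝒜 T ι hι.integral.immersion hι.integral.tangent
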